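/- Let $K$ be an imaginary quadratic field of class number $1$ and let $E/K$ be an elliptic curve whose conductor is a prime ideal $\mathfrak p$ of $\mathcal O_K$ and which has a $K$-rational point of order $2$. Then there is an elliptic curve $E'/K$, isogenous to $E$ over $K$, such that the valuation $v_{\mathfrak p}(\mathcal D_{\min}(E'))$ at $\mathfrak p$ of the minimal discriminant of $E'$ is odd. -/

import Mathlib

open scoped Classical NumberField
open IsDedekindDomain

noncomputable section

namespace EllipticConductor

variable {K : Type*} [Field K] [NumberField K]

/-! ### Torsion fields and wild ramification -/

/-- The `n`-division field `K(E[n])`: the subfield of the algebraic closure of `K` generated over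
`K` by the coordinates of all affine `n`-torsion points of `E`. -/
def divisionField (E : WeierstrassCurve K) (n : ℕ) : IntermediateField K (AlgebraicClosure K) :=
  IntermediateField.adjoin K
    {z | ∃ (x y : AlgebraicClosure K)
        (h : (E.baseChange (AlgebraicClosure K)).toAffine.Nonsingular x y),
        n • WeierstrassCurve.Affine.Point.some x y h = 0 ∧ (z = x ∨ z = y)}

/-- The group `E[n]`, as the `n`-torsion subgroup of the points of `E` over `K(E[n])`. -/
abbrev torsion (E : WeierstrassCurve K) (n : ℕ) :
    AddSubgroup (E.baseChange (divisionField E n)).toAffine.Point :=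
  AddSubgroup.torsionBy _ (n : ℤ)

instance torsionModule (E : WeierstrassCurve K) (n : ℕ) : Module (ZMod n) (torsion E n) :=
  AddSubgroup.torsionBy.zmodModule

/-- The subspace of `E[n]` fixed by a subgroup `G` of `Gal(K(E[n])/K)`. -/
def fixedTorsion (E : WeierstrassCurve K) (n : ℕ) (G : Subgroup Gal(divisionField E n/K)) :
    Submodule (ZMod n) (torsion E n) :=
  AddSubgroup.toZModSubmodule n
    { carrier := {P | ∀ σ ∈ G, WeierstrassCurve.Affine.Point.map (W' := E)
        (σ : divisionField E n →ₐ[K] divisionField E n) P.1 = P.1}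
      zero_mem' := fun σ _ => by simp
      add_mem' := fun {P Q} hP hQ σ hσ => by
        simp only [Set.mem_ofPred_eq] at hP hQ
        simp [hP σ hσ, hQ σ hσ]
      neg_mem' := fun {P} hP σ hσ => by
        simp only [Set.mem_ofPred_eq] at hP
        simp [hP σ hσ] }

/-- The ramification group `G_i` (lower numbering) of a prime `P` of the field `L` over `K`:
the automorphisms `σ` with `σ x ≡ x` modulo `P ^ (i + 1)` for all integers `x` of `L`. -/
def ramificationGroup {L : Type*} [Field L] [Algebra K L] (P : Ideal (𝓞 L)) (i : ℕ) :
    Subgroup Gal(L/K) :=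
  AddSubgroup.inertia (P ^ (i + 1)).toAddSubgroup Gal(L/K)

/-- A prime of the field `K(E[n])` above `v`. -/
def primeAbove (E : WeierstrassCurve K) (n : ℕ) (v : HeightOneSpectrum (𝓞 K)) :
    Ideal (𝓞 (divisionField E n)) :=
  (Classical.choice (Ideal.nonempty_primesOver (S := 𝓞 (divisionField E n)) v.asIdeal)).1

/-- A prime number different from the residue characteristic of `v`. -/
def auxPrime (v : HeightOneSpectrum (𝓞 K)) : ℕ :=
  if (2 : 𝓞 K) ∈ v.asIdeal then 3 else 2

/-- The wild part of the conductor exponent of `E` at `v`,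
`δ = ∑_{i ≥ 1} (|G_i| / |G_0|) * dim (E[ℓ] / E[ℓ] ^ G_i)`, where `ℓ` is a prime different from the
residue characteristic and `G_i` are the ramification groups of `K(E[ℓ])/K` at a prime above `v`.
It depends neither on `ℓ` nor on the prime above `v`, and it is an integer, so that the rounding
in the definition has no effect. -/
def wildExponent (E : WeierstrassCurve K) (v : HeightOneSpectrum (𝓞 K)) : ℕ :=
  let ℓ := auxPrime v
  let G : ℕ → Subgroup Gal(divisionField E ℓ/K) := ramificationGroup (primeAbove E ℓ v)
  ⌊∑ᶠ i : ℕ, (Nat.card (G (i + 1)) : ℚ) / Nat.card (G 0) *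
      Module.finrank (ZMod ℓ) (torsion E ℓ ⧸ fixedTorsion E ℓ (G (i + 1)))⌋₊

/-! ### Conductor and minimal discriminant -/

/-- A Weierstrass equation of `E` that is minimal at `v`. -/
abbrev minimalAt (E : WeierstrassCurve K) (v : HeightOneSpectrum (𝓞 K)) : WeierstrassCurve K :=
  E.minimal (v.valuation K).integer

/-- The exponent of the conductor of `E` at `v`: it is `0` if `E` has good reduction, `1` if `E` has
multiplicative reduction, and `2 + δ` if `E` has additive reduction, where `δ` measures the wild
ramification. -/
def conductorExponent (E : WeierstrassCurve K) (v : HeightOneSpectrum (𝓞 K)) : ℕ :=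
  if (minimalAt E v).HasGoodReduction (v.valuation K).integer then 0
  else if (minimalAt E v).HasMultiplicativeReduction (v.valuation K).integer then 1
  else 2 + wildExponent E v

/-- The conductor of `E`, an ideal of the ring of integers of `K`. -/
def conductor (E : WeierstrassCurve K) : Ideal (𝓞 K) :=
  ∏ᶠ v : HeightOneSpectrum (𝓞 K), v.asIdeal ^ conductorExponent E v

/-- The normalized additive valuation at `v` of the minimal discriminant of `E`. -/
def minimalDiscriminantValuation (E : WeierstrassCurve K) (v : HeightOneSpectrum (𝓞 K)) : ℤ :=
  -WithZero.log (v.valuation K (minimalAt E v).Δ)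

end EllipticConductor

/-! ### Isogenies -/

namespace EllipticIsogeny

variable {K : Type*} [Field K]

/-- The rational function `f` on the curve `W` has a pole at the point at infinity. For a nonzero
polynomial function `g`, the order of the pole of `g` at infinity is the degree in `X` of the norm
of `g` from the coordinate ring to `K[X]`; a rational function is a quotient `g / h`. -/
def HasPoleAtInfinity (W : WeierstrassCurve K) (f : W.toAffine.FunctionField) : Prop :=
  ∃ g h : W.toAffine.CoordinateRing, h ≠ 0 ∧
    f = algebraMap _ W.toAffine.FunctionField g / algebraMap _ W.toAffine.FunctionField h ∧
    (Algebra.norm (Polynomial K) h).natDegree < (Algebra.norm (Polynomial K) g).natDegree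

/-- The coordinate function `x` on the curve `W`. -/
def xFunction (W : WeierstrassCurve K) : W.toAffine.FunctionField :=
  algebraMap W.toAffine.CoordinateRing _ (algebraMap (Polynomial K) _ Polynomial.X)

/-- An isogeny `E → E'` over `K`, i.e. a nonconstant morphism of curves over `K` that maps the zero
of `E` to the zero of `E'`. Nonconstant morphisms of smooth projective curves correspond to
`K`-embeddings of the function fields in the opposite direction; as the only pole of the function
`x` on `E'` is the zero of `E'`, the zero of `E` is mapped there if and only if the pullback of `x`
has a pole at the zero of `E`. -/
structure Isogeny (E E' : WeierstrassCurve K) where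
  pullback : E'.toAffine.FunctionField →ₐ[K] E.toAffine.FunctionField
  map_zero : HasPoleAtInfinity E (pullback (xFunction E'))

/-- The curves `E` and `E'` are isogenous over `K`. -/
def IsIsogenous (E E' : WeierstrassCurve K) : Prop :=
  Nonempty (Isogeny E E')

end EllipticIsogeny

end

/-! Moving the 2-torsion point to the origin turns E into y² = x³ + a x² + b x, which is 2-isogenous
to the dual curve with coefficients (-2a, a² - 4b). At a prime of good or multiplicative reduction,
one of the two curves has an integral model y² + α₁xy = x³ + α₂x² + βx with D = (α₁² + 4α₂)² - 64β a
unit (`IntPair`), apart from one supersingular configuration above a ramified 2. Such a model has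
discriminant β²D and its 2-isogenous curve has discriminant βD², so the discriminant valuations at
the bad prime are 2k and k with k the valuation of β. This gives an odd valuation at once, unless
all the exponents that occur are even.

The supersingular configuration does not occur (`PrimeReduction.localTypes`). It would make both b
and a² - 4b congruent to 1 + 2l modulo 4 up to fourth powers. One of the two has all its valuations
divisible by 4, so by class number one it is a unit times a fourth power, and a unit of trace at
most 2 in absolute value is never congruent to 1 + 2l (`unit_not_congr`).

If all exponents are even, then b and a² - 4b are units times squares. At a prime above 2 the
integral model shows that a² - 4b or 16b is a square modulo 4 up to squares, and a unit that is a
square modulo 4 there is a square (`unit_eq_sq`). Hence E or its dual has full rational 2-torsion.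
The differences of the three abscissas sum to zero. Divided by their greatest common divisor they
are coprime integers with product 16 π^k times a unit, where k > 0 is the discriminant valuation of
a curve isogenous to E. By `unitEquation` this k is not even: comparing norms leaves only the near
misses N(s) = 15 and N(s) = 17, where s = π^(k/2). The first is no norm of a prime power, and the
second would put √-17 in K. So k is odd.

Isogenies are function field embeddings that preserve the pole at infinity. They are handled through
the valuation given by the degree of the norm, which yields composition and the explicit 2-isogeny.
-/

noncomputable section

/-! ### The valuation at infinity of the function field, and composition of isogenies -/

namespace EllipticIsogeny

open Polynomial WithZero WeierstrassCurve
open scoped Polynomial.Bivariate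

variable {K : Type*} [Field K]

instance (W : WeierstrassCurve K) : Module.Finite K[X] W.toAffine.CoordinateRing :=
  Module.Finite.of_basis (Affine.CoordinateRing.basis W.toAffine)

/-- The valuation on polynomials given by the degree. -/
def degreeValuation (K : Type*) [Field K] : Valuation K[X] ℤᵐ⁰ :=
  (RatFunc.inftyValuation K).comap (algebraMap K[X] (RatFunc K))

lemma degreeValuation_of_ne_zero {p : K[X]} (hp : p ≠ 0) :
    degreeValuation K p = exp (p.natDegree : ℤ) :=
  RatFunc.inftyValuation.polynomial K hp

lemma degreeValuation_norm_smul_basis (W : WeierstrassCurve K) (p q : K[X]) :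
    degreeValuation K (Algebra.norm K[X]
      (p • (1 : W.toAffine.CoordinateRing) + q • Affine.CoordinateRing.mk W.toAffine Y)) =
    max (degreeValuation K p ^ 2) (degreeValuation K q ^ 2 * exp 3) := by
  have hdeg := Affine.CoordinateRing.degree_norm_smul_basis (W' := W.toAffine) p q
  set N := Algebra.norm K[X]
      (p • (1 : W.toAffine.CoordinateRing) + q • Affine.CoordinateRing.mk W.toAffine Y)
  by_cases hp : p = 0
  · by_cases hq : q = 0
    · simp [N, hp, hq]
    · have hN : N ≠ 0 := by
        intro h
        rw [h] at hdeg
        simp [hp, degree_eq_natDegree hq] at hdeg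
        norm_cast at hdeg
      have : N.natDegree = 2 * q.natDegree + 3 := by
        apply natDegree_eq_of_degree_eq_some
        rw [hdeg, hp, degree_eq_natDegree hq]
        simp
      rw [degreeValuation_of_ne_zero hN, degreeValuation_of_ne_zero hq, this, hp, map_zero,
        ← exp_nsmul, ← exp_add]
      simp
  · by_cases hq : q = 0
    · have hN : N ≠ 0 := by
        intro h
        rw [h] at hdeg
        simp [hq, degree_eq_natDegree hp] at hdeg
        norm_cast at hdeg
      have : N.natDegree = 2 * p.natDegree := by
        apply natDegree_eq_of_degree_eq_some
        rw [hdeg, hq, degree_eq_natDegree hp]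
        simp
      rw [degreeValuation_of_ne_zero hN, degreeValuation_of_ne_zero hp, this, hq, map_zero,
        ← exp_nsmul]
      simp
    · rw [degree_eq_natDegree hp, degree_eq_natDegree hq] at hdeg
      have hdeg' : N.degree = ((max (2 * p.natDegree) (2 * q.natDegree + 3) : ℕ) : WithBot ℕ) := by
        rw [hdeg, Nat.mono_cast.map_max]
        simp
      have hN : N ≠ 0 := by
        intro h
        rw [h, degree_zero] at hdeg'
        exact absurd hdeg' (WithBot.bot_ne_natCast _)
      rw [degreeValuation_of_ne_zero hN, degreeValuation_of_ne_zero hp,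
        degreeValuation_of_ne_zero hq, natDegree_eq_of_degree_eq_some hdeg', ← exp_nsmul,
        ← exp_nsmul, ← exp_add]
      rcases le_total (2 * p.natDegree) (2 * q.natDegree + 3) with h | h
      · rw [max_eq_right h, max_eq_right]
        · simp
        · rw [exp_le_exp]; simp; omega
      · rw [max_eq_left h, max_eq_left]
        · simp
        · rw [exp_le_exp]; simp; omega

/-- The valuation at infinity on the coordinate ring. -/
def coordinateRingValuation (W : WeierstrassCurve K) :
    Valuation W.toAffine.CoordinateRing ℤᵐ⁰ where
  toFun g := degreeValuation K (Algebra.norm K[X] g)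
  map_zero' := by
    simp
  map_one' := by simp
  map_mul' := by simp
  -- In the basis 1, Y the value is a maximum of a term in p and a term in q, and each of these is
  -- ultrametric.
  map_add_le_max' g h := by
    obtain ⟨p, q, rfl⟩ := Affine.CoordinateRing.exists_smul_basis_eq g
    obtain ⟨p', q', rfl⟩ := Affine.CoordinateRing.exists_smul_basis_eq h
    have : p • (1 : W.toAffine.CoordinateRing) + q • Affine.CoordinateRing.mk W.toAffine Y +
        (p' • 1 + q' • Affine.CoordinateRing.mk W.toAffine Y) =
        (p + p') • 1 + (q + q') • Affine.CoordinateRing.mk W.toAffine Y := by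
      rw [add_smul, add_smul]; abel
    rw [this, degreeValuation_norm_smul_basis, degreeValuation_norm_smul_basis,
      degreeValuation_norm_smul_basis]
    have h1 := (degreeValuation K).map_add p p'
    have h2 := (degreeValuation K).map_add q q'
    rcases le_max_iff.mp h1 with h1 | h1 <;> rcases le_max_iff.mp h2 with h2 | h2 <;>
    · refine max_le ?_ ?_
      · have := pow_le_pow_left₀ zero_le h1 2
        simp only [le_max_iff, this, true_or, or_true]
      · have := mul_le_mul_left (pow_le_pow_left₀ zero_le h2 2) (exp (3 : ℤ))
        simp only [le_max_iff, this, true_or, or_true]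

lemma coordinateRingValuation_smul_basis (W : WeierstrassCurve K) (p q : K[X]) :
    coordinateRingValuation W
      (p • (1 : W.toAffine.CoordinateRing) + q • Affine.CoordinateRing.mk W.toAffine Y) =
    max (degreeValuation K p ^ 2) (degreeValuation K q ^ 2 * exp 3) :=
  degreeValuation_norm_smul_basis W p q

lemma norm_ne_zero_of_ne_zero {W : WeierstrassCurve K} {g : W.toAffine.CoordinateRing}
    (hg : g ≠ 0) : Algebra.norm K[X] g ≠ 0 :=
  Algebra.norm_ne_zero_iff.mpr hg

lemma coordinateRingValuation_of_ne_zero {W : WeierstrassCurve K}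
    {g : W.toAffine.CoordinateRing} (hg : g ≠ 0) :
    coordinateRingValuation W g = exp ((Algebra.norm K[X] g).natDegree : ℤ) :=
  degreeValuation_of_ne_zero (norm_ne_zero_of_ne_zero hg)

lemma coordinateRingValuation_supp (W : WeierstrassCurve K) :
    nonZeroDivisors W.toAffine.CoordinateRing ≤
      (coordinateRingValuation W).supp.primeCompl := by
  intro g hg h
  have hg' := nonZeroDivisors.ne_zero hg
  have : coordinateRingValuation W g = 0 := h
  rw [coordinateRingValuation_of_ne_zero hg'] at this
  exact exp_ne_zero this

/-- The valuation at infinity on the function field. -/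
def functionFieldValuation (W : WeierstrassCurve K) : Valuation W.toAffine.FunctionField ℤᵐ⁰ :=
  (coordinateRingValuation W).extendToLocalization (coordinateRingValuation_supp W) _

lemma functionFieldValuation_algebraMap (W : WeierstrassCurve K)
    (g : W.toAffine.CoordinateRing) :
    functionFieldValuation W (algebraMap _ _ g) = coordinateRingValuation W g :=
  Valuation.extendToLocalization_apply_map_apply _ _ _ _

lemma hasPoleAtInfinity_iff (W : WeierstrassCurve K) (f : W.toAffine.FunctionField) :
    HasPoleAtInfinity W f ↔ 1 < functionFieldValuation W f := by
  have key : ∀ g h : W.toAffine.CoordinateRing, g ≠ 0 → h ≠ 0 →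
      functionFieldValuation W (algebraMap _ _ g / algebraMap _ _ h) =
      exp (((Algebra.norm K[X] g).natDegree : ℤ) - ((Algebra.norm K[X] h).natDegree : ℤ)) := by
    intro g h hg hh
    rw [map_div₀, functionFieldValuation_algebraMap, functionFieldValuation_algebraMap,
      coordinateRingValuation_of_ne_zero hg, coordinateRingValuation_of_ne_zero hh, exp_sub]
  constructor
  · rintro ⟨g, h, hh, rfl, hlt⟩
    have hg : g ≠ 0 := by
      rintro rfl
      rw [Algebra.norm_zero] at hlt
      simp at hlt
    rw [key g h hg hh, ← exp_zero, exp_lt_exp]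
    omega
  · intro hf
    obtain ⟨g, h, hh, rfl⟩ := IsFractionRing.div_surjective (A := W.toAffine.CoordinateRing) f
    have hh := nonZeroDivisors.ne_zero hh
    have hg : g ≠ 0 := by
      rintro rfl
      simp at hf
    refine ⟨g, h, hh, rfl, ?_⟩
    rw [key g h hg hh, ← exp_zero, exp_lt_exp] at hf
    omega

instance (W : WeierstrassCurve K) : (functionFieldValuation W).IsTrivialOn K where
  eq_one a ha := by
    rw [IsScalarTower.algebraMap_apply K W.toAffine.CoordinateRing W.toAffine.FunctionField,
      functionFieldValuation_algebraMap]
    have : algebraMap K W.toAffine.CoordinateRing a =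
        (C a : K[X]) • (1 : W.toAffine.CoordinateRing) +
          (0 : K[X]) • Affine.CoordinateRing.mk W.toAffine Y := by
      rw [zero_smul, add_zero, Algebra.smul_def, mul_one]
      rfl
    rw [this, coordinateRingValuation_smul_basis, degreeValuation_of_ne_zero (C_ne_zero.mpr ha)]
    simp

/-- The coordinate function `y` on the curve `W`. -/
def yFunction (W : WeierstrassCurve K) : W.toAffine.FunctionField :=
  algebraMap W.toAffine.CoordinateRing _ (Affine.CoordinateRing.mk W.toAffine Y)

lemma functionFieldValuation_xFunction (W : WeierstrassCurve K) :
    functionFieldValuation W (xFunction W) = exp 2 := by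
  rw [xFunction, functionFieldValuation_algebraMap]
  have : algebraMap K[X] W.toAffine.CoordinateRing X =
      (X : K[X]) • (1 : W.toAffine.CoordinateRing) +
        (0 : K[X]) • Affine.CoordinateRing.mk W.toAffine Y := by
    rw [zero_smul, add_zero, Algebra.smul_def, mul_one]
  rw [this, coordinateRingValuation_smul_basis, degreeValuation_of_ne_zero X_ne_zero, ← exp_nsmul]
  simp

lemma functionFieldValuation_yFunction (W : WeierstrassCurve K) :
    functionFieldValuation W (yFunction W) = exp 3 := by
  rw [yFunction, functionFieldValuation_algebraMap]
  have : Affine.CoordinateRing.mk W.toAffine Y =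
      (0 : K[X]) • (1 : W.toAffine.CoordinateRing) +
        (1 : K[X]) • Affine.CoordinateRing.mk W.toAffine Y := by
    rw [zero_smul, zero_add, one_smul]
  rw [this, coordinateRingValuation_smul_basis]
  simp

/-- The Weierstrass equation of `W` holds for `x` and `y` in a `K`-algebra. -/
def SatisfiesEquation (W : WeierstrassCurve K) {L : Type*} [CommRing L] [Algebra K L] (x y : L) :
    Prop :=
  y ^ 2 + algebraMap K L W.a₁ * x * y + algebraMap K L W.a₃ * y =
    x ^ 3 + algebraMap K L W.a₂ * x ^ 2 + algebraMap K L W.a₄ * x + algebraMap K L W.a₆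

lemma satisfiesEquation_coordinateRing (W : WeierstrassCurve K) :
    SatisfiesEquation W (algebraMap K[X] W.toAffine.CoordinateRing X)
      (Affine.CoordinateRing.mk W.toAffine Y) := by
  have h : Affine.CoordinateRing.mk W.toAffine W.toAffine.polynomial = 0 := AdjoinRoot.mk_self
  simp only [Affine.polynomial] at h
  simp only [map_sub, map_add, map_mul, map_pow] at h
  rw [sub_eq_zero] at h
  have hc : ∀ c : K, algebraMap K W.toAffine.CoordinateRing c =
    Affine.CoordinateRing.mk W.toAffine (C (C c)) := fun c => rfl
  have hx : algebraMap K[X] W.toAffine.CoordinateRing X =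
    Affine.CoordinateRing.mk W.toAffine (C X) := rfl
  rw [SatisfiesEquation, hc, hc, hc, hc, hc, hx]
  linear_combination h

lemma SatisfiesEquation.map {W : WeierstrassCurve K} {L M : Type*} [CommRing L] [Algebra K L]
    [CommRing M] [Algebra K M] (f : L →ₐ[K] M) {x y : L} (h : SatisfiesEquation W x y) :
    SatisfiesEquation W (f x) (f y) := by
  have := congrArg f h
  simpa [SatisfiesEquation] using this

lemma satisfiesEquation_functionField (W : WeierstrassCurve K) :
    SatisfiesEquation W (xFunction W) (yFunction W) :=
  (satisfiesEquation_coordinateRing W).map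
    (IsScalarTower.toAlgHom K W.toAffine.CoordinateRing W.toAffine.FunctionField)

/-- The homomorphism from the coordinate ring given by a solution of the equation. -/
def coordinateRingLift (W : WeierstrassCurve K) {L : Type*} [CommRing L] [Algebra K L] (x y : L)
    (h : SatisfiesEquation W x y) : W.toAffine.CoordinateRing →ₐ[K] L :=
  AdjoinRoot.liftAlgHom W.toAffine.polynomial (aeval x) y (by
    rw [Affine.polynomial]
    simp only [SatisfiesEquation] at h
    simp [eval₂_add, eval₂_sub, eval₂_mul, eval₂_pow]
    linear_combination h)

lemma coordinateRingLift_x (W : WeierstrassCurve K) {L : Type*} [CommRing L] [Algebra K L]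
    (x y : L) (h : SatisfiesEquation W x y) :
    coordinateRingLift W x y h (algebraMap K[X] _ X) = x := by
  have : algebraMap K[X] W.toAffine.CoordinateRing X = AdjoinRoot.of _ X := rfl
  rw [this, coordinateRingLift, AdjoinRoot.liftAlgHom_of, aeval_X]

lemma valuation_y_sq {W : WeierstrassCurve K} {L : Type*} [Field L] [Algebra K L]
    (V : Valuation L ℤᵐ⁰) [V.IsTrivialOn K] {x y : L} (h : SatisfiesEquation W x y)
    (hx : 1 < V x) : V y ^ 2 = V x ^ 3 := by
  have hc : ∀ c : K, V (algebraMap K L c) ≤ 1 :=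
    fun c => Valuation.IsTrivialOn.valuation_algebraMap_le_one (A := K) (v := V) c
  have hx0 : 0 < V x := lt_trans zero_lt_one hx
  have hR : V (x ^ 3 + algebraMap K L W.a₂ * x ^ 2 + algebraMap K L W.a₄ * x +
      algebraMap K L W.a₆) = V x ^ 3 := by
    set p : K[X] := C 1 * X ^ 3 + C W.a₂ * X ^ 2 + C W.a₄ * X + C W.a₆ with hp
    have hdeg : p.natDegree = 3 := natDegree_cubic one_ne_zero
    have hp0 : p ≠ 0 := by
      intro h0
      rw [h0] at hdeg
      simp at hdeg
    have := Polynomial.valuation_aeval_eq_valuation_X_pow_natDegree_of_one_lt_valuation_X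
      (v := V) x hx hp0
    rw [hdeg] at this
    rw [← this]
    simp [hp]
  rw [← h] at hR
  have h12 : V x < V x ^ 2 := lt_self_pow₀ hx one_lt_two
  have h23 : V x ^ 2 < V x ^ 3 := pow_lt_pow_right₀ hx (by norm_num)
  -- If V y ≤ V x, every term on the left is at most V x ^ 2, too small to equal V x ^ 3.
  have hy : V x < V y := by
    by_contra hle
    push Not at hle
    apply absurd hR
    apply ne_of_lt
    refine lt_of_le_of_lt ?_ h23
    refine V.map_add_le (V.map_add_le ?_ ?_) ?_
    · rw [map_pow]; exact pow_le_pow_left₀ zero_le hle 2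
    · rw [map_mul, map_mul, sq]
      exact mul_le_mul' (mul_le_of_le_one_left zero_le (hc _)) hle
    · rw [map_mul]
      exact (mul_le_of_le_one_left zero_le (hc _)).trans (hle.trans h12.le)
  have hy0 : 0 < V y := hx0.trans hy
  have h1 : V (algebraMap K L W.a₁ * x * y) < V (y ^ 2) := by
    rw [map_mul, map_mul, map_pow, sq]
    refine mul_lt_mul_of_pos_right ?_ hy0
    exact (mul_le_of_le_one_left zero_le (hc _)).trans_lt hy
  have h2 : V (algebraMap K L W.a₃ * y) < V (y ^ 2) := by
    rw [map_mul, map_pow, sq]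
    refine mul_lt_mul_of_pos_right ?_ hy0
    exact (hc _).trans_lt (hx.trans hy)
  have h3 := V.map_add_eq_of_lt_left h1
  rw [V.map_add_eq_of_lt_left (h3 ▸ h2), h3, map_pow] at hR
  exact hR

/-- A valuation that is trivial on constants and has a pole at x is forced to be a power of the
valuation at infinity: y weighs 3/2 of x, so the two terms of p + qy never have equal nonzero
weight. Squaring avoids the half-integral exponent. This gives both injectivity of pullbacks and
preservation of poles. -/
lemma valuation_coordinateRing_sq {W : WeierstrassCurve K} {L : Type*} [Field L] [Algebra K L]
    (V : Valuation L ℤᵐ⁰) [V.IsTrivialOn K] (ψ : W.toAffine.CoordinateRing →ₐ[K] L)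
    (hx : 1 < V (ψ (algebraMap K[X] _ X))) (g : W.toAffine.CoordinateRing) :
    V (ψ g) ^ 2 = coordinateRingValuation W g ^ log (V (ψ (algebraMap K[X] _ X))) := by
  have hy := valuation_y_sq V ((satisfiesEquation_coordinateRing W).map ψ) hx
  set x := ψ (algebraMap K[X] _ X) with hxdef
  set y := ψ (Affine.CoordinateRing.mk W.toAffine Y) with hydef
  have hVx : V x ≠ 0 := (zero_lt_one.trans hx).ne'
  have hVy : V y ≠ 0 := by
    intro h0
    rw [h0, zero_pow two_ne_zero] at hy
    exact pow_ne_zero 3 hVx hy.symm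
  set c := log (V x) with hc
  have hcx : V x = exp c := (exp_log hVx).symm
  have hc0 : 0 < c := by rw [hcx, ← exp_zero, exp_lt_exp] at hx; exact hx
  obtain ⟨p, q, rfl⟩ := Affine.CoordinateRing.exists_smul_basis_eq g
  have hψ : ∀ p : K[X], ψ (p • (1 : W.toAffine.CoordinateRing)) = aeval x p := by
    intro p
    rw [Algebra.smul_def, mul_one]
    have := aeval_algHom_apply (ψ.comp (IsScalarTower.toAlgHom K K[X] _)) X p
    simpa [hxdef] using this.symm
  have hpol : ∀ p : K[X], V (aeval x p) ^ 2 = (degreeValuation K p ^ 2) ^ c := by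
    intro p
    by_cases hp : p = 0
    · simp [hp, zero_zpow c hc0.ne']
    · rw [Polynomial.valuation_aeval_eq_valuation_X_pow_natDegree_of_one_lt_valuation_X (v := V)
        x hx hp, degreeValuation_of_ne_zero hp, hcx, ← exp_nsmul, ← exp_nsmul, ← exp_nsmul,
        ← exp_zsmul]
      congr 1
      simp only [nsmul_eq_mul, smul_eq_mul]
      push_cast
      ring
  have hmap : ψ (p • (1 : W.toAffine.CoordinateRing) +
      q • Affine.CoordinateRing.mk W.toAffine Y) = aeval x p + aeval x q * y := by
    rw [map_add, hψ, ← hψ q, hydef, ← map_mul, smul_mul_assoc, one_mul]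
  have hy' : V y ^ 2 = exp 3 ^ c := by
    rw [hy, hcx, ← exp_nsmul, ← exp_zsmul]
    congr 1
    simp only [nsmul_eq_mul, smul_eq_mul]
    push_cast
    ring
  have hq : V (aeval x q * y) ^ 2 = (degreeValuation K q ^ 2 * exp 3) ^ c := by
    rw [map_mul, mul_pow, hpol, hy', mul_zpow]
  rw [coordinateRingValuation_smul_basis, hmap]
  have hmono : ∀ a b : ℤᵐ⁰, a < b → a ^ c < b ^ c := by
    intro a b hab
    obtain ⟨n, hn⟩ := Int.eq_ofNat_of_zero_le hc0.le
    rw [hn]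
    simp only [zpow_natCast]
    exact pow_lt_pow_left₀ hab zero_le (by omega)
  have hlt : ∀ a b : ℤᵐ⁰, a ^ 2 < b ^ 2 → a < b := fun a b h => lt_of_pow_lt_pow_left₀ 2 zero_le h
  rcases lt_trichotomy (degreeValuation K p ^ 2) (degreeValuation K q ^ 2 * exp 3) with h | h | h
  · rw [max_eq_right h.le, V.map_add_eq_of_lt_right, hq]
    apply hlt
    rw [hpol, hq]
    exact hmono _ _ h
  -- Equality of nonzero weights would read 2 deg p = 2 deg q + 3, which parity forbids.
  · have hp0 : p = 0 := by
      by_contra hp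
      have hq0 : q ≠ 0 := by
        rintro rfl
        rw [degreeValuation_of_ne_zero hp] at h
        simp at h
      rw [degreeValuation_of_ne_zero hp, degreeValuation_of_ne_zero hq0, ← exp_nsmul,
        ← exp_nsmul, ← exp_add, exp_inj] at h
      simp at h
      omega
    rw [hp0, map_zero, zero_add, hq, map_zero, zero_pow two_ne_zero, max_eq_right zero_le]
  · rw [max_eq_left h.le, V.map_add_eq_of_lt_left, hpol]
    apply hlt
    rw [hpol, hq]
    exact hmono _ _ h

lemma coordinateRingHom_injective {W : WeierstrassCurve K} {L : Type*} [Field L] [Algebra K L]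
    (V : Valuation L ℤᵐ⁰) [V.IsTrivialOn K] (ψ : W.toAffine.CoordinateRing →ₐ[K] L)
    (hx : 1 < V (ψ (algebraMap K[X] _ X))) : Function.Injective ψ := by
  rw [injective_iff_map_eq_zero]
  intro g hg
  by_contra hg0
  have h := valuation_coordinateRing_sq V ψ hx g
  rw [hg, map_zero, zero_pow two_ne_zero, coordinateRingValuation_of_ne_zero hg0] at h
  exact zpow_ne_zero _ exp_ne_zero h.symm

/-- A solution of the equation of `E'` in the function field of `E` whose first coordinate has a
pole at infinity gives an isogeny. -/
lemma isIsogenous_of_solution {E E' : WeierstrassCurve K} {x y : E.toAffine.FunctionField}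
    (h : SatisfiesEquation E' x y) (hx : 1 < functionFieldValuation E x) : IsIsogenous E E' := by
  set ψ := coordinateRingLift E' x y h with hψ
  have hψx : ψ (algebraMap K[X] _ X) = x := coordinateRingLift_x E' x y h
  have hinj : Function.Injective ψ :=
    coordinateRingHom_injective (functionFieldValuation E) ψ (by rw [hψx]; exact hx)
  refine ⟨⟨IsFractionRing.liftAlgHom (K := E'.toAffine.FunctionField) hinj, ?_⟩⟩
  rw [hasPoleAtInfinity_iff, xFunction, IsFractionRing.liftAlgHom_apply,
    IsFractionRing.lift_algebraMap]
  change 1 < functionFieldValuation E (ψ _)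
  rw [hψx]
  exact hx

/-- The definition of an isogeny only constrains the pullback of x. Since that determines the
valuation of every pullback up to a positive exponent, all poles at infinity survive, and this makes
isogenies compose. -/
lemma Isogeny.one_lt_valuation {E E' : WeierstrassCurve K} (φ : Isogeny E E')
    {f : E'.toAffine.FunctionField} (hf : 1 < functionFieldValuation E' f) :
    1 < functionFieldValuation E (φ.pullback f) := by
  have hx := (hasPoleAtInfinity_iff _ _).mp φ.map_zero
  set V := functionFieldValuation E
  set ψ : E'.toAffine.CoordinateRing →ₐ[K] E.toAffine.FunctionField :=
    φ.pullback.comp (IsScalarTower.toAlgHom K E'.toAffine.CoordinateRing E'.toAffine.FunctionField)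
  have hx' : 1 < V (ψ (algebraMap K[X] _ X)) := hx
  set c := log (V (ψ (algebraMap K[X] _ X))) with hc
  have hc0 : 0 < c := by
    rw [← exp_log (zero_lt_one.trans hx').ne', ← exp_zero, exp_lt_exp] at hx'
    exact hx'
  have key : V (φ.pullback f) ^ 2 = functionFieldValuation E' f ^ c := by
    obtain ⟨g, h, hh, rfl⟩ := IsFractionRing.div_surjective (A := E'.toAffine.CoordinateRing) f
    rw [map_div₀, map_div₀, map_div₀, div_pow, div_zpow, functionFieldValuation_algebraMap,
      functionFieldValuation_algebraMap, ← valuation_coordinateRing_sq V ψ hx',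
      ← valuation_coordinateRing_sq V ψ hx']
    rfl
  have h1 : 1 < V (φ.pullback f) ^ 2 := by
    rw [key]
    exact one_lt_zpow₀ hf hc0
  by_contra hle
  push Not at hle
  exact absurd h1 (not_lt.mpr (pow_le_one₀ zero_le hle))

lemma IsIsogenous.trans {E E' E'' : WeierstrassCurve K} (h : IsIsogenous E E')
    (h' : IsIsogenous E' E'') : IsIsogenous E E'' := by
  obtain ⟨φ⟩ := h
  obtain ⟨φ'⟩ := h'
  have hpole : HasPoleAtInfinity E (φ.pullback (φ'.pullback (xFunction E''))) :=
    (hasPoleAtInfinity_iff _ _).mpr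
      (φ.one_lt_valuation ((hasPoleAtInfinity_iff _ _).mp φ'.map_zero))
  exact ⟨{ pullback := φ.pullback.comp φ'.pullback, map_zero := hpole }⟩

/-! ### Changes of variables and the explicit 2-isogeny -/

lemma valuation_algebraMap_eq_one (E : WeierstrassCurve K) {c : K} (hc : c ≠ 0) :
    functionFieldValuation E (algebraMap K _ c) = 1 :=
  Valuation.IsTrivialOn.eq_one (v := functionFieldValuation E) c hc

lemma SatisfiesEquation.variableChange {E : WeierstrassCurve K} {L : Type*} [CommRing L]
    [Algebra K L] {x y : L} (h : SatisfiesEquation E x y) (C : VariableChange K) :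
    SatisfiesEquation (C • E) (algebraMap K L (C.u⁻¹ : Kˣ) ^ 2 * (x - algebraMap K L C.r))
      (algebraMap K L (C.u⁻¹ : Kˣ) ^ 3 *
        (y - algebraMap K L C.s * (x - algebraMap K L C.r) - algebraMap K L C.t)) := by
  unfold SatisfiesEquation at h ⊢
  rw [variableChange_a₁, variableChange_a₂, variableChange_a₃, variableChange_a₄,
    variableChange_a₆]
  simp only [map_mul, map_add, map_sub, map_pow, map_ofNat]
  linear_combination (algebraMap K L (C.u⁻¹ : Kˣ)) ^ 6 * h

lemma isIsogenous_variableChange (E : WeierstrassCurve K) (C : VariableChange K) :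
    IsIsogenous E (C • E) := by
  refine isIsogenous_of_solution ((satisfiesEquation_functionField E).variableChange C) ?_
  rw [map_mul, map_pow, valuation_algebraMap_eq_one E (Units.ne_zero _), one_pow, one_mul,
    sub_eq_add_neg, Valuation.map_add_eq_of_lt_left, functionFieldValuation_xFunction, ← exp_zero,
    exp_lt_exp]
  · norm_num
  · rw [Valuation.map_neg, functionFieldValuation_xFunction]
    refine (Valuation.IsTrivialOn.valuation_algebraMap_le_one (A := K)
      (v := functionFieldValuation E) C.r).trans_lt ?_
    rw [← exp_zero, exp_lt_exp]
    norm_num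

/-- The curve `y² = x³ + a x² + b x`. -/
def twoTorsionCurve (a b : K) : WeierstrassCurve K := ⟨0, a, 0, b, 0⟩

/-- The classical formulas for the quotient by the point (0, 0). -/
lemma SatisfiesEquation.twoIsogeny {a b : K} {L : Type*} [Field L]
    [Algebra K L] {x y : L} (h : SatisfiesEquation (twoTorsionCurve a b) x y) (hx : x ≠ 0) :
    SatisfiesEquation (twoTorsionCurve (-2 * a) (a ^ 2 - 4 * b)) (y ^ 2 / x ^ 2)
      (y * (algebraMap K L b - x ^ 2) / x ^ 2) := by
  have h : y ^ 2 = x ^ 3 + algebraMap K L a * x ^ 2 + algebraMap K L b * x := by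
    unfold SatisfiesEquation at h
    simpa [twoTorsionCurve] using h
  unfold SatisfiesEquation
  simp only [twoTorsionCurve, map_zero, map_mul, map_sub, map_pow, map_ofNat, map_neg]
  generalize algebraMap K L a = a at *
  generalize algebraMap K L b = b at *
  field_simp
  have h4 : y ^ 4 = (x ^ 3 + a * x ^ 2 + b * x) ^ 2 := by rw [← h]; ring
  have h6 : y ^ 6 = (x ^ 3 + a * x ^ 2 + b * x) ^ 3 := by rw [← h]; ring
  ring_nf
  simp only [h, h4, h6]
  ring

lemma isIsogenous_twoTorsionCurve (a b : K) :
    IsIsogenous (twoTorsionCurve a b) (twoTorsionCurve (-2 * a) (a ^ 2 - 4 * b)) := by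
  have hVx := functionFieldValuation_xFunction (twoTorsionCurve a b)
  have hVy := functionFieldValuation_yFunction (twoTorsionCurve a b)
  have hx0 : xFunction (twoTorsionCurve a b) ≠ 0 := by
    intro h0
    rw [h0, map_zero] at hVx
    exact exp_ne_zero hVx.symm
  refine isIsogenous_of_solution ((satisfiesEquation_functionField _).twoIsogeny hx0) ?_
  rw [map_div₀, map_pow, map_pow, hVx, hVy, ← exp_nsmul, ← exp_nsmul, ← exp_sub, ← exp_zero,
    exp_lt_exp]
  norm_num

end EllipticIsogeny

/-! ### Norms, traces and units of an imaginary quadratic field -/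

namespace ImaginaryQuadratic

open NumberField

variable {K : Type*} [Field K] [NumberField K]

/-- The norm of an algebraic integer, as an integer. -/
def nm (x : 𝓞 K) : ℤ := Algebra.norm ℤ x

/-- The trace of an algebraic integer, as an integer. -/
def tr (x : 𝓞 K) : ℤ := Algebra.trace ℤ (𝓞 K) x

/-- The conjugate of an integer of a quadratic field. -/
def conj (x : 𝓞 K) : 𝓞 K := (tr x : 𝓞 K) - x

/-- The predicate that `K` is an imaginary quadratic field. -/
structure IsImaginaryQuadratic (K : Type*) [Field K] [NumberField K] : Prop where
  finrank_eq_two : Module.finrank ℚ K = 2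
  totallyComplex : IsTotallyComplex K

omit [NumberField K] in
lemma nm_mul (x y : 𝓞 K) : nm (x * y) = nm x * nm y := map_mul _ _ _

omit [NumberField K] in
lemma nm_pow (x : 𝓞 K) (n : ℕ) : nm (x ^ n) = nm x ^ n := map_pow _ _ _

omit [NumberField K] in
lemma nm_one : nm (1 : 𝓞 K) = 1 := map_one _

omit [NumberField K] in
lemma tr_add (x y : 𝓞 K) : tr (x + y) = tr x + tr y := map_add _ _ _

omit [NumberField K] in
lemma tr_neg (x : 𝓞 K) : tr (-x) = - tr x := map_neg _ _

omit [NumberField K] in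
lemma tr_intCast_mul (n : ℤ) (x : 𝓞 K) : tr ((n : 𝓞 K) * x) = n * tr x := by
  rw [tr, ← zsmul_eq_mul, map_zsmul, smul_eq_mul, tr]

omit [NumberField K] in
lemma nm_dvd_of_dvd {x y : 𝓞 K} (h : x ∣ y) : nm x ∣ nm y := map_dvd _ h

namespace IsImaginaryQuadratic

variable (hK : IsImaginaryQuadratic K)

/-- A complex embedding and its conjugate are distinct, hence are all the embeddings. Identities
between norms, traces and conjugates can therefore be checked in ℂ. -/
lemma exists_embedding (hK : IsImaginaryQuadratic K) : ∃ φ : K →+* ℂ, ∀ x : 𝓞 K,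
    (nm x : ℂ) = φ x * starRingEnd ℂ (φ x) ∧ (tr x : ℂ) = φ x + starRingEnd ℂ (φ x) := by
  obtain ⟨w⟩ := (inferInstance : Nonempty (InfinitePlace K))
  have hw := InfinitePlace.isComplex_iff.mp (hK.totallyComplex.isComplex w)
  set φ := w.embedding
  rw [ComplexEmbedding.isReal_iff] at hw
  let φ₁ : K →ₐ[ℚ] ℂ := φ.toRatAlgHom
  let φ₂ : K →ₐ[ℚ] ℂ := (ComplexEmbedding.conjugate φ).toRatAlgHom
  have hne : φ₁ ≠ φ₂ := by
    intro h
    apply hw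
    ext x
    exact (DFunLike.congr_fun h x).symm
  have huniv : (Finset.univ : Finset (K →ₐ[ℚ] ℂ)) = {φ₁, φ₂} := by
    symm
    apply Finset.eq_univ_of_card
    rw [Finset.card_pair hne, AlgHom.card, hK.finrank_eq_two]
  refine ⟨φ, fun x => ⟨?_, ?_⟩⟩
  · have h := Algebra.norm_eq_prod_embeddings ℚ ℂ (x : K)
    rw [huniv, Finset.prod_pair hne, ← Algebra.coe_norm_int] at h
    simpa [φ₁, φ₂, nm] using h
  · have h := trace_eq_sum_embeddings (K := ℚ) ℂ (x := (x : K))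
    rw [huniv, Finset.sum_pair hne, ← Algebra.coe_trace_int] at h
    simpa [φ₁, φ₂, tr] using h

include hK

lemma sq_eq (x : 𝓞 K) : x ^ 2 = tr x * x - nm x := by
  obtain ⟨φ, hφ⟩ := hK.exists_embedding
  apply RingOfIntegers.coe_injective
  apply φ.injective
  simp [(hφ x).1, (hφ x).2]
  ring

lemma mul_conj (x : 𝓞 K) : x * conj x = nm x := by
  rw [conj]
  linear_combination -hK.sq_eq x

/-- The difference is four times the square of the imaginary part. This is the archimedean input
behind the later norm estimates and the finite list of traces of units. -/
lemma four_nm_sub (x : 𝓞 K) : tr x ^ 2 ≤ 4 * nm x := by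
  obtain ⟨φ, hφ⟩ := hK.exists_embedding
  obtain ⟨hn, ht⟩ := hφ x
  rw [Complex.mul_conj, Complex.normSq_apply] at hn
  rw [Complex.add_conj] at ht
  have hn : (nm x : ℝ) = (φ x).re * (φ x).re + (φ x).im * (φ x).im := by exact_mod_cast hn
  have ht : (tr x : ℝ) = 2 * (φ x).re := by exact_mod_cast ht
  have : (tr x : ℝ) ^ 2 ≤ 4 * (nm x : ℝ) := by
    rw [hn, ht]
    nlinarith [sq_nonneg (φ x).im]
  exact_mod_cast this

lemma nm_nonneg (x : 𝓞 K) : 0 ≤ nm x := by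
  have := hK.four_nm_sub x
  nlinarith [sq_nonneg (tr x)]

lemma nm_pos {x : 𝓞 K} (hx : x ≠ 0) : 0 < nm x :=
  lt_of_le_of_ne (hK.nm_nonneg x) (Algebra.norm_ne_zero_iff.mpr hx).symm

lemma tr_intCast (n : ℤ) : tr (n : 𝓞 K) = 2 * n := by
  obtain ⟨φ, hφ⟩ := hK.exists_embedding
  have h := (hφ n).2
  apply Int.cast_injective (α := ℂ)
  rw [h]
  simp
  ring

lemma nm_intCast (n : ℤ) : nm (n : 𝓞 K) = n ^ 2 := by
  obtain ⟨φ, hφ⟩ := hK.exists_embedding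
  have h := (hφ n).1
  apply Int.cast_injective (α := ℂ)
  rw [h]
  simp
  ring

lemma tr_sq (x : 𝓞 K) : tr (x ^ 2) = tr x ^ 2 - 2 * nm x := by
  rw [hK.sq_eq, sub_eq_add_neg, tr_add, tr_neg, tr_intCast_mul, hK.tr_intCast]
  ring

lemma nm_neg (x : 𝓞 K) : nm (-x) = nm x := by
  have : nm (-1 : 𝓞 K) = 1 := by
    have := hK.nm_intCast (-1)
    simpa using this
  rw [neg_eq_neg_one_mul, nm_mul, this, one_mul]

lemma nm_conj (x : 𝓞 K) : nm (conj x) = nm x := by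
  obtain ⟨φ, hφ⟩ := hK.exists_embedding
  have h := (hφ (conj x)).1
  apply Int.cast_injective (α := ℂ)
  rw [h, (hφ x).1]
  simp [conj, (hφ x).2]
  ring

lemma nm_add (x y : 𝓞 K) : nm (x + y) = nm x + nm y + tr (x * conj y) := by
  obtain ⟨φ, hφ⟩ := hK.exists_embedding
  apply Int.cast_injective (α := ℂ)
  push_cast
  rw [(hφ (x + y)).1, (hφ x).1, (hφ y).1, (hφ (x * conj y)).2]
  simp [conj, (hφ y).2]
  ring

lemma conj_mul (x y : 𝓞 K) : conj (x * y) = conj x * conj y := by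
  obtain ⟨φ, hφ⟩ := hK.exists_embedding
  apply RingOfIntegers.coe_injective
  apply φ.injective
  simp [conj, (hφ x).2, (hφ y).2, (hφ (x * y)).2]

/-- The product of two discriminants is a square. -/
lemma disc_mul_disc (x y : 𝓞 K) :
    ∃ m : ℤ, (tr x ^ 2 - 4 * nm x) * (tr y ^ 2 - 4 * nm y) = m ^ 2 := by
  -- Each factor is an element minus its conjugate, so z is fixed by conjugation; m is half the
  -- trace of z.
  set z : 𝓞 K := (x + x - tr x) * (y + y - tr y) with hz
  have hz2 : z ^ 2 = ((tr x ^ 2 - 4 * nm x) * (tr y ^ 2 - 4 * nm y) : ℤ) := by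
    push_cast
    have h1 := hK.sq_eq x
    have h2 := hK.sq_eq y
    have e1 : (x + x - (tr x : 𝓞 K)) ^ 2 = tr x ^ 2 - 4 * nm x := by
      linear_combination 4 * h1
    have e2 : (y + y - (tr y : 𝓞 K)) ^ 2 = tr y ^ 2 - 4 * nm y := by
      linear_combination 4 * h2
    rw [hz, mul_pow, e1, e2]
  obtain ⟨φ, hφ⟩ := hK.exists_embedding
  have hzt : (tr z : 𝓞 K) = z + z := by
    apply RingOfIntegers.coe_injective
    apply φ.injective
    have hx := (hφ x).2
    have hy := (hφ y).2
    have hzv : φ z = (φ x + φ x - tr x) * (φ y + φ y - tr y) := by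
      rw [hz]
      simp
    have hzc := (hφ z).2
    rw [hzv, hx, hy] at hzc
    have goal : (tr z : ℂ) = φ z + φ z := by
      rw [hzc, hzv, hx, hy]
      simp
      ring
    simpa using goal
  set D := (tr x ^ 2 - 4 * nm x) * (tr y ^ 2 - 4 * nm y)
  have h4 : tr z ^ 2 = 4 * D := by
    have : ((tr z ^ 2 : ℤ) : 𝓞 K) = ((4 * D : ℤ) : 𝓞 K) := by
      push_cast
      rw [hzt, ← hz2]
      ring
    exact_mod_cast this
  have heven : Even (tr z) := by
    have : Even (tr z ^ 2) := by rw [h4]; exact ⟨2 * D, by ring⟩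
    exact (Int.even_pow.mp this).1
  obtain ⟨m, hm⟩ := heven
  refine ⟨m, ?_⟩
  rw [hm] at h4
  linarith

lemma nm_of_isUnit {u : 𝓞 K} (hu : IsUnit u) : nm u = 1 := by
  have h1 : IsUnit (nm u) := hu.map (Algebra.norm ℤ)
  have h2 := hK.nm_nonneg u
  rcases Int.isUnit_iff.mp h1 with h | h <;> omega

lemma isUnit_of_nm {u : 𝓞 K} (hu : nm u = 1) : IsUnit u := by
  refine IsUnit.of_mul_eq_one (conj u) ?_
  rw [hK.mul_conj, hu, Int.cast_one]

lemma tr_of_isUnit {u : 𝓞 K} (hu : IsUnit u) : -2 ≤ tr u ∧ tr u ≤ 2 := by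
  have h := hK.four_nm_sub u
  rw [hK.nm_of_isUnit hu] at h
  constructor <;> nlinarith

lemma eq_of_tr_eq_two {u : 𝓞 K} (hu : nm u = 1) (ht : tr u = 2) : u = 1 := by
  have h := hK.sq_eq u
  rw [hu, ht] at h
  have : (u - 1) ^ 2 = 0 := by
    push_cast at h
    linear_combination h
  exact sub_eq_zero.mp (pow_eq_zero_iff two_ne_zero |>.mp this)

lemma eq_of_tr_eq_neg_two {u : 𝓞 K} (hu : nm u = 1) (ht : tr u = -2) : u = -1 := by
  have h := hK.sq_eq u
  rw [hu, ht] at h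
  have : (u + 1) ^ 2 = 0 := by
    push_cast at h
    linear_combination h
  exact eq_neg_of_add_eq_zero_left (pow_eq_zero_iff two_ne_zero |>.mp this)

lemma nm_one_sub (x : 𝓞 K) : nm (1 - x) = 1 - tr x + nm x := by
  have h := hK.nm_add 1 (-x)
  rw [← sub_eq_add_neg, hK.nm_neg, nm_one] at h
  rw [h, one_mul, conj]
  have : tr ((tr (-x) : 𝓞 K) - -x) = - tr x := by
    rw [sub_neg_eq_add, tr_add, hK.tr_intCast, tr_neg]
    ring
  rw [this]
  ring

end IsImaginaryQuadratic

end ImaginaryQuadratic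

/-! ### Additive valuations, and elements whose valuations are divisible by m -/

namespace AdditiveValuation

open WithZero HeightOneSpectrum

variable {R : Type*} [CommRing R] [IsDedekindDomain R] {K : Type*} [Field K] [Algebra R K]
  [IsFractionRing R K] (v : HeightOneSpectrum R)

/-- The normalized additive valuation at `v`. -/
def ord (x : K) : ℤ := -log (v.valuation K x)

variable {v}

lemma valuation_eq_exp {x : K} (hx : x ≠ 0) : v.valuation K x = exp (-ord v x) := by
  rw [ord, neg_neg, exp_log ((v.valuation K).ne_zero_iff.mpr hx)]

lemma ord_eq_iff {x : K} (hx : x ≠ 0) {n : ℤ} : ord v x = n ↔ v.valuation K x = exp (-n) := by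
  rw [valuation_eq_exp hx, exp_inj, neg_inj]

lemma ord_mul {x y : K} (hx : x ≠ 0) (hy : y ≠ 0) : ord v (x * y) = ord v x + ord v y := by
  rw [ord_eq_iff (mul_ne_zero hx hy), map_mul, valuation_eq_exp hx, valuation_eq_exp hy, ← exp_add]
  congr 1
  ring

lemma ord_one : ord v (1 : K) = 0 := by simp [ord]

lemma ord_neg (x : K) : ord v (-x) = ord v x := by simp [ord, Valuation.map_neg]

lemma ord_inv (x : K) : ord v x⁻¹ = -ord v x := by
  simp [ord, log_inv]

lemma ord_div {x y : K} (hx : x ≠ 0) (hy : y ≠ 0) : ord v (x / y) = ord v x - ord v y := by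
  rw [div_eq_mul_inv, ord_mul hx (inv_ne_zero hy), ord_inv, sub_eq_add_neg]

lemma ord_pow (x : K) (n : ℕ) : ord v (x ^ n) = n * ord v x := by
  simp [ord, log_pow]

lemma valuation_le_one_iff {x : K} (hx : x ≠ 0) : v.valuation K x ≤ 1 ↔ 0 ≤ ord v x := by
  rw [valuation_eq_exp hx, ← exp_zero, exp_le_exp, Left.neg_nonpos_iff]

lemma valuation_lt_one_iff {x : K} (hx : x ≠ 0) : v.valuation K x < 1 ↔ 0 < ord v x := by
  rw [valuation_eq_exp hx, ← exp_zero, exp_lt_exp, Left.neg_neg_iff]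

lemma valuation_eq_one_iff {x : K} (hx : x ≠ 0) : v.valuation K x = 1 ↔ ord v x = 0 := by
  rw [valuation_eq_exp hx, ← exp_zero, exp_inj, neg_eq_zero]

lemma ne_zero_of_valuation_eq_one {x : K} (h : v.valuation K x = 1) : x ≠ 0 := by
  rintro rfl
  simp at h

lemma ord_algebraMap_nonneg (r : R) : 0 ≤ ord v (algebraMap R K r) := by
  by_cases hr : algebraMap R K r = 0
  · rw [hr]; simp [ord]
  · exact (valuation_le_one_iff hr).mp (v.valuation_le_one r)

lemma ord_pos_iff {r : R} (hr : r ≠ 0) : 0 < ord v (algebraMap R K r) ↔ r ∈ v.asIdeal := by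
  rw [← valuation_lt_one_iff ((map_ne_zero_iff _ (IsFractionRing.injective R K)).mpr hr),
    valuation_lt_one_iff_mem]

lemma ord_unit (u : Rˣ) : ord v (algebraMap R K u) = 0 := by
  have h1 := ord_algebraMap_nonneg (v := v) (K := K) (u : R)
  have h2 := ord_algebraMap_nonneg (v := v) (K := K) ((u⁻¹ : Rˣ) : R)
  have hne : ∀ w : Rˣ, algebraMap R K w ≠ 0 := fun w =>
    (map_ne_zero_iff _ (IsFractionRing.injective R K)).mpr (Units.ne_zero w)
  have h3 := ord_mul (v := v) (hne u) (hne u⁻¹)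
  rw [← map_mul, Units.mul_inv, map_one, ord_one] at h3
  omega

/-- An element with nonnegative valuations is integral. -/
lemma exists_algebraMap_of_ord_nonneg {x : K} (hx : x ≠ 0)
    (h : ∀ v : HeightOneSpectrum R, 0 ≤ ord v x) : ∃ r : R, algebraMap R K r = x :=
  mem_integers_of_valuation_le_one K x fun v => (valuation_le_one_iff hx).mpr (h v)

lemma exists_unit_of_ord_eq_zero {x : K} (hx : x ≠ 0)
    (h : ∀ v : HeightOneSpectrum R, ord v x = 0) : ∃ u : Rˣ, algebraMap R K u = x := by
  obtain ⟨r, hr⟩ := exists_algebraMap_of_ord_nonneg (R := R) hx fun v => (h v).ge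
  obtain ⟨s, hs⟩ := exists_algebraMap_of_ord_nonneg (R := R) (inv_ne_zero hx) fun v => by
    rw [ord_inv, h v, neg_zero]
  have hrs : r * s = 1 := by
    apply IsFractionRing.injective R K
    rw [map_mul, hr, hs, mul_inv_cancel₀ hx, map_one]
  exact ⟨⟨r, s, hrs, by rw [mul_comm, hrs]⟩, hr⟩

lemma exists_unit_mul_of_ord_eq {x y : K} (hx : x ≠ 0) (hy : y ≠ 0)
    (h : ∀ v : HeightOneSpectrum R, ord v x = ord v y) :
    ∃ u : Rˣ, x = algebraMap R K u * y := by
  obtain ⟨u, hu⟩ := exists_unit_of_ord_eq_zero (R := R) (div_ne_zero hx hy) fun v => by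
    rw [ord_div hx hy, h v, sub_self]
  exact ⟨u, by rw [hu, div_mul_cancel₀ _ hy]⟩

variable [IsPrincipalIdealRing R]

variable (v) in
lemma exists_generator (K : Type*) [Field K] [Algebra R K] [IsFractionRing R K] :
    ∃ π : R, Prime π ∧ v.asIdeal = Ideal.span {π} ∧
    ord v (algebraMap R K π) = 1 ∧ ∀ w : HeightOneSpectrum R, w ≠ v →
      ord w (algebraMap R K π) = 0 := by
  obtain ⟨π, hπ⟩ := IsPrincipalIdealRing.principal v.asIdeal
  rw [Ideal.submodule_span_eq] at hπ
  have hπ0 : π ≠ 0 := by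
    rintro rfl
    apply v.ne_bot
    rw [hπ]
    simp
  have hπ0' : algebraMap R K π ≠ 0 := (map_ne_zero_iff _ (IsFractionRing.injective R K)).mpr hπ0
  refine ⟨π, ?_, hπ, ?_, ?_⟩
  · exact (Ideal.span_singleton_prime hπ0).mp (hπ ▸ v.isPrime)
  · rw [ord_eq_iff hπ0', valuation_of_algebraMap, intValuation_singleton v hπ0 hπ]
  · intro w hw
    have h1 := ord_algebraMap_nonneg (v := w) (K := K) π
    by_contra hne
    have hpos : 0 < ord w (algebraMap R K π) := by omega
    rw [ord_pos_iff hπ0] at hpos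
    apply hw
    ext1
    have hle : v.asIdeal ≤ w.asIdeal := by
      rw [hπ, Ideal.span_singleton_le_iff_mem]
      exact hpos
    exact (v.isMaximal.eq_of_le w.isPrime.ne_top hle).symm

/-- Induction on divisibility: at a prime π dividing a nonunit y the valuation is a positive
multiple of m, so π^m can be split off. -/
lemma exists_unit_mul_pow_of_integer {m : ℕ} (hm : 0 < m) (K : Type*) [Field K] [Algebra R K]
    [IsFractionRing R K] (y : R) (hy : y ≠ 0)
    (h : ∀ v : HeightOneSpectrum R, (m : ℤ) ∣ ord v (algebraMap R K y)) :
    ∃ (u : Rˣ) (t : R), y = u * t ^ m := by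
  revert hy h
  refine wellFounded_dvdNotUnit.induction (C := fun y : R => y ≠ 0 →
    (∀ v : HeightOneSpectrum R, (m : ℤ) ∣ ord v (algebraMap R K y)) →
      ∃ (u : Rˣ) (t : R), y = u * t ^ m) y ?_
  intro y ih hy h
  by_cases hu : IsUnit y
  · obtain ⟨u, rfl⟩ := hu
    exact ⟨u, 1, by simp⟩
  obtain ⟨M, hM, hyM⟩ := Ideal.exists_le_maximal (Ideal.span {y})
    (by rwa [Ne, Ideal.span_singleton_eq_top])
  have hyM : y ∈ M := hyM (Ideal.mem_span_singleton_self y)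
  let v : HeightOneSpectrum R := ⟨M, hM.isPrime, fun hb => hy (by rw [hb] at hyM; simpa using hyM)⟩
  obtain ⟨π, hπ, -, hπv, hπw⟩ := exists_generator v K
  have hinj := IsFractionRing.injective R K
  have hy' : algebraMap R K y ≠ 0 := (map_ne_zero_iff _ hinj).mpr hy
  have hπ' : algebraMap R K π ≠ 0 := (map_ne_zero_iff _ hinj).mpr hπ.ne_zero
  have hpos : 0 < ord v (algebraMap R K y) := (ord_pos_iff hy).mpr hyM
  have hge : (m : ℤ) ≤ ord v (algebraMap R K y) := Int.le_of_dvd hpos (h v)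
  have hord : ∀ w : HeightOneSpectrum R, ord w (algebraMap R K y / algebraMap R K π ^ m) =
      ord w (algebraMap R K y) - m * ord w (algebraMap R K π) := fun w => by
    rw [ord_div hy' (pow_ne_zero _ hπ'), ord_pow]
  obtain ⟨z, hz⟩ := exists_algebraMap_of_ord_nonneg (R := R)
    (div_ne_zero hy' (pow_ne_zero m hπ')) (by
      intro w
      rw [hord]
      by_cases hwv : w = v
      · rw [hwv, hπv]
        linarith
      · rw [hπw w hwv, mul_zero, sub_zero]
        exact ord_algebraMap_nonneg y)
  have hyz : y = z * π ^ m := by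
    apply hinj
    rw [map_mul, hz, map_pow, div_mul_cancel₀ _ (pow_ne_zero m hπ')]
  have hz0 : z ≠ 0 := by
    rintro rfl
    rw [zero_mul] at hyz
    exact hy hyz
  obtain ⟨u, t, hut⟩ := ih z ⟨hz0, π ^ m, fun hun => hπ.not_isUnit
    ((isUnit_pow_iff hm.ne').mp hun), hyz⟩ hz0 fun w => by
      rw [hz, hord]
      exact dvd_sub (h w) (dvd_mul_right _ _)
  exact ⟨u, t * π, by rw [hyz, hut]; ring⟩

/-- An element of the fraction field of a principal ideal domain all of whose valuations are
divisible by `m` is a unit times an `m`-th power. -/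
lemma exists_unit_mul_pow {m : ℕ} (hm : 0 < m) {x : K} (hx : x ≠ 0)
    (h : ∀ v : HeightOneSpectrum R, (m : ℤ) ∣ ord v x) :
    ∃ (u : Rˣ) (t : K), t ≠ 0 ∧ x = algebraMap R K u * t ^ m := by
  obtain ⟨a, b, hb, rfl⟩ := IsFractionRing.div_surjective (A := R) x
  have hinj := IsFractionRing.injective R K
  have hb0 := nonZeroDivisors.ne_zero hb
  have hb' : algebraMap R K b ≠ 0 := (map_ne_zero_iff _ hinj).mpr hb0
  have ha' : algebraMap R K a ≠ 0 := by
    intro h0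
    rw [h0, zero_div] at hx
    exact hx rfl
  have ha0 : a ≠ 0 := (map_ne_zero_iff _ hinj).mp ha'
  -- a b^(m-1) = (a/b) b^m is integral and has the valuations of a/b modulo m.
  obtain ⟨u, t, hut⟩ := exists_unit_mul_pow_of_integer hm K (a * b ^ (m - 1))
    (mul_ne_zero ha0 (pow_ne_zero _ hb0)) (by
      intro v
      have : algebraMap R K (a * b ^ (m - 1)) =
          algebraMap R K a / algebraMap R K b * algebraMap R K b ^ m := by
        rw [map_mul, map_pow, div_mul_eq_mul_div, eq_div_iff hb', mul_assoc, ← pow_succ,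
          Nat.sub_add_cancel hm]
      rw [this, ord_mul hx (pow_ne_zero _ hb'), ord_pow]
      exact dvd_add (h v) (dvd_mul_right _ _))
  have hx' : algebraMap R K a / algebraMap R K b =
      algebraMap R K u * (algebraMap R K t / algebraMap R K b) ^ m := by
    rw [div_pow, ← mul_div_assoc, eq_div_iff (pow_ne_zero _ hb'), ← map_pow _ t, ← map_mul, ← hut,
      map_mul, map_pow, div_mul_eq_mul_div, div_eq_iff hb', mul_assoc, ← pow_succ,
      Nat.sub_add_cancel hm]
  refine ⟨u, algebraMap R K t / algebraMap R K b, ?_, hx'⟩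
  intro h0
  rw [h0, zero_pow hm.ne', mul_zero] at hx'
  exact hx hx'

end AdditiveValuation

/-! ### The equation a + b + c = 0 with abc = 16 π^(2j) up to a unit -/

namespace ImaginaryQuadratic

open NumberField

variable {K : Type*} [Field K] [NumberField K]

lemma dvd_pow_of_coprime {R : Type*} [CommRing R] [IsDomain R] {p a b c : R} (hp : Prime p)
    (hab : IsCoprime a b) (hac : IsCoprime a c) (hbc : IsCoprime b c) {n : ℕ}
    (h : p ^ n ∣ a * b * c) : p ^ n ∣ a ∨ p ^ n ∣ b ∨ p ^ n ∣ c := by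
  have key : ∀ {x y : R}, IsCoprime x y → p ∣ x → ¬ p ∣ y := fun hxy hx hy =>
    hp.not_isUnit (hxy.isUnit_of_dvd' hx hy)
  by_cases ha : p ∣ a
  · left
    refine hp.pow_dvd_of_dvd_mul_right n (key hab ha) ?_
    exact hp.pow_dvd_of_dvd_mul_right n (key hac ha) h
  · by_cases hb : p ∣ b
    · right; left
      refine hp.pow_dvd_of_dvd_mul_left n ha ?_
      exact hp.pow_dvd_of_dvd_mul_right n (key hbc hb) h
    · right; right
      refine hp.pow_dvd_of_dvd_mul_left n (fun h' => (hp.dvd_or_dvd h').elim ha hb) h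

lemma isUnit_of_mul_mul_eq {M : Type*} [CommMonoid M] {a b c u : M} (hu : IsUnit u)
    (h : a * b * c = u) : IsUnit a ∧ IsUnit b ∧ IsUnit c := by
  rw [← h] at hu
  have h1 := isUnit_of_mul_isUnit_left hu
  exact ⟨isUnit_of_mul_isUnit_left h1, isUnit_of_mul_isUnit_right h1,
    isUnit_of_mul_isUnit_right hu⟩

namespace IsImaginaryQuadratic

variable (hK : IsImaginaryQuadratic K)
include hK

lemma conj_isUnit {u : 𝓞 K} (hu : IsUnit u) : IsUnit (conj u) :=
  hK.isUnit_of_nm (by rw [hK.nm_conj, hK.nm_of_isUnit hu])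

lemma nm_two : nm (2 : 𝓞 K) = 4 := by
  have := hK.nm_intCast 2
  simpa using this

lemma exists_prime_dvd_two [IsPrincipalIdealRing (𝓞 K)] : ∃ l : 𝓞 K, Prime l ∧ l ∣ 2 := by
  have h2 : ¬ IsUnit (2 : 𝓞 K) := fun h => by
    have := hK.nm_of_isUnit h
    rw [hK.nm_two] at this
    norm_num at this
  obtain ⟨l, hl, hd⟩ := WfDvdMonoid.exists_irreducible_factor h2 two_ne_zero
  exact ⟨l, hl.prime, hd⟩

lemma nm_prime_dvd_two {l : 𝓞 K} (hl : Prime l) (h2 : l ∣ 2) : nm l = 2 ∨ nm l = 4 := by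
  have hd := nm_dvd_of_dvd h2
  rw [hK.nm_two] at hd
  have hpos := hK.nm_pos hl.ne_zero
  have hle := Int.le_of_dvd (by norm_num) hd
  have h1 : nm l ≠ 1 := fun h => hl.not_isUnit (hK.isUnit_of_nm h)
  interval_cases h : nm l
  · exact absurd rfl h1
  · left; rfl
  · norm_num at hd
  · right; rfl

lemma tr_bound {l : 𝓞 K} (h : nm l = 2) :
    tr l = 0 ∨ tr l = 1 ∨ tr l = -1 ∨ tr l = 2 ∨ tr l = -2 := by
  have := hK.four_nm_sub l
  rw [h] at this
  have h1 : -2 ≤ tr l := by nlinarith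
  have h2 : tr l ≤ 2 := by nlinarith
  omega

/-- A prime above `2` is either the only one, or `2` splits. -/
lemma two_dichotomy {l : 𝓞 K} (hl : Prime l) (h2 : l ∣ 2) :
    (Associated l 2 ∨ nm l = 2 ∧ Associated (l ^ 2) 2) ∨
      nm l = 2 ∧ (tr l = 1 ∨ tr l = -1) := by
  rcases hK.nm_prime_dvd_two hl h2 with hn | hn
  · rcases (show (∃ t, tr l = 2 * t) ∨ tr l = 1 ∨ tr l = -1 by
      rcases hK.tr_bound hn with h | h | h | h | h
      · exact .inl ⟨0, by omega⟩
      · exact .inr (.inl h)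
      · exact .inr (.inr h)
      · exact .inl ⟨1, by omega⟩
      · exact .inl ⟨-1, by omega⟩) with ⟨t, ht⟩ | ht
    · left; right
      refine ⟨hn, ?_⟩
      have hsq := hK.sq_eq l
      rw [hn, ht] at hsq
      -- An even trace makes l a root of x² - 2tx + 2, and comparing norms shows that the cofactor
      -- of 2 is a unit.
      have h3 : l ^ 2 = 2 * ((t : 𝓞 K) * l - 1) := by
        rw [hsq]; push_cast; ring
      have hnm : nm (l ^ 2) = nm (2 : 𝓞 K) * nm ((t : 𝓞 K) * l - 1) := by rw [h3, nm_mul]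
      rw [nm_pow, hn, hK.nm_two] at hnm
      have hu : IsUnit ((t : 𝓞 K) * l - 1) := hK.isUnit_of_nm (by linarith)
      rw [h3]
      exact associated_mul_unit_left _ _ hu
    · exact .inr ⟨hn, ht⟩
  · left; left
    obtain ⟨m, hm⟩ := h2
    have h4 : nm (2 : 𝓞 K) = nm l * nm m := by rw [hm, nm_mul]
    rw [hK.nm_two, hn] at h4
    have hu : IsUnit m := hK.isUnit_of_nm (by linarith)
    rw [hm]
    exact (associated_mul_unit_left l m hu).symm

/-- `-17` is not a square in an imaginary quadratic field of class number one. -/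
lemma sq_ne_neg_seventeen [IsPrincipalIdealRing (𝓞 K)] {s : 𝓞 K} (htr : tr s = 0)
    (hnm : nm s = 17) : False := by
  obtain ⟨l, hl, h2⟩ := hK.exists_prime_dvd_two
  have hs := hK.sq_eq s
  rw [htr, hnm] at hs
  rcases hK.nm_prime_dvd_two hl h2 with hn | hn
  -- The discriminant of l is -8, -7 or -4; times the discriminant -68 of s this would have to be a
  -- square.
  · obtain ⟨m, hm⟩ := hK.disc_mul_disc l s
    rw [hn, htr, hnm] at hm
    have hm' : m.natAbs ^ 2 = 544 ∨ m.natAbs ^ 2 = 476 ∨ m.natAbs ^ 2 = 272 := by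
      zify
      rw [sq_abs, ← hm]
      rcases hK.tr_bound hn with h | h | h | h | h <;> rw [h] <;> norm_num
    have : m.natAbs ≤ 23 := by
      by_contra hc
      have : 24 ^ 2 ≤ m.natAbs ^ 2 := Nat.pow_le_pow_left (by omega) 2
      omega
    interval_cases m.natAbs <;> omega
  · obtain ⟨m, hm⟩ := h2
    have h4 : nm (2 : 𝓞 K) = nm l * nm m := by rw [hm, nm_mul]
    rw [hK.nm_two, hn] at h4
    have hu : IsUnit m := hK.isUnit_of_nm (by linarith)
    have h2l : (2 : 𝓞 K) ∣ l := by
      rw [hm]; exact (associated_mul_unit_left l m hu).dvd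
    have h3 : l ∣ (s + 1) ^ 2 := by
      -- When 2 is inert this makes 2 divide s + 1, whose norm 18 is not divisible by 4.
      have : (s + 1) ^ 2 = 2 * (s - 8) := by
        push_cast at hs
        linear_combination hs
      rw [this, hm, mul_assoc]
      exact dvd_mul_right _ _
    have h5 : nm (2 : 𝓞 K) ∣ nm (s + 1) := nm_dvd_of_dvd (h2l.trans (hl.dvd_of_dvd_pow h3))
    have h6 := hK.nm_one_sub (-s)
    rw [hK.nm_neg, tr_neg, htr, hnm, sub_neg_eq_add, add_comm] at h6
    rw [h6, hK.nm_two] at h5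
    norm_num at h5

/-- The case in which `16` divides the first term of the unit equation. -/
lemma unitEquation_sixteen_left [IsPrincipalIdealRing (𝓞 K)] {a b c s u : 𝓞 K} (hu : IsUnit u)
    (hprod : a * b * c = 16 * u) (hsum : a + b + s ^ 2 * c = 0) (h15 : nm s ≠ 15)
    (ha : 16 ∣ a) : False := by
  obtain ⟨w, rfl⟩ := ha
  have hprod' : w * b * c = u := by
    have : (16 : 𝓞 K) ≠ 0 := by norm_num
    apply mul_left_cancel₀ this
    rw [← hprod]; ring
  obtain ⟨hw, hb, hc⟩ := isUnit_of_mul_mul_eq hu hprod'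
  have hwb : IsUnit (w * conj b) := hw.mul (hK.conj_isUnit hb)
  have h1 : nm (16 * w + b) = nm s ^ 2 := by
    have : 16 * w + b = - (s ^ 2 * c) := by linear_combination hsum
    rw [this, hK.nm_neg, nm_mul, nm_pow, hK.nm_of_isUnit hc, mul_one]
  have h16 : nm (16 : 𝓞 K) = 256 := by
    have := hK.nm_intCast 16
    simpa using this
  have ht16 : tr (16 * w * conj b) = 16 * tr (w * conj b) := by
    rw [← tr_intCast_mul]; push_cast; rw [mul_assoc]
  rw [hK.nm_add, nm_mul, h16, hK.nm_of_isUnit hw, hK.nm_of_isUnit hb, ht16] at h1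
  have hpos := hK.nm_nonneg s
  obtain ⟨hl, hr⟩ := hK.tr_of_isUnit hwb
  -- N(s)² = 257 + 16 t with t the trace of a unit, so it lies between 225 = 15² and 289 = 17²; N(s)
  -- = 16 fails modulo 16.
  have hle : nm s ≤ 17 := by nlinarith
  have hge : 15 ≤ nm s := by nlinarith
  have hs17 : nm s = 17 ∧ tr (w * conj b) = 2 := by
    interval_cases hn : nm s
    · exact absurd rfl h15
    · omega
    · exact ⟨rfl, by omega⟩
  obtain ⟨hs17, ht2⟩ := hs17
  have hone : w * conj b = 1 := hK.eq_of_tr_eq_two (hK.nm_of_isUnit hwb) ht2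
  have hwb' : w = b := by
    have hbb := hK.mul_conj b
    rw [hK.nm_of_isUnit hb, Int.cast_one, ← hone] at hbb
    exact (mul_right_cancel₀ (hK.conj_isUnit hb).ne_zero hbb).symm
  obtain ⟨c, rfl⟩ := hc
  set u' : 𝓞 K := -b * (c⁻¹ : (𝓞 K)ˣ) with hu'
  have hu'u : IsUnit u' := hb.neg.mul (Units.isUnit _)
  have hs2 : s ^ 2 = (17 : ℤ) * u' := by
    have : s ^ 2 * c = -17 * b := by rw [hwb'] at hsum; linear_combination hsum
    have hcc : (c : 𝓞 K) * (c⁻¹ : (𝓞 K)ˣ) = 1 := Units.mul_inv c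
    push_cast
    linear_combination (c⁻¹ : (𝓞 K)ˣ) * this - s ^ 2 * hcc
  have htr := hK.tr_sq s
  rw [hs2, tr_intCast_mul, hs17] at htr
  obtain ⟨hl', hr'⟩ := hK.tr_of_isUnit hu'u
  -- With tr(s)² ≤ 4 · 17 this leaves only trace zero, that is s² = -17.
  have hd : (17 : ℤ) ∣ tr s ^ 2 := ⟨tr u' + 2, by linarith⟩
  have hd' : (17 : ℤ) ∣ tr s := Int.Prime.dvd_pow' (by norm_num) hd
  have hb1 : tr s ≤ 8 := by nlinarith
  have hb2 : -8 ≤ tr s := by nlinarith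
  exact hK.sq_ne_neg_seventeen (s := s) (by omega) hs17

/-- A sum of two units has norm at most 4, while the remaining term has norm at least 4 · 256. -/
lemma unitEquation_sixteen_right {a b c s u : 𝓞 K} (hu : IsUnit u)
    (hprod : a * b * c = 16 * u) (hsum : a + b + s ^ 2 * c = 0) (hs : 2 ≤ nm s)
    (hc : 16 ∣ c) : False := by
  obtain ⟨w, rfl⟩ := hc
  have hprod' : a * b * w = u := by
    have : (16 : 𝓞 K) ≠ 0 := by norm_num
    apply mul_left_cancel₀ this
    rw [← hprod]; ring
  obtain ⟨ha, hb, hw⟩ := isUnit_of_mul_mul_eq hu hprod'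
  have hab := hK.tr_of_isUnit (ha.mul (hK.conj_isUnit hb))
  have h16 : nm (16 : 𝓞 K) = 256 := by
    have := hK.nm_intCast 16
    simpa using this
  have h1 : nm (a + b) = nm s ^ 2 * 256 := by
    have : a + b = - (s ^ 2 * (16 * w)) := by linear_combination hsum
    rw [this, hK.nm_neg, nm_mul, nm_mul, nm_pow, hK.nm_of_isUnit hw, mul_one, h16]
  rw [hK.nm_add, hK.nm_of_isUnit ha, hK.nm_of_isUnit hb] at h1
  nlinarith

/-- By the triangle inequality the first two terms sum to norm at most (4 + 1)² = 25, below 4 · 16.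
-/
lemma unitEquation_norm_sixteen {a b c s : 𝓞 K} (hsum : a + b + s ^ 2 * c = 0) (hs : 2 ≤ nm s)
    (ha : nm a = 16) (hb : nm b = 1) (hc : nm c = 16) : False := by
  have hab := hK.four_nm_sub (a * conj b)
  rw [nm_mul, hK.nm_conj, ha, hb] at hab
  have h1 : nm (a + b) = nm s ^ 2 * 16 := by
    have : a + b = - (s ^ 2 * c) := by linear_combination hsum
    rw [this, hK.nm_neg, nm_mul, nm_pow, hc]
  rw [hK.nm_add, ha, hb] at h1
  have : tr (a * conj b) ≤ 8 := by nlinarith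
  nlinarith

/-- The field contains √-7, since l has discriminant -7. A unit of trace 0 or ±1 has discriminant -4
or -3, and neither 28 nor 21 is a square. -/
lemma isUnit_eq_of_split {l w : 𝓞 K} (hn : nm l = 2) (ht : tr l = 1 ∨ tr l = -1)
    (hw : IsUnit w) : w = 1 ∨ w = -1 := by
  have h1 := hK.nm_of_isUnit hw
  obtain ⟨hl, hr⟩ := hK.tr_of_isUnit hw
  obtain ⟨m, hm⟩ := hK.disc_mul_disc l w
  have ht' : tr l ^ 2 = 1 := by rcases ht with h | h <;> rw [h] <;> norm_num
  rw [ht', hn, h1] at hm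
  have hm1 : -5 ≤ m := by nlinarith
  have hm2 : m ≤ 5 := by nlinarith
  have : tr w = 2 ∨ tr w = -2 := by
    interval_cases h : tr w
    · right; rfl
    · exfalso; interval_cases m <;> omega
    · exfalso; interval_cases m <;> omega
    · exfalso; interval_cases m <;> omega
    · left; rfl
  rcases this with h | h
  · exact .inl (hK.eq_of_tr_eq_two h1 h)
  · exact .inr (hK.eq_of_tr_eq_neg_two h1 h)

/-- Here N(a + b) = 16 + 16 ± tr(l⁸) with tr(l⁸) = -31, so N(s)² would be 1 or 63. -/
lemma unitEquation_split {l a b c s w w' : 𝓞 K} (hn : nm l = 2) (ht : tr l = 1 ∨ tr l = -1)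
    (hsum : a + b + s ^ 2 * c = 0) (hs : 2 ≤ nm s) (ha : a = l ^ 4 * w)
    (hb : b = conj l ^ 4 * w') (hw : IsUnit w) (hw' : IsUnit w') (hc : IsUnit c) : False := by
  have hc1 : conj (1 : 𝓞 K) = 1 := by
    have : tr (1 : 𝓞 K) = 2 := by
      have := hK.tr_intCast 1
      simpa using this
    rw [conj, this]; norm_num
  have hcc : conj (conj l) = l := by
    have : tr (conj l) = tr l := by
      rw [conj, sub_eq_add_neg, tr_add, hK.tr_intCast, tr_neg]; ring
    rw [conj, this, conj]; ring
  have hcpow : conj (conj l ^ 4) = l ^ 4 := by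
    rw [show conj l ^ 4 = conj l * conj l * (conj l * conj l) by ring, hK.conj_mul, hK.conj_mul,
      hcc]
    ring
  have ht2 : tr l ^ 2 = 1 := by rcases ht with h | h <;> rw [h] <;> norm_num
  have h2 : tr (l ^ 2) = -3 := by rw [hK.tr_sq, ht2, hn]; norm_num
  have h4 : tr (l ^ 4) = 1 := by
    rw [show l ^ 4 = (l ^ 2) ^ 2 by ring, hK.tr_sq, h2, nm_pow, hn]; norm_num
  have h8 : tr (l ^ 8) = -31 := by
    rw [show l ^ 8 = (l ^ 4) ^ 2 by ring, hK.tr_sq, h4, nm_pow, hn]; norm_num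
  have hun := hK.isUnit_eq_of_split hn ht (hw.mul (hK.conj_isUnit hw'))
  have hab : a * conj b = l ^ 8 * (w * conj w') := by
    rw [ha, hb, hK.conj_mul, hcpow]; ring
  have h1 : nm (a + b) = nm s ^ 2 := by
    have : a + b = - (s ^ 2 * c) := by linear_combination hsum
    rw [this, hK.nm_neg, nm_mul, nm_pow, hK.nm_of_isUnit hc, mul_one]
  have hna : nm a = 16 := by
    rw [ha, nm_mul, nm_pow, hn, hK.nm_of_isUnit hw]; norm_num
  have hnb : nm b = 16 := by
    rw [hb, nm_mul, nm_pow, hK.nm_conj, hn, hK.nm_of_isUnit hw']; norm_num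
  rw [hK.nm_add, hna, hnb, hab] at h1
  rcases hun with h | h
  · rw [h, mul_one, h8] at h1
    nlinarith
  · rw [h, mul_neg_one, tr_neg, h8] at h1
    have : nm s ≤ 7 := by nlinarith
    interval_cases nm s <;> omega

/-- If 2 has a single prime above it, coprimality puts all of 16 into one term. If 2 splits, l⁴ and
its conjugate each go into one term, and either they share a term or the terms are determined up to
units. -/
lemma unitEquation_aux [IsPrincipalIdealRing (𝓞 K)] {a b c s u : 𝓞 K} (hu : IsUnit u)
    (hab : IsCoprime a b) (hac : IsCoprime a c) (hbc : IsCoprime b c)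
    (hprod : a * b * c = 16 * u) (hsum : a + b + s ^ 2 * c = 0) (hs : 2 ≤ nm s)
    (h15 : nm s ≠ 15) : False := by
  have hprod' : b * a * c = 16 * u := by rw [← hprod]; ring
  have hsum' : b + a + s ^ 2 * c = 0 := by rw [← hsum]; ring
  have h16 : ¬ (16 ∣ a ∨ 16 ∣ b ∨ 16 ∣ c) := by
    rintro (h | h | h)
    · exact hK.unitEquation_sixteen_left hu hprod hsum h15 h
    · exact hK.unitEquation_sixteen_left hu hprod' hsum' h15 h
    · exact hK.unitEquation_sixteen_right hu hprod hsum hs h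
  have hpow : ∀ {l : 𝓞 K} {n : ℕ}, Prime l → Associated (l ^ n) 16 → False := by
    intro l n hl h
    have hd := dvd_pow_of_coprime hl hab hac hbc (n := n)
      (by rw [hprod]; exact h.dvd.trans (dvd_mul_right _ _))
    exact h16 (hd.imp h.symm.dvd.trans (Or.imp h.symm.dvd.trans h.symm.dvd.trans))
  obtain ⟨l, hl, h2⟩ := hK.exists_prime_dvd_two
  rcases hK.two_dichotomy hl h2 with (h | ⟨-, h⟩) | ⟨hn, ht⟩
  · refine hpow hl (n := 4) ?_
    have := h.pow_pow (n := 4)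
    rwa [show (2 : 𝓞 K) ^ 4 = 16 by norm_num] at this
  · refine hpow hl (n := 8) ?_
    have := h.pow_pow (n := 4)
    rwa [← pow_mul, show (2 : 𝓞 K) ^ 4 = 16 by norm_num] at this
  · have hconj : l * conj l = 2 := by
      rw [hK.mul_conj, hn]; norm_num
    have hln : ∀ w w' : 𝓞 K, (l ^ 4 * w) * (conj l ^ 4 * w') = 16 * (w * w') := by
      intro w w'
      have : (l * conj l) ^ 4 = 16 := by rw [hconj]; norm_num
      rw [← this]; ring
    have hl' : Prime (conj l) := by
      rw [← irreducible_iff_prime]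
      refine ⟨fun hun => ?_, fun x y hxy => ?_⟩
      · have := hK.nm_of_isUnit hun
        rw [hK.nm_conj, hn] at this
        norm_num at this
      · have h := congrArg nm hxy
        rw [hK.nm_conj, hn, nm_mul] at h
        have hx := hK.nm_nonneg x
        have hy := hK.nm_nonneg y
        have hxle : nm x ≤ 2 := Int.le_of_dvd (by norm_num) ⟨_, h⟩
        interval_cases hx' : nm x
        · omega
        · exact .inl (hK.isUnit_of_nm hx')
        · exact .inr (hK.isUnit_of_nm (by omega))
    have hcop : IsCoprime (l ^ 4) (conj l ^ 4) := by
      apply IsCoprime.pow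
      have hsum : l + conj l = tr l := by rw [conj]; ring
      rcases ht with ht | ht
      · exact ⟨1, 1, by rw [one_mul, one_mul, hsum, ht]; norm_num⟩
      · exact ⟨-1, -1, by
          have : (-1 : 𝓞 K) * l + -1 * conj l = -(l + conj l) := by ring
          rw [this, hsum, ht]; norm_num⟩
    have hboth : ∀ z : 𝓞 K, l ^ 4 ∣ z → conj l ^ 4 ∣ z → 16 ∣ z := by
      intro z h1 h2
      have := hcop.mul_dvd h1 h2
      rw [← mul_pow, hconj] at this
      convert this
      norm_num
    have hcancel : ∀ {w w' c : 𝓞 K}, (l ^ 4 * w) * (conj l ^ 4 * w') * c = 16 * u →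
        IsUnit w ∧ IsUnit w' ∧ IsUnit c := by
      intro w w' c h
      rw [hln, mul_assoc] at h
      exact isUnit_of_mul_mul_eq hu (mul_left_cancel₀ (by norm_num) h)
    have hnl : ∀ {w : 𝓞 K}, IsUnit w → nm (l ^ 4 * w) = 16 := fun hw => by
      rw [nm_mul, nm_pow, hn, hK.nm_of_isUnit hw]; norm_num
    have hnl' : ∀ {w : 𝓞 K}, IsUnit w → nm (conj l ^ 4 * w) = 16 := fun hw => by
      rw [nm_mul, nm_pow, hK.nm_conj, hn, hK.nm_of_isUnit hw]; norm_num
    have hd := dvd_pow_of_coprime hl hab hac hbc (n := 4)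
      ⟨conj l ^ 4 * u, by linear_combination hprod - u * hln 1 1⟩
    have hd' := dvd_pow_of_coprime hl' hab hac hbc (n := 4)
      ⟨l ^ 4 * u, by linear_combination hprod - u * hln 1 1⟩
    rcases hd with hd | hd | hd <;> rcases hd' with hd' | hd' | hd'
    · exact h16 (.inl (hboth a hd hd'))
    · obtain ⟨w, hw⟩ := hd
      obtain ⟨w', hw'⟩ := hd'
      obtain ⟨h1, h2, h3⟩ := hcancel (w := w) (w' := w') (c := c)
        (by rw [← hprod, hw, hw'])
      exact hK.unitEquation_split hn ht hsum hs hw hw' h1 h2 h3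
    · obtain ⟨w, hw⟩ := hd
      obtain ⟨w', hw'⟩ := hd'
      obtain ⟨h1, h2, h3⟩ := hcancel (w := w) (w' := w') (c := b)
        (by rw [← hprod, hw, hw']; ring)
      exact hK.unitEquation_norm_sixteen hsum hs (hw ▸ hnl h1) (hK.nm_of_isUnit h3)
        (hw' ▸ hnl' h2)
    · obtain ⟨w, hw⟩ := hd
      obtain ⟨w', hw'⟩ := hd'
      obtain ⟨h1, h2, h3⟩ := hcancel (w := w) (w' := w') (c := c)
        (by rw [← hprod, hw, hw']; ring)
      exact hK.unitEquation_split hn ht hsum' hs hw hw' h1 h2 h3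
    · exact h16 (.inr (.inl (hboth b hd hd')))
    · obtain ⟨w, hw⟩ := hd
      obtain ⟨w', hw'⟩ := hd'
      obtain ⟨h1, h2, h3⟩ := hcancel (w := w) (w' := w') (c := a)
        (by rw [← hprod, hw, hw']; ring)
      exact hK.unitEquation_norm_sixteen hsum' hs (hw ▸ hnl h1) (hK.nm_of_isUnit h3)
        (hw' ▸ hnl' h2)
    · obtain ⟨w, hw⟩ := hd
      obtain ⟨w', hw'⟩ := hd'
      obtain ⟨h1, h2, h3⟩ := hcancel (w := w) (w' := w') (c := b)
        (by rw [← hprod, hw, hw']; ring)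
      exact hK.unitEquation_norm_sixteen hsum hs (hw' ▸ hnl' h2) (hK.nm_of_isUnit h3)
        (hw ▸ hnl h1)
    · obtain ⟨w, hw⟩ := hd
      obtain ⟨w', hw'⟩ := hd'
      obtain ⟨h1, h2, h3⟩ := hcancel (w := w) (w' := w') (c := a)
        (by rw [← hprod, hw, hw']; ring)
      exact hK.unitEquation_norm_sixteen hsum' hs (hw' ▸ hnl' h2) (hK.nm_of_isUnit h3)
        (hw ▸ hnl h1)
    · exact h16 (.inr (.inr (hboth c hd hd')))

/-- Such a π divides 3 or 5, so its norm divides 9 or 25, yet 3 and 5 both divide a power of that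
norm. -/
lemma nm_prime_pow_ne_fifteen {π : 𝓞 K} (hπ : Prime π) (j : ℕ) : nm (π ^ j) ≠ 15 := by
  intro h
  have hj : j ≠ 0 := by
    rintro rfl
    rw [pow_zero, nm_one] at h
    norm_num at h
  have hd : π ∣ 3 * 5 := by
    have h1 : π ∣ π ^ j * conj (π ^ j) := (dvd_pow_self π hj).mul_right _
    rw [hK.mul_conj, h] at h1
    convert h1
    norm_num
  rw [nm_pow] at h
  have hp : ∀ q r : ℕ, q.Prime → r.Prime → q ≠ r → (r : ℤ) ∣ nm π ^ j → π ∣ (q : 𝓞 K) →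
      False := by
    intro q r hq hr hqr hrd hd
    have h1 : (r : ℤ) ∣ nm π := Int.Prime.dvd_pow' hr hrd
    have h2 := nm_dvd_of_dvd hd
    have h3 := hK.nm_intCast q
    push_cast at h3
    rw [h3] at h2
    have h4 : (r : ℤ) ∣ (q : ℤ) := Int.Prime.dvd_pow' hr (h1.trans h2)
    exact hqr ((Nat.prime_dvd_prime_iff_eq hr hq).mp (by exact_mod_cast h4)).symm
  rcases hπ.dvd_or_dvd hd with hd | hd
  · exact hp 3 5 (by norm_num) (by norm_num) (by norm_num) (by rw [h]; norm_num) (by simpa using hd)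
  · exact hp 5 3 (by norm_num) (by norm_num) (by norm_num) (by rw [h]; norm_num) (by simpa using hd)

/-- Coprimality places the full power π^(2j) in c. As the exponent is even it is a square s² with s
= π^j, and this is where evenness enters. -/
lemma unitEquation_of_dvd [IsPrincipalIdealRing (𝓞 K)] {a b c π u : 𝓞 K} (hu : IsUnit u)
    (hπ : Prime π) {j : ℕ} (hj : j ≠ 0) (hab : IsCoprime a b) (hac : IsCoprime a c)
    (hbc : IsCoprime b c) (hprod : a * b * c = 16 * π ^ (2 * j) * u) (hsum : a + b + c = 0)
    (hc : π ∣ c) : False := by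
  have hna : ¬ π ∣ a := fun h => hπ.not_isUnit (hac.isUnit_of_dvd' h hc)
  have hnb : ¬ π ∣ b := fun h => hπ.not_isUnit (hbc.isUnit_of_dvd' h hc)
  have hd : π ^ (2 * j) ∣ c := by
    refine hπ.pow_dvd_of_dvd_mul_left _ (fun h => (hπ.dvd_or_dvd h).elim hna hnb)
      (⟨16 * u, ?_⟩ : π ^ (2 * j) ∣ a * b * c)
    rw [hprod]; ring
  obtain ⟨y, rfl⟩ := hd
  have hy : a * b * y = 16 * u := by
    apply mul_left_cancel₀ (pow_ne_zero (2 * j) hπ.ne_zero)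
    linear_combination hprod
  have hnπ : 2 ≤ nm (π ^ j) := by
    have hpos := hK.nm_pos (pow_ne_zero j hπ.ne_zero)
    have hne : nm (π ^ j) ≠ 1 := fun h =>
      hπ.not_isUnit ((isUnit_pow_iff hj).mp (hK.isUnit_of_nm h))
    omega
  refine hK.unitEquation_aux hu hab (hac.of_isCoprime_of_dvd_right (dvd_mul_left _ _))
    (hbc.of_isCoprime_of_dvd_right (dvd_mul_left _ _)) hy (s := π ^ j) ?_ hnπ
    (hK.nm_prime_pow_ne_fifteen hπ j)
  rw [← pow_mul, mul_comm j 2]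
  exact hsum

/-- The equation `a + b + c = 0` in coprime integers of an imaginary quadratic field of class
number one with `a b c = 16 π ^ k` up to a unit has no solution if `k ≥ 1` is even. -/
theorem unitEquation [IsPrincipalIdealRing (𝓞 K)] {a b c π u : 𝓞 K} (hu : IsUnit u)
    (hπ : Prime π) {j : ℕ} (hj : j ≠ 0) (hab : IsCoprime a b) (hac : IsCoprime a c)
    (hbc : IsCoprime b c) (hprod : a * b * c = 16 * π ^ (2 * j) * u) (hsum : a + b + c = 0) :
    False := by
  have hd : π ∣ a * b * c := by
    rw [hprod]
    exact ((dvd_pow_self π (by omega)).mul_left _).mul_right _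
  rcases hπ.dvd_or_dvd hd with hd | hd
  · rcases hπ.dvd_or_dvd hd with hd | hd
    · exact hK.unitEquation_of_dvd hu hπ hj hbc hab.symm hac.symm (by rw [← hprod]; ring)
        (by rw [← hsum]; ring) hd
    · exact hK.unitEquation_of_dvd hu hπ hj hac hab hbc.symm (by rw [← hprod]; ring)
        (by rw [← hsum]; ring) hd
  · exact hK.unitEquation_of_dvd hu hπ hj hab hac hbc hprod hsum hd

end IsImaginaryQuadratic

end ImaginaryQuadratic

/-! ### Primes above 2 and units modulo 4 -/

namespace ImaginaryQuadratic

open NumberField AdditiveValuation WithZero HeightOneSpectrum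

variable {K : Type*} [Field K] [NumberField K]

/-- The prime `v` is above `2`, which is ramified, and `l` is a uniformizer with
`l² = 2 (t l - 1)`. -/
structure IsRamifiedTwo (v : HeightOneSpectrum (𝓞 K)) (l : K) (t : ℤ) : Prop where
  valuation_eq : v.valuation K l = exp (-1)
  sq_eq : l ^ 2 = 2 * (t * l - 1)
  abs_le : t = 0 ∨ t = 1 ∨ t = -1
  sub_one_lt : ∀ x : K, v.valuation K x = 1 → v.valuation K (x - 1) < 1
  unique : ∀ w : HeightOneSpectrum (𝓞 K), w ≠ v → ord w (2 : K) = 0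

lemma valuation_add_eq_one {R : Type*} [Ring R] {Γ : Type*} [LinearOrderedCommGroupWithZero Γ]
    {V : Valuation R Γ} {x y : R} (hx : V x = 1) (hy : V y < 1) : V (x + y) = 1 := by
  rw [V.map_add_eq_of_lt_left (by rw [hx]; exact hy), hx]

lemma valuation_mul_le_one {R : Type*} [Ring R] {Γ : Type*} [LinearOrderedCommGroupWithZero Γ]
    {V : Valuation R Γ} {x y : R} (hx : V x ≤ 1) (hy : V y ≤ 1) : V (x * y) ≤ 1 := by
  rw [map_mul]; exact mul_le_one' hx hy

lemma valuation_mul_lt_one {R : Type*} [Ring R] {Γ : Type*} [LinearOrderedCommGroupWithZero Γ]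
    {V : Valuation R Γ} {x y : R} (hx : V x < 1) (hy : V y ≤ 1) : V (x * y) < 1 := by
  rw [map_mul]
  exact (mul_le_of_le_one_right' hy).trans_lt hx

lemma valuation_int_le_one (v : HeightOneSpectrum (𝓞 K)) (n : ℤ) :
    v.valuation K (n : K) ≤ 1 := by
  have := v.valuation_le_one (K := K) (n : 𝓞 K)
  simpa using this

lemma lt_one_iff_le_exp {x : ℤᵐ⁰} : x < 1 ↔ x ≤ exp (-1) := by
  by_cases hx : x = 0
  · simp [hx]
  · rw [← exp_log hx, ← exp_zero, exp_lt_exp, exp_le_exp]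
    omega

namespace IsRamifiedTwo

variable {v : HeightOneSpectrum (𝓞 K)} {l : K} {t : ℤ} (h : IsRamifiedTwo v l t)
include h

lemma ne_zero : l ≠ 0 := by
  rintro rfl
  have := h.valuation_eq
  rw [map_zero] at this
  exact exp_ne_zero this.symm

lemma lt_one : v.valuation K l < 1 := by
  rw [lt_one_iff_le_exp]
  exact h.valuation_eq.le

lemma valuation_kappa : v.valuation K (t * l - 1) = 1 := by
  rw [← Valuation.map_neg, neg_sub, sub_eq_add_neg]
  apply valuation_add_eq_one (map_one _)
  rw [Valuation.map_neg, mul_comm]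
  exact valuation_mul_lt_one h.lt_one (valuation_int_le_one v t)

lemma valuation_two : v.valuation K 2 = exp (-2) := by
  have h1 := congrArg (v.valuation K) h.sq_eq
  rw [map_mul, h.valuation_kappa, mul_one, map_pow, h.valuation_eq, ← exp_nsmul] at h1
  rw [← h1]
  norm_num

lemma valuation_four : v.valuation K 4 = exp (-4) := by
  rw [show (4 : K) = 2 * 2 by norm_num, map_mul, h.valuation_two, ← exp_add]
  norm_num

lemma exists_mul {x : K} (hx : v.valuation K x < 1) : ∃ g, v.valuation K g ≤ 1 ∧ x = l * g := by
  refine ⟨x / l, ?_, by rw [mul_div_cancel₀ _ h.ne_zero]⟩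
  rw [map_div₀, h.valuation_eq, div_le_one₀ (by rw [zero_lt_iff]; exact exp_ne_zero)]
  exact lt_one_iff_le_exp.mp hx

lemma exists_eq_one_add {x : K} (hx : v.valuation K x = 1) :
    ∃ g, v.valuation K g ≤ 1 ∧ x = 1 + l * g := by
  obtain ⟨g, hg, hxg⟩ := h.exists_mul (h.sub_one_lt x hx)
  exact ⟨g, hg, by rw [← hxg]; ring⟩

end IsRamifiedTwo

namespace IsImaginaryQuadratic

variable (hK : IsImaginaryQuadratic K)
include hK

omit hK in
-- The residue field has N(l) = 2 elements.
lemma sub_one_mem {v : HeightOneSpectrum (𝓞 K)} {l : 𝓞 K} (hl : nm l = 2)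
    (hv : v.asIdeal = Ideal.span {l}) {x : 𝓞 K} (hx : x ∉ v.asIdeal) : x - 1 ∈ v.asIdeal := by
  have hcard : Nat.card (𝓞 K ⧸ v.asIdeal) = 2 := by
    have := Ideal.absNorm_span_singleton l
    rw [← hv, show (Algebra.norm ℤ) l = nm l from rfl, hl] at this
    rw [← Submodule.cardQuot_apply]
    exact this
  have hx0 : Ideal.Quotient.mk v.asIdeal x ≠ 0 := by
    rwa [Ne, Ideal.Quotient.eq_zero_iff_mem]
  have h10 : (1 : 𝓞 K ⧸ v.asIdeal) ≠ 0 := by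
    rw [← map_one (Ideal.Quotient.mk v.asIdeal), Ne, Ideal.Quotient.eq_zero_iff_mem]
    exact v.isPrime.one_notMem
  rw [← Ideal.Quotient.eq_zero_iff_mem, map_sub, map_one, sub_eq_zero]
  by_contra hne
  have : Finite (𝓞 K ⧸ v.asIdeal) := Nat.finite_of_card_ne_zero (by rw [hcard]; norm_num)
  have : Fintype (𝓞 K ⧸ v.asIdeal) := Fintype.ofFinite _
  rw [Nat.card_eq_fintype_card] at hcard
  have hle := Finset.card_le_univ ({0, 1, Ideal.Quotient.mk v.asIdeal x} : Finset _)
  rw [hcard, Finset.card_insert_of_notMem (by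
    simp only [Finset.mem_insert, Finset.mem_singleton, not_or]
    exact ⟨h10.symm, hx0.symm⟩), Finset.card_pair (Ne.symm hne)] at hle
  norm_num at hle

lemma ramified_or_unramified [IsPrincipalIdealRing (𝓞 K)] {v : HeightOneSpectrum (𝓞 K)}
    (h2 : v.valuation K 2 < 1) :
    v.valuation K 2 = exp (-1) ∨ ∃ l t, IsRamifiedTwo v l t := by
  obtain ⟨l, hl, hv, hlv, hlw⟩ := exists_generator v K
  have hmap : algebraMap (𝓞 K) K 2 = 2 := map_ofNat _ 2
  have h2' : (2 : 𝓞 K) ∈ v.asIdeal := by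
    rw [← v.valuation_lt_one_iff_mem (K := K)]
    change v.valuation K (algebraMap (𝓞 K) K 2) < 1
    rwa [hmap]
  have hl2 : l ∣ 2 := by rwa [hv, Ideal.mem_span_singleton] at h2'
  have hinj : Function.Injective (algebraMap (𝓞 K) K) := RingOfIntegers.coe_injective
  have hl0 : algebraMap (𝓞 K) K l ≠ 0 := (map_ne_zero_iff _ hinj).mpr hl.ne_zero
  have hlval : v.valuation K (algebraMap (𝓞 K) K l) = exp (-1) := by
    rw [valuation_eq_exp hl0, hlv]
  have hunit : ∀ u : (𝓞 K)ˣ, v.valuation K (algebraMap (𝓞 K) K u) = 1 := fun u =>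
    (valuation_eq_one_iff ((map_ne_zero_iff _ hinj).mpr u.ne_zero)).mpr (ord_unit u)
  rcases hK.two_dichotomy hl hl2 with (h | ⟨hn, h⟩) | ⟨hn, ht⟩
  · left
    obtain ⟨u, hu⟩ := h
    have := congrArg (fun x => v.valuation K (algebraMap (𝓞 K) K x)) hu
    simp only [map_mul, hunit, mul_one, hlval, hmap] at this
    exact this.symm
  · right
    rcases (show (∃ t, (t = 0 ∨ t = 1 ∨ t = -1) ∧ tr l = 2 * t) ∨ tr l = 1 ∨ tr l = -1 by
      rcases hK.tr_bound hn with h | h | h | h | h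
      · exact .inl ⟨0, by omega⟩
      · exact .inr (.inl h)
      · exact .inr (.inr h)
      · exact .inl ⟨1, by omega⟩
      · exact .inl ⟨-1, by omega⟩) with ⟨t, ht, htr⟩ | htr
    · have hsq := hK.sq_eq l
      rw [hn, htr] at hsq
      refine ⟨algebraMap (𝓞 K) K l, t, hlval, ?_, ht, ?_, ?_⟩
      · have := congrArg (algebraMap (𝓞 K) K) hsq
        push_cast at this
        simp only [map_intCast, map_ofNat] at this
        rw [this]; ring
      · intro x hx
        -- Replacing x by a congruent global integer reduces the claim to the residue field of `𝓞
        -- K`.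
        obtain ⟨a, ha⟩ := v.exists_valuation_sub_lt_of_integer hx.le 1
        rw [Units.val_one] at ha
        have ha1 : v.valuation K (algebraMap (𝓞 K) K a) = 1 := by
          have := valuation_add_eq_one hx ha
          rwa [add_sub_cancel] at this
        have hmem := sub_one_mem hn hv (x := a) (v.valuation_eq_one_iff_notMem.mp ha1)
        rw [← v.valuation_lt_one_iff_mem (K := K)] at hmem
        change v.valuation K (algebraMap (𝓞 K) K (a - 1)) < 1 at hmem
        rw [map_sub, map_one] at hmem
        have := (v.valuation K).map_sub_lt hmem ha
        rwa [show algebraMap (𝓞 K) K a - 1 - (algebraMap (𝓞 K) K a - x) = x - 1 by ring] at this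
      · intro w hw
        obtain ⟨u, hu⟩ := h
        have := congrArg (fun x => ord w (algebraMap (𝓞 K) K x)) hu
        simp only [map_mul, map_pow, map_ofNat] at this
        rw [← this, ord_mul (pow_ne_zero _ hl0) ((map_ne_zero_iff _ hinj).mpr u.ne_zero), ord_pow,
          hlw w hw, ord_unit]
        norm_num
    · exfalso
      obtain ⟨u, hu⟩ := h
      have hsq := hK.sq_eq l
      have hd : l ∣ (tr l : 𝓞 K) := by
        have h3 : l ^ 2 ∣ l * (tr l : 𝓞 K) := by
          have : (l * (tr l : 𝓞 K)) = l ^ 2 * (1 + u) := by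
            rw [hn] at hsq
            push_cast at hsq
            linear_combination -hsq - hu
          exact ⟨_, this⟩
        rw [pow_two] at h3
        exact (mul_dvd_mul_iff_left hl.ne_zero).mp h3
      apply hl.not_isUnit
      refine isUnit_of_dvd_unit hd ?_
      rcases htr with h | h <;> rw [h] <;> simp
  · left
    have hc : v.valuation K (algebraMap (𝓞 K) K (conj l)) = 1 := by
      rw [valuation_eq_one_iff_notMem]
      intro hmem
      have hlm : l ∈ v.asIdeal := by rw [hv]; exact Ideal.mem_span_singleton_self l
      have hsum := v.asIdeal.add_mem hlm hmem
      rw [show l + conj l = (tr l : 𝓞 K) by rw [conj]; ring] at hsum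
      apply v.isPrime.ne_top
      refine Ideal.eq_top_of_isUnit_mem _ hsum ?_
      rcases ht with h | h <;> rw [h] <;> simp
    have := congrArg (fun x => v.valuation K (algebraMap (𝓞 K) K x)) (hK.mul_conj l)
    simp only [map_mul, hc, mul_one, hlval, hn, Int.cast_ofNat, hmap] at this
    exact this.symm

/-- A unit is congruent to `1 + 2 l` modulo `4` at no ramified prime above `2`. -/
lemma unit_not_congr {v : HeightOneSpectrum (𝓞 K)} {l : K} {t : ℤ} (h : IsRamifiedTwo v l t)
    (u : (𝓞 K)ˣ) :
    ¬ v.valuation K (algebraMap (𝓞 K) K u - (1 + 2 * l)) ≤ v.valuation K 4 := by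
  intro hle
  rw [h.valuation_four] at hle
  have h2l : v.valuation K (2 * l) = exp (-3) := by
    rw [map_mul, h.valuation_two, h.valuation_eq, ← exp_add]; norm_num
  have hval : v.valuation K (algebraMap (𝓞 K) K (1 - u)) = exp (-3) := by
    have h1 : algebraMap (𝓞 K) K (1 - u) =
        -(2 * l) + -(algebraMap (𝓞 K) K u - (1 + 2 * l)) := by
      rw [map_sub, map_one]; ring
    rw [h1, Valuation.map_add_eq_of_lt_left, Valuation.map_neg, h2l]
    rw [Valuation.map_neg, Valuation.map_neg, h2l]
    refine hle.trans_lt ?_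
    rw [exp_lt_exp]; norm_num
  have hu1 := hK.nm_of_isUnit u.isUnit
  obtain ⟨hl, hr⟩ := hK.tr_of_isUnit u.isUnit
  have hnm := hK.nm_one_sub (u : 𝓞 K)
  rw [hu1] at hnm
  have hd := hK.mul_conj (1 - u : 𝓞 K)
  rw [hnm] at hd
  have hdv : v.valuation K ((1 - tr (u : 𝓞 K) + 1 : ℤ) : K) ≤ exp (-3) := by
    have := congrArg (fun x => v.valuation K (algebraMap (𝓞 K) K x)) hd
    simp only [map_mul, hval, map_intCast] at this
    rw [← this]
    exact mul_le_of_le_one_right' (v.valuation_le_one _)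
  have hlt3 : (exp (-3) : ℤᵐ⁰) < 1 := by rw [← exp_zero, exp_lt_exp]; norm_num
  have hlt32 : (exp (-3) : ℤᵐ⁰) < exp (-2) := by rw [exp_lt_exp]; norm_num
  have h2 := h.valuation_two
  have h2lt : v.valuation K 2 < 1 := by rw [h2, ← exp_zero, exp_lt_exp]; norm_num
  -- N(1 - u) = 2 - tr u lies in {0, 1, 2, 3, 4} and is divisible by l³. Only 0 and 4 survive, where
  -- 1 - u is 0 or 2, neither of order exactly 3.
  interval_cases htr : tr (u : 𝓞 K)
  · rw [hK.eq_of_tr_eq_neg_two hu1 htr] at hval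
    have : (1 - -1 : 𝓞 K) = 2 := by norm_num
    rw [this, map_ofNat, h2] at hval
    exact absurd hval (by rw [exp_inj]; norm_num)
  · have h3 : v.valuation K 3 = 1 := by
      rw [show (3 : K) = 1 + 2 by norm_num]
      exact valuation_add_eq_one (map_one _) h2lt
    norm_num at hdv
    rw [h3] at hdv
    exact absurd hdv (not_le.mpr hlt3)
  · norm_num at hdv
    rw [h2] at hdv
    exact absurd hdv (not_le.mpr hlt32)
  · norm_num at hdv
    exact absurd hdv (not_le.mpr hlt3)
  · rw [hK.eq_of_tr_eq_two hu1 htr, sub_self, map_zero, map_zero] at hval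
    exact exp_ne_zero hval.symm

/-- If 2 is unramified at v, 1 + y² = (1 + y)² - 2y is never divisible by 4. If it is ramified,
expanding y = 1 + lg and g = 1 + lk reduces the congruence to 2 ∣ l(t + 1). Then t = ±1, and l² =
2(tl - 1) reads (l - t)² = -1. -/
lemma neg_one_eq_sq [IsPrincipalIdealRing (𝓞 K)] {v : HeightOneSpectrum (𝓞 K)}
    (h2 : v.valuation K 2 < 1) {y : K} (hy : v.valuation K (1 + y ^ 2) ≤ v.valuation K 4) :
    ∃ w : K, -1 = w ^ 2 := by
  have hval4 : v.valuation K 4 = v.valuation K 2 * v.valuation K 2 := by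
    rw [← map_mul]; norm_num
  have h4lt : v.valuation K 4 < 1 := by
    rw [hval4]; exact mul_lt_one_of_lt_of_le h2 h2.le
  have hy1 : v.valuation K y = 1 := by
    have h1 : v.valuation K (y ^ 2) = 1 := by
      have := valuation_add_eq_one (V := v.valuation K) (x := -1) (y := 1 + y ^ 2)
        (by rw [Valuation.map_neg, map_one]) (hy.trans_lt h4lt)
      rwa [neg_add_cancel_left] at this
    rw [map_pow] at h1
    exact (pow_eq_one_iff_of_nonneg zero_le two_ne_zero).mp h1
  rcases hK.ramified_or_unramified h2 with h | ⟨l, t, h⟩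
  · exfalso
    have h2y : v.valuation K (2 * y) = exp (-1) := by rw [map_mul, h, hy1, mul_one]
    have hid : 1 + y ^ 2 = (1 + y) ^ 2 - 2 * y := by ring
    have hle1 : v.valuation K (1 + y) ≤ 1 :=
      (v.valuation K).map_add_le (map_one _).le hy1.le
    rcases hle1.lt_or_eq with hlt | heq
    · have hsq : v.valuation K ((1 + y) ^ 2) < v.valuation K (2 * y) := by
        rw [map_pow, sq, h2y]
        rw [lt_one_iff_le_exp] at hlt
        refine (mul_le_mul' hlt hlt).trans_lt ?_
        rw [← exp_add, exp_lt_exp]; norm_num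
      rw [hid, Valuation.map_sub_eq_of_lt_right _ hsq, h2y, hval4, h, ← exp_add, exp_le_exp] at hy
      norm_num at hy
    · have h1 : v.valuation K ((1 + y) ^ 2 - 2 * y) = 1 := by
        rw [sub_eq_add_neg]
        apply valuation_add_eq_one
        · rw [map_pow, heq, one_pow]
        · rw [Valuation.map_neg, h2y, lt_one_iff_le_exp]
      rw [hid, h1] at hy
      exact absurd hy (not_le.mpr h4lt)
  · set κ : K := t * l - 1 with hκ
    have hκ1 := h.valuation_kappa
    rw [← hκ] at hκ1
    obtain ⟨g, hg, rfl⟩ := h.exists_eq_one_add hy1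
    have hlsq := h.sq_eq
    rw [← hκ] at hlsq
    have h20 : (2 : K) ≠ 0 := two_ne_zero
    have hv20 : 0 < v.valuation K 2 := by rw [h.valuation_two, zero_lt_iff]; exact exp_ne_zero
    have e1 : v.valuation K (1 + l * g + κ * g ^ 2) ≤ v.valuation K 2 := by
      have : 1 + (1 + l * g) ^ 2 = 2 * (1 + l * g + κ * g ^ 2) := by
        linear_combination g ^ 2 * hlsq
      rw [this, map_mul, hval4] at hy
      exact (mul_le_mul_iff_right₀ hv20).mp hy
    have hg1 : v.valuation K g = 1 := by
      by_contra hne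
      have hglt := lt_of_le_of_ne hg hne
      have : v.valuation K (1 + g * (l + κ * g)) = 1 := by
        apply valuation_add_eq_one (map_one _)
        apply valuation_mul_lt_one hglt
        exact (v.valuation K).map_add_le h.lt_one.le (valuation_mul_le_one hκ1.le hg)
      rw [show 1 + l * g + κ * g ^ 2 = 1 + g * (l + κ * g) by ring, this] at e1
      exact absurd e1 (not_le.mpr h2)
    obtain ⟨k, hk, rfl⟩ := h.exists_eq_one_add hg1
    have e2 : v.valuation K (1 + l + κ) ≤ v.valuation K 2 := by
      have : 1 + l + κ = (1 + l * (1 + l * k) + κ * (1 + l * k) ^ 2) -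
          2 * (κ * (k + l * k + κ * k ^ 2)) := by
        linear_combination (-k - κ * k ^ 2) * hlsq
      rw [this]
      apply (v.valuation K).map_sub_le e1
      rw [map_mul]
      apply mul_le_of_le_one_right'
      apply valuation_mul_le_one hκ1.le
      apply (v.valuation K).map_add_le
      · exact (v.valuation K).map_add_le hk (valuation_mul_le_one h.lt_one.le hk)
      · apply valuation_mul_le_one hκ1.le
        rw [map_pow]
        exact pow_le_one₀ zero_le hk
    have hlin : 1 + l + κ = l * (t + 1) := by rw [hκ]; ring
    rw [hlin, map_mul, h.valuation_eq, h.valuation_two] at e2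
    have ht0 : t ≠ 0 := by
      rintro rfl
      rw [Int.cast_zero, zero_add, map_one, mul_one, exp_le_exp] at e2
      norm_num at e2
    have ht2 : (t : K) ^ 2 = 1 := by
      rcases h.abs_le with ht | ht | ht
      · exact absurd ht ht0
      · rw [ht]; norm_num
      · rw [ht]; norm_num
    refine ⟨l - t, ?_⟩
    rw [hκ] at hlsq
    linear_combination -hlsq - ht2

/-- A unit that is a square modulo `4` at a prime above `2` is a square. -/
lemma unit_eq_sq [IsPrincipalIdealRing (𝓞 K)] {v : HeightOneSpectrum (𝓞 K)}
    (h2 : v.valuation K 2 < 1) (u : (𝓞 K)ˣ) {y : K}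
    (hy : v.valuation K (algebraMap (𝓞 K) K u - y ^ 2) ≤ v.valuation K 4) :
    ∃ w : K, algebraMap (𝓞 K) K u = w ^ 2 := by
  have hunit : ∀ u : (𝓞 K)ˣ, v.valuation K (algebraMap (𝓞 K) K u) = 1 := fun u =>
    (valuation_eq_one_iff ((map_ne_zero_iff _ RingOfIntegers.coe_injective).mpr u.ne_zero)).mpr
      (ord_unit u)
  have hneg : ∀ w : (𝓞 K)ˣ, (u : 𝓞 K) = - (w : 𝓞 K) ^ 2 →
      ∃ w : K, algebraMap (𝓞 K) K u = w ^ 2 := by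
    intro w hw
    have hw0 : algebraMap (𝓞 K) K w ≠ 0 :=
      (map_ne_zero_iff _ RingOfIntegers.coe_injective).mpr w.ne_zero
    obtain ⟨i, hi⟩ := hK.neg_one_eq_sq h2 (y := y / algebraMap (𝓞 K) K w) (by
      have : algebraMap (𝓞 K) K u - y ^ 2 =
          -(algebraMap (𝓞 K) K w ^ 2 * (1 + (y / algebraMap (𝓞 K) K w) ^ 2)) := by
        rw [hw]
        simp only [map_neg, map_pow]
        field_simp
        ring
      rw [this, Valuation.map_neg, map_mul, map_pow, hunit, one_pow, one_mul] at hy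
      exact hy)
    refine ⟨i * algebraMap (𝓞 K) K w, ?_⟩
    rw [hw, mul_pow, ← hi, map_neg, map_pow, neg_one_mul]
  have hu1 := hK.nm_of_isUnit u.isUnit
  obtain ⟨hl, hr⟩ := hK.tr_of_isUnit u.isUnit
  have hsq := hK.sq_eq (u : 𝓞 K)
  rw [hu1] at hsq
  interval_cases htr : tr (u : 𝓞 K)
  · exact hneg 1 (by rw [hK.eq_of_tr_eq_neg_two hu1 htr]; simp)
  -- Here u is a primitive cube root of unity, so u = u⁴.
  · refine ⟨algebraMap (𝓞 K) K (u ^ 2 : 𝓞 K), ?_⟩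
    rw [← map_pow]
    congr 1
    push_cast at hsq
    linear_combination (-(u : 𝓞 K) ^ 2 + u) * hsq
  -- Here u² = -1 and (u - 1)² = -2u. Unramified: 2 has odd valuation. Ramified: u - 1 has order 1,
  -- but a unit that is a square modulo 4 is 1 modulo 2.
  · exfalso
    push_cast at hsq
    have hsq' : ((u : 𝓞 K) - 1) ^ 2 = -2 * u := by linear_combination hsq
    have hval := congrArg (fun x => v.valuation K (algebraMap (𝓞 K) K x)) hsq'
    simp only [map_pow, map_mul, hunit, mul_one, map_neg, map_ofNat, Valuation.map_neg] at hval
    rcases hK.ramified_or_unramified h2 with h | ⟨l, t, h⟩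
    · rw [h] at hval
      have hne : v.valuation K (algebraMap (𝓞 K) K ((u : 𝓞 K) - 1)) ≠ 0 := by
        intro h0
        rw [h0, zero_pow two_ne_zero] at hval
        exact exp_ne_zero hval.symm
      rw [← exp_log hne, ← exp_nsmul, exp_inj] at hval
      simp only [nsmul_eq_mul, Nat.cast_ofNat] at hval
      omega
    · rw [h.valuation_two] at hval
      rw [h.valuation_four] at hy
      have hne : v.valuation K (algebraMap (𝓞 K) K ((u : 𝓞 K) - 1)) ≠ 0 := by
        intro h0
        rw [h0, zero_pow two_ne_zero] at hval
        exact exp_ne_zero hval.symm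
      have hval1 : v.valuation K (algebraMap (𝓞 K) K ((u : 𝓞 K) - 1)) = exp (-1) := by
        rw [← exp_log hne, ← exp_nsmul, exp_inj] at hval
        rw [← exp_log hne, exp_inj]
        simp only [nsmul_eq_mul, Nat.cast_ofNat] at hval
        omega
      have hlt4 : (exp (-4) : ℤᵐ⁰) < 1 := by rw [← exp_zero, exp_lt_exp]; norm_num
      have hy1 : v.valuation K y = 1 := by
        have := (v.valuation K).map_sub_eq_of_lt_right (x := algebraMap (𝓞 K) K u - y ^ 2)
          (y := algebraMap (𝓞 K) K u) (by rw [hunit]; exact hy.trans_lt hlt4)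
        rw [sub_sub_cancel_left, Valuation.map_neg, hunit, map_pow] at this
        exact (pow_eq_one_iff_of_nonneg zero_le two_ne_zero).mp this
      obtain ⟨g, hg, rfl⟩ := h.exists_eq_one_add hy1
      have hsum : algebraMap (𝓞 K) K ((u : 𝓞 K) - 1) =
          (algebraMap (𝓞 K) K u - (1 + l * g) ^ 2) + 2 * (l * g + (t * l - 1) * g ^ 2) := by
        rw [map_sub, map_one]
        linear_combination g ^ 2 * h.sq_eq
      have : v.valuation K (algebraMap (𝓞 K) K ((u : 𝓞 K) - 1)) ≤ exp (-2) := by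
        rw [hsum]
        refine (v.valuation K).map_add_le (hy.trans ?_) ?_
        · rw [exp_le_exp]; norm_num
        · rw [map_mul, h.valuation_two]
          apply mul_le_of_le_one_right'
          apply (v.valuation K).map_add_le (valuation_mul_le_one h.lt_one.le hg)
          apply valuation_mul_le_one h.valuation_kappa.le
          rw [map_pow]
          exact pow_le_one₀ zero_le hg
      rw [hval1, exp_le_exp] at this
      norm_num at this
  -- Here u is a primitive sixth root of unity, so u = -u⁴ and the case of -1 applies.
  · refine hneg (u ^ 2) ?_
    push_cast at hsq ⊢
    linear_combination ((u : 𝓞 K) ^ 2 + u) * hsq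
  · exact ⟨1, by rw [hK.eq_of_tr_eq_two hu1 htr]; simp⟩

end IsImaginaryQuadratic

end ImaginaryQuadratic

/-! ### Integral models of a curve with a 2-torsion point, and of its 2-isogenous curve -/

namespace TwoTorsionReduction

open AdditiveValuation WithZero HeightOneSpectrum EllipticIsogeny ImaginaryQuadratic
  WeierstrassCurve

variable {K : Type*} [Field K] [NumberField K]

/-- The coefficients of the Weierstrass equation `W` are integral at `v`. -/
structure IsIntegralAt (v : HeightOneSpectrum (𝓞 K)) (W : WeierstrassCurve K) : Prop where
  a₁ : W.a₁ ∈ (v.valuation K).integer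
  a₂ : W.a₂ ∈ (v.valuation K).integer
  a₃ : W.a₃ ∈ (v.valuation K).integer
  a₄ : W.a₄ ∈ (v.valuation K).integer
  a₆ : W.a₆ ∈ (v.valuation K).integer

/-- Good reduction of `W` at `v`. -/
def GoodAt (v : HeightOneSpectrum (𝓞 K)) (W : WeierstrassCurve K) : Prop :=
  ∃ C : VariableChange K, IsIntegralAt v (C • W) ∧ v.valuation K (C • W).Δ = 1

/-- Multiplicative reduction of `W` at `v`, with minimal discriminant of valuation `n`. -/
def MultAt (v : HeightOneSpectrum (𝓞 K)) (W : WeierstrassCurve K) (n : ℤ) : Prop :=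
  0 < n ∧ ∃ C : VariableChange K, IsIntegralAt v (C • W) ∧ v.valuation K (C • W).c₄ = 1 ∧
    (C • W).Δ ≠ 0 ∧ ord v (C • W).Δ = n

lemma GoodAt.of_smul {v : HeightOneSpectrum (𝓞 K)} {W : WeierstrassCurve K}
    (C : VariableChange K) (h : GoodAt v W) : GoodAt v (C • W) := by
  obtain ⟨C', h1, h2⟩ := h
  refine ⟨C' * C⁻¹, ?_⟩
  rw [mul_smul, inv_smul_smul]
  exact ⟨h1, h2⟩

lemma MultAt.of_smul {v : HeightOneSpectrum (𝓞 K)} {W : WeierstrassCurve K} {n : ℤ}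
    (C : VariableChange K) (h : MultAt v W n) : MultAt v (C • W) n := by
  obtain ⟨hn, C', h1⟩ := h
  refine ⟨hn, C' * C⁻¹, ?_⟩
  rw [mul_smul, inv_smul_smul]
  exact h1

/-- Up to scaling, the curve `y² = x³ + a x² + b x` has the equation
`y² + α₁ x y = x³ + α₂ x² + β x` with coefficients integral at `v`, where `β` has valuation `k` and
`(α₁² + 4 α₂)² - 64 β` is a unit. -/
def IntPair (v : HeightOneSpectrum (𝓞 K)) (a b : K) (k : ℤ) : Prop :=
  ∃ u α₁ α₂ β : K, u ≠ 0 ∧ β ≠ 0 ∧ α₁ ∈ (v.valuation K).integer ∧ α₂ ∈ (v.valuation K).integer ∧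
    β ∈ (v.valuation K).integer ∧ 4 * a = u ^ 2 * (α₁ ^ 2 + 4 * α₂) ∧ b = u ^ 4 * β ∧
    ord v β = k ∧ v.valuation K ((α₁ ^ 2 + 4 * α₂) ^ 2 - 64 * β) = 1

/-- The pair `(a, b)` is of the type that occurs for supersingular reduction at a ramified prime
above `2`. -/
def SupersingularPair (v : HeightOneSpectrum (𝓞 K)) (a b : K) : Prop :=
  ∃ (l : K) (t : ℤ) (r s : K), IsRamifiedTwo v l t ∧ r ≠ 0 ∧ s ≠ 0 ∧
    v.valuation K (b * r ^ 4 - (1 + 2 * l)) ≤ v.valuation K 4 ∧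
    v.valuation K ((a ^ 2 - 4 * b) * s ^ 4 - (1 + 2 * l)) ≤ v.valuation K 4

variable {v : HeightOneSpectrum (𝓞 K)} {a b : K} {k : ℤ}

lemma IntPair.smul {c : K} (hc : c ≠ 0) (h : IntPair v a b k) :
    IntPair v (c ^ 2 * a) (c ^ 4 * b) k := by
  obtain ⟨u, α₁, α₂, β, hu, hβ, h1, h2, h3, ha, hb, hk, hunit⟩ := h
  refine ⟨c * u, α₁, α₂, β, mul_ne_zero hc hu, hβ, h1, h2, h3, ?_, ?_, hk, hunit⟩
  · linear_combination c ^ 2 * ha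
  · rw [hb]; ring

lemma SupersingularPair.smul {c : K} (hc : c ≠ 0) (h : SupersingularPair v a b) :
    SupersingularPair v (c ^ 2 * a) (c ^ 4 * b) := by
  obtain ⟨l, t, r, s, hl, hr, hs, h1, h2⟩ := h
  refine ⟨l, t, r / c, s / c, hl, div_ne_zero hr hc, div_ne_zero hs hc, ?_, ?_⟩
  · rwa [show c ^ 4 * b * (r / c) ^ 4 = b * r ^ 4 by field_simp]
  · rwa [show ((c ^ 2 * a) ^ 2 - 4 * (c ^ 4 * b)) * (s / c) ^ 4 = (a ^ 2 - 4 * b) * s ^ 4 by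
      field_simp]

lemma ord_of_valuation_eq_one {x : K} (h : v.valuation K x = 1) : ord v x = 0 :=
  (valuation_eq_one_iff (ne_zero_of_valuation_eq_one h)).mp h

/-- Valuations of `b` and of the discriminant of `x² + a x + b` for an integral pair. -/
lemma IntPair.ord_eq (h : IntPair v a b k) : b ≠ 0 ∧ a ^ 2 - 4 * b ≠ 0 ∧
    ∃ m : ℤ, ord v b = 4 * m + k ∧ ord v (16 * (a ^ 2 - 4 * b)) = 4 * m := by
  obtain ⟨u, α₁, α₂, β, hu, hβ, h1, h2, h3, ha, hb, hk, hunit⟩ := h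
  have hD : 16 * (a ^ 2 - 4 * b) = u ^ 4 * ((α₁ ^ 2 + 4 * α₂) ^ 2 - 64 * β) := by
    rw [hb]
    linear_combination (4 * a + u ^ 2 * (α₁ ^ 2 + 4 * α₂)) * ha
  have hne := ne_zero_of_valuation_eq_one hunit
  refine ⟨by rw [hb]; exact mul_ne_zero (pow_ne_zero _ hu) hβ, ?_, ord v u, ?_, ?_⟩
  · intro h0
    rw [h0, mul_zero] at hD
    exact mul_ne_zero (pow_ne_zero _ hu) hne hD.symm
  · rw [hb, ord_mul (pow_ne_zero _ hu) hβ, ord_pow, hk]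
    push_cast; ring
  · rw [hD, ord_mul (pow_ne_zero _ hu) hne, ord_pow, ord_of_valuation_eq_one hunit]
    push_cast; ring

/-- The discriminant of `x² + a x + b` is a fourth power times a square modulo `4`. -/
lemma IntPair.exists_sq (h : IntPair v a b k) : ∃ u ρ : K,
    v.valuation K ((a ^ 2 - 4 * b) * u ^ 4) = 1 ∧
    v.valuation K ((a ^ 2 - 4 * b) * u ^ 4 - ρ ^ 2) ≤ v.valuation K 4 := by
  obtain ⟨u, α₁, α₂, β, hu, hβ, h1, h2, h3, ha, hb, hk, hunit⟩ := h
  have hD : (a ^ 2 - 4 * b) * (2 / u) ^ 4 = (α₁ ^ 2 + 4 * α₂) ^ 2 - 64 * β := by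
    rw [hb]
    field_simp
    linear_combination (4 * a + u ^ 2 * (α₁ ^ 2 + 4 * α₂)) * ha
  refine ⟨2 / u, α₁ ^ 2 + 4 * α₂, by rw [hD, hunit], ?_⟩
  rw [hD, show (α₁ ^ 2 + 4 * α₂) ^ 2 - 64 * β - (α₁ ^ 2 + 4 * α₂) ^ 2 = 4 * (-16 * β) by ring,
    map_mul]
  apply mul_le_of_le_one_right'
  rw [← Valuation.mem_integer_iff]
  exact mul_mem (neg_mem (ofNat_mem _ _)) h3

lemma smul_twoTorsionCurve {u α₁ α₂ β : K} (hu : u ≠ 0)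
    (ha : 4 * a = u ^ 2 * (α₁ ^ 2 + 4 * α₂)) (hb : b = u ^ 4 * β) :
    (⟨Units.mk0 u hu, 0, u * α₁ / 2, 0⟩ : VariableChange K) • twoTorsionCurve a b =
      ⟨α₁, α₂, 0, β, 0⟩ := by
  have h4 : (4 : K) ≠ 0 := by norm_num
  have ha' : a = u ^ 2 * (α₁ ^ 2 + 4 * α₂) / 4 := by field_simp; linear_combination ha
  ext <;> simp [variableChange_def, twoTorsionCurve, ha', hb] <;> field_simp
  ring

lemma IntPair.goodAt (h : IntPair v a b 0) : GoodAt v (twoTorsionCurve a b) := by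
  obtain ⟨u, α₁, α₂, β, hu, hβ, h1, h2, h3, ha, hb, hk, hunit⟩ := h
  have hC := smul_twoTorsionCurve hu ha hb
  refine ⟨_, by rw [hC]; exact ⟨h1, h2, zero_mem _, h3, zero_mem _⟩, ?_⟩
  rw [hC]
  have : (⟨α₁, α₂, 0, β, 0⟩ : WeierstrassCurve K).Δ =
      β ^ 2 * ((α₁ ^ 2 + 4 * α₂) ^ 2 - 64 * β) := by
    simp only [Δ, b₂, b₄, b₆, b₈]; ring
  rw [this, map_mul, map_pow, hunit, (valuation_eq_one_iff hβ).mpr hk]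
  simp

/-- The equation of the isogenous curve for an integral pair. -/
lemma dual_variableChange {u α₁ α₂ β : K} (hu : u ≠ 0)
    (ha : 4 * a = u ^ 2 * (α₁ ^ 2 + 4 * α₂)) (hb : b = u ^ 4 * β) :
    (⟨Units.mk0 u hu, a, u * α₁ / 2, 0⟩ : VariableChange K) •
      twoTorsionCurve (-2 * a) (a ^ 2 - 4 * b) =
      ⟨α₁, α₂, 0, -4 * β, -(α₁ ^ 2 + 4 * α₂) * β⟩ := by
  have h4 : (4 : K) ≠ 0 := by norm_num
  have ha' : a = u ^ 2 * (α₁ ^ 2 + 4 * α₂) / 4 := by field_simp; linear_combination ha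
  ext <;> simp [variableChange_def, twoTorsionCurve, ha', hb] <;> field_simp <;> ring

omit [NumberField K] in
lemma dual_Δ (α₁ α₂ β : K) :
    (⟨α₁, α₂, 0, -4 * β, -(α₁ ^ 2 + 4 * α₂) * β⟩ : WeierstrassCurve K).Δ =
      β * ((α₁ ^ 2 + 4 * α₂) ^ 2 - 64 * β) ^ 2 := by
  simp only [Δ, b₂, b₄, b₆, b₈]; ring

lemma isIntegralAt_dual {α₁ α₂ β : K} (h1 : α₁ ∈ (v.valuation K).integer)
    (h2 : α₂ ∈ (v.valuation K).integer) (h3 : β ∈ (v.valuation K).integer) :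
    IsIntegralAt v ⟨α₁, α₂, 0, -4 * β, -(α₁ ^ 2 + 4 * α₂) * β⟩ := by
  constructor <;>
  apply_rules [add_mem, mul_mem, pow_mem, neg_mem, ofNat_mem, zero_mem]

lemma IntPair.goodAt_dual (h : IntPair v a b 0) :
    GoodAt v (twoTorsionCurve (-2 * a) (a ^ 2 - 4 * b)) := by
  obtain ⟨u, α₁, α₂, β, hu, hβ, h1, h2, h3, ha, hb, hk, hunit⟩ := h
  refine ⟨_, by rw [dual_variableChange hu ha hb]; exact isIntegralAt_dual h1 h2 h3, ?_⟩
  rw [dual_variableChange hu ha hb, dual_Δ, map_mul, map_pow, hunit,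
    (valuation_eq_one_iff hβ).mpr hk]
  simp

lemma IntPair.multAt (h : IntPair v a b k) (hk0 : 0 < k) :
    MultAt v (twoTorsionCurve a b) (2 * k) := by
  obtain ⟨u, α₁, α₂, β, hu, hβ, h1, h2, h3, ha, hb, hk, hunit⟩ := h
  have hC := smul_twoTorsionCurve hu ha hb
  have hlt : v.valuation K β < 1 := (valuation_lt_one_iff hβ).mpr (by omega)
  have hΔ : (⟨α₁, α₂, 0, β, 0⟩ : WeierstrassCurve K).Δ =
      β ^ 2 * ((α₁ ^ 2 + 4 * α₂) ^ 2 - 64 * β) := by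
    simp only [Δ, b₂, b₄, b₆, b₈]; ring
  have hc : (⟨α₁, α₂, 0, β, 0⟩ : WeierstrassCurve K).c₄ =
      ((α₁ ^ 2 + 4 * α₂) ^ 2 - 64 * β) + β * 16 := by
    simp only [c₄, b₂, b₄]; ring
  have hne := ne_zero_of_valuation_eq_one hunit
  refine ⟨by omega, _, by rw [hC]; exact ⟨h1, h2, zero_mem _, h3, zero_mem _⟩, ?_, ?_, ?_⟩ <;>
    rw [hC]
  · rw [hc]
    exact valuation_add_eq_one hunit (valuation_mul_lt_one hlt (ofNat_mem (v.valuation K).integer _))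
  · rw [hΔ]; exact mul_ne_zero (pow_ne_zero _ hβ) hne
  · rw [hΔ, ord_mul (pow_ne_zero _ hβ) hne, ord_pow, hk, ord_of_valuation_eq_one hunit]
    simp

/-- The discriminant βD² contains β once, against β² in `IntPair.multAt`. This halving is what can
make the valuation odd. -/
lemma IntPair.multAt_dual (h : IntPair v a b k) (hk0 : 0 < k) :
    MultAt v (twoTorsionCurve (-2 * a) (a ^ 2 - 4 * b)) k := by
  obtain ⟨u, α₁, α₂, β, hu, hβ, h1, h2, h3, ha, hb, hk, hunit⟩ := h
  have hC := dual_variableChange hu ha hb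
  have hlt : v.valuation K β < 1 := (valuation_lt_one_iff hβ).mpr (by omega)
  have hc : (⟨α₁, α₂, 0, -4 * β, -(α₁ ^ 2 + 4 * α₂) * β⟩ : WeierstrassCurve K).c₄ =
      ((α₁ ^ 2 + 4 * α₂) ^ 2 - 64 * β) + β * 256 := by
    simp only [c₄, b₂, b₄]; ring
  have hne := ne_zero_of_valuation_eq_one hunit
  refine ⟨hk0, _, by rw [hC]; exact isIntegralAt_dual h1 h2 h3, ?_, ?_, ?_⟩ <;> rw [hC]
  · rw [hc]
    exact valuation_add_eq_one hunit (valuation_mul_lt_one hlt (ofNat_mem (v.valuation K).integer _))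
  · rw [dual_Δ]; exact mul_ne_zero hβ (pow_ne_zero _ hne)
  · rw [dual_Δ, ord_mul hβ (pow_ne_zero _ hne), ord_pow, hk, ord_of_valuation_eq_one hunit]
    simp

end TwoTorsionReduction

/-! ### From a 2-torsion point on an integral model to an integral pair -/

namespace TwoTorsionReduction

open AdditiveValuation WithZero HeightOneSpectrum EllipticIsogeny ImaginaryQuadratic
  WeierstrassCurve

variable {K : Type*} [Field K] [NumberField K] {v : HeightOneSpectrum (𝓞 K)}

/-- `(X, Y)` is a point of order two of the curve `W`. -/
structure IsTwoTorsion (W : WeierstrassCurve K) (X Y : K) : Prop where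
  eqn : Y ^ 2 + W.a₁ * X * Y + W.a₃ * Y = X ^ 3 + W.a₂ * X ^ 2 + W.a₄ * X + W.a₆
  two_mul : 2 * Y + W.a₁ * X + W.a₃ = 0

/-- The coefficient of `x²` after the point of abscissa `X` has been moved to the origin. -/
def shiftedA (W : WeierstrassCurve K) (X : K) : K := 3 * X + W.b₂ / 4

/-- The coefficient of `x` after the point of abscissa `X` has been moved to the origin. -/
def shiftedB (W : WeierstrassCurve K) (X : K) : K := 3 * X ^ 2 + W.b₂ * X / 2 + W.b₄ / 2

variable {W : WeierstrassCurve K} {X Y : K}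

omit [NumberField K] in
lemma IsTwoTorsion.cubic (h : IsTwoTorsion W X Y) :
    4 * X ^ 3 + W.b₂ * X ^ 2 + 2 * W.b₄ * X + W.b₆ = 0 := by
  simp only [b₂, b₄, b₆]
  linear_combination (-4) * h.eqn + (2 * Y + W.a₁ * X + W.a₃) * h.two_mul

lemma IsTwoTorsion.Δ_eq (h : IsTwoTorsion W X Y) :
    W.Δ = 16 * shiftedB W X ^ 2 * (shiftedA W X ^ 2 - 4 * shiftedB W X) := by
  have h1 := h.cubic
  have h2 := W.b_relation
  have h6 : W.b₆ = -(4 * X ^ 3 + W.b₂ * X ^ 2 + 2 * W.b₄ * X) := by linear_combination h1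
  have h8 : W.b₈ = (W.b₂ * W.b₆ - W.b₄ ^ 2) / 4 := by
    rw [eq_div_iff (by norm_num)]; linear_combination h2
  simp only [Δ, shiftedA, shiftedB, h8, h6]
  ring

/-- The case of a point of order two with integral coordinates. -/
lemma IsTwoTorsion.valuation_y_le (hW : IsIntegralAt v W) (h : IsTwoTorsion W X Y)
    (hX : X ∈ (v.valuation K).integer) : Y ∈ (v.valuation K).integer := by
  have e : Y * Y = -(X ^ 3 + W.a₂ * X ^ 2 + W.a₄ * X + W.a₆) := by
    linear_combination -h.eqn + Y * h.two_mul
  have hm : Y * Y ∈ (v.valuation K).integer := by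
    rw [e]
    have := hW.a₂; have := hW.a₄; have := hW.a₆
    apply_rules [add_mem, mul_mem, pow_mem, neg_mem]
  rw [Valuation.mem_integer_iff] at hm ⊢
  rw [map_mul] at hm
  by_contra hlt
  rw [not_le] at hlt
  exact absurd hm (not_le.mpr (one_lt_mul'' hlt hlt))

lemma valuation_eq_one_of_mul {x y : K} (hx : x ∈ (v.valuation K).integer)
    (hy : y ∈ (v.valuation K).integer) (h : v.valuation K (x * y) = 1) :
    v.valuation K x = 1 ∧ v.valuation K y = 1 := by
  rw [map_mul] at h
  constructor
  · refine le_antisymm hx (not_lt.mp fun hlt => ?_)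
    exact (((mul_le_of_le_one_right' hy).trans_lt hlt).ne h)
  · refine le_antisymm hy (not_lt.mp fun hlt => ?_)
    exact (((mul_le_of_le_one_left' hx).trans_lt hlt).ne h)

lemma IsTwoTorsion.exists_of_integral (hW : IsIntegralAt v W) (h : IsTwoTorsion W X Y)
    (hX : X ∈ (v.valuation K).integer) :
    ∃ α₁ α₂ : K, α₁ ∈ (v.valuation K).integer ∧ α₂ ∈ (v.valuation K).integer ∧
      4 * shiftedA W X = α₁ ^ 2 + 4 * α₂ ∧ shiftedB W X ∈ (v.valuation K).integer ∧
      W.Δ = shiftedB W X ^ 2 * ((α₁ ^ 2 + 4 * α₂) ^ 2 - 64 * shiftedB W X) ∧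
      W.c₄ = ((α₁ ^ 2 + 4 * α₂) ^ 2 - 64 * shiftedB W X) + 16 * shiftedB W X := by
  have hY := h.valuation_y_le hW hX
  have h1 := hW.a₁
  have h2 := hW.a₂
  have h4 := hW.a₄
  have hA : 4 * shiftedA W X = W.a₁ ^ 2 + 4 * (W.a₂ + 3 * X) := by
    simp only [shiftedA, b₂]; ring
  refine ⟨W.a₁, W.a₂ + 3 * X, h1, ?_, hA, ?_, ?_, ?_⟩
  · apply_rules [add_mem, mul_mem, ofNat_mem]
  · have : shiftedB W X = 3 * X ^ 2 + 2 * W.a₂ * X + W.a₄ - W.a₁ * Y := by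
      simp only [shiftedB, b₂, b₄]
      linear_combination W.a₁ / 2 * h.two_mul
    rw [this]
    apply_rules [add_mem, sub_mem, mul_mem, pow_mem, ofNat_mem]
  · rw [← hA, h.Δ_eq]; ring
  · rw [← hA]
    simp only [c₄, shiftedA, shiftedB]; ring

lemma IsTwoTorsion.intPair_of_good (hW : IsIntegralAt v W) (h : IsTwoTorsion W X Y)
    (hX : X ∈ (v.valuation K).integer) (hΔ : v.valuation K W.Δ = 1) :
    IntPair v (shiftedA W X) (shiftedB W X) 0 := by
  obtain ⟨α₁, α₂, h1, h2, hA, hB, hΔ', -⟩ := h.exists_of_integral hW hX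
  rw [hΔ'] at hΔ
  obtain ⟨hb, hr⟩ := valuation_eq_one_of_mul (pow_mem hB 2) (by
    apply_rules [add_mem, sub_mem, mul_mem, pow_mem, ofNat_mem]) hΔ
  rw [map_pow] at hb
  have hb1 := (pow_eq_one_iff_of_nonneg zero_le two_ne_zero).mp hb
  exact ⟨1, α₁, α₂, _, one_ne_zero, ne_zero_of_valuation_eq_one hb1, h1, h2, hB,
    by rw [hA]; ring, by ring, ord_of_valuation_eq_one hb1, hr⟩

/-- With B = `shiftedB W X`, c₄ is D + 16B and is a unit. Either D is a unit and the model itself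
qualifies, or 16B is a unit. Then 2 is invertible and the dual curve qualifies with α₁ = 0. -/
lemma IsTwoTorsion.intPair_of_mult (hW : IsIntegralAt v W) (h : IsTwoTorsion W X Y)
    (hX : X ∈ (v.valuation K).integer) (hΔ0 : W.Δ ≠ 0) (hc : v.valuation K W.c₄ = 1) :
    (∃ k, IntPair v (shiftedA W X) (shiftedB W X) k ∧ ord v W.Δ = 2 * k) ∨
      IntPair v (-2 * shiftedA W X) (shiftedA W X ^ 2 - 4 * shiftedB W X) (ord v W.Δ) := by
  obtain ⟨α₁, α₂, h1, h2, hA, hB, hΔ', hc'⟩ := h.exists_of_integral hW hX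
  have hr : (α₁ ^ 2 + 4 * α₂) ^ 2 - 64 * shiftedB W X ∈ (v.valuation K).integer := by
    apply_rules [add_mem, sub_mem, mul_mem, pow_mem, ofNat_mem]
  have hB0 : shiftedB W X ≠ 0 := by
    intro h0
    rw [h0] at hΔ'
    exact hΔ0 (by rw [hΔ']; ring)
  rcases (show v.valuation K _ ≤ 1 from hr).lt_or_eq with hlt | heq
  · right
    have h16 : v.valuation K (16 * shiftedB W X) = 1 := by
      have := (v.valuation K).map_sub_eq_of_lt_left (x := W.c₄) (hlt.trans_eq hc.symm)
      rwa [hc', add_sub_cancel_left, ← hc', hc] at this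
    obtain ⟨h16', hB1⟩ := valuation_eq_one_of_mul (ofNat_mem _ 16) hB h16
    have h2u : v.valuation K (2 : K) = 1 := by
      rw [show (16 : K) = 2 * 8 by norm_num] at h16'
      exact (valuation_eq_one_of_mul (ofNat_mem _ 2) (ofNat_mem _ 8) h16').1
    have hinv : (2⁻¹ : K) ∈ (v.valuation K).integer := by
      rw [Valuation.mem_integer_iff, map_inv₀, h2u, inv_one]
    have hD : shiftedA W X ^ 2 - 4 * shiftedB W X =
        2⁻¹ ^ 4 * ((α₁ ^ 2 + 4 * α₂) ^ 2 - 64 * shiftedB W X) := by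
      rw [← hA]; ring
    have hD0 : shiftedA W X ^ 2 - 4 * shiftedB W X ≠ 0 := by
      intro h0
      rw [h.Δ_eq, h0] at hΔ0
      simp at hΔ0
    refine ⟨1, 0, -(2⁻¹ * (α₁ ^ 2 + 4 * α₂)), _, one_ne_zero, hD0, zero_mem _, ?_, ?_, ?_, by ring,
      ?_, ?_⟩
    · apply_rules [add_mem, mul_mem, pow_mem, neg_mem, ofNat_mem]
    · rw [hD]
      exact mul_mem (pow_mem hinv 4) hr
    · rw [← hA]; ring
    · rw [h.Δ_eq, ord_mul (mul_ne_zero (by norm_num) (pow_ne_zero _ hB0)) hD0,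
        ord_mul (by norm_num) (pow_ne_zero _ hB0), ord_pow, ord_of_valuation_eq_one h16',
        ord_of_valuation_eq_one hB1]
      ring
    · have : (0 ^ 2 + 4 * -(2⁻¹ * (α₁ ^ 2 + 4 * α₂))) ^ 2 -
          64 * (shiftedA W X ^ 2 - 4 * shiftedB W X) = 16 * (16 * shiftedB W X) := by
        rw [← hA]; ring
      rw [this, map_mul, h16, h16', mul_one]
  · left
    have hne := ne_zero_of_valuation_eq_one heq
    refine ⟨ord v (shiftedB W X), ⟨1, α₁, α₂, _, one_ne_zero, hB0, h1, h2, hB,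
      by rw [hA]; ring, by ring, rfl, heq⟩, ?_⟩
    rw [hΔ', ord_mul (pow_ne_zero _ hB0) hne, ord_pow, ord_of_valuation_eq_one heq]
    simp

/-- A point of order two with nonintegral coordinates has even residue characteristic. -/
lemma IsTwoTorsion.valuation_two_lt (hW : IsIntegralAt v W) (h : IsTwoTorsion W X Y)
    (hX : 1 < v.valuation K X) : v.valuation K 2 < 1 := by
  have hX0 : X ≠ 0 := by rintro rfl; simp at hX
  have hXi : X⁻¹ ∈ (v.valuation K).integer := by
    rw [Valuation.mem_integer_iff, map_inv₀]; exact inv_le_one_of_one_le₀ hX.le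
  have e : 4 * X = -(W.b₂ + 2 * W.b₄ * X⁻¹ + W.b₆ * X⁻¹ ^ 2) := by
    field_simp
    linear_combination h.cubic
  have hm : 4 * X ∈ (v.valuation K).integer := by
    rw [e]
    have h1 := hW.a₁
    have h2 := hW.a₂
    have h3 := hW.a₃
    have h4 := hW.a₄
    have h6 := hW.a₆
    simp only [b₂, b₄, b₆]
    apply_rules [add_mem, mul_mem, pow_mem, neg_mem, ofNat_mem]
  refine lt_of_le_of_ne (ofNat_mem (v.valuation K).integer 2) fun h2 => ?_
  rw [Valuation.mem_integer_iff, map_mul, show (4 : K) = 2 * 2 by norm_num, map_mul, h2, one_mul,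
    one_mul] at hm
  exact absurd hX (not_lt.mpr hm)

/-- A point of order two with nonintegral coordinates, for ordinary or multiplicative reduction. -/
lemma IsTwoTorsion.intPair_dual (hW : IsIntegralAt v W) (h : IsTwoTorsion W X Y)
    (hX : 1 < v.valuation K X) (ha : v.valuation K W.a₁ = 1) (hΔ0 : W.Δ ≠ 0) :
    IntPair v (-2 * shiftedA W X) (shiftedA W X ^ 2 - 4 * shiftedB W X) (ord v W.Δ) := by
  have h2lt := h.valuation_two_lt hW hX
  have hX0 : X ≠ 0 := by rintro rfl; simp at hX
  have hXi : v.valuation K X⁻¹ < 1 := by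
    rw [map_inv₀]; exact inv_lt_one_of_one_lt₀ hX
  have hXi' : X⁻¹ ∈ (v.valuation K).integer := hXi.le
  have h1 := hW.a₁
  have h2 := hW.a₂
  have h3 := hW.a₃
  have h4 := hW.a₄
  have h6 := hW.a₆
  have hb4 : W.b₄ ∈ (v.valuation K).integer := by
    simp only [b₄]; apply_rules [add_mem, mul_mem, pow_mem, neg_mem, ofNat_mem]
  have hb6 : W.b₆ ∈ (v.valuation K).integer := by
    simp only [b₆]; apply_rules [add_mem, mul_mem, pow_mem, neg_mem, ofNat_mem]
  have hb2 : v.valuation K W.b₂ = 1 := by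
    simp only [b₂]
    apply valuation_add_eq_one (by rw [map_pow, ha, one_pow])
    rw [show 4 * W.a₂ = 2 * (2 * W.a₂) by ring]
    exact valuation_mul_lt_one h2lt (mul_mem (ofNat_mem _ 2) h2)
  have hb2' : W.b₂ ∈ (v.valuation K).integer := hb2.le
  have e4X : v.valuation K (4 * X) = 1 := by
    have e : 4 * X = -(W.b₂ + X⁻¹ * (2 * W.b₄ + W.b₆ * X⁻¹)) := by
      field_simp
      linear_combination h.cubic
    rw [e, Valuation.map_neg]
    apply valuation_add_eq_one hb2
    refine valuation_mul_lt_one hXi (?_ : _ ∈ (v.valuation K).integer)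
    apply_rules [add_mem, mul_mem, ofNat_mem]
  have h4Xi : (4 * X)⁻¹ ∈ (v.valuation K).integer := by
    rw [Valuation.mem_integer_iff, map_inv₀, e4X, inv_one]
  -- Dividing the 2-division cubic by X² gives 4X = -b₂ + 8τ, with τ integral because 4X is a unit.
  set τ : K := -(W.b₄ * (4 * X)⁻¹ + 2 * W.b₆ * (4 * X)⁻¹ ^ 2) with hτ
  have hτm : τ ∈ (v.valuation K).integer := by
    apply_rules [add_mem, mul_mem, pow_mem, neg_mem, ofNat_mem]
  have hXτ : 4 * X = 8 * τ - W.b₂ := by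
    rw [hτ]
    field_simp
    linear_combination 16 * h.cubic
  have hX' : X = 2 * τ - W.b₂ / 4 := by linear_combination hXτ / 4
  have h16B : v.valuation K (16 * shiftedB W X) = 1 := by
    have e : 16 * shiftedB W X = W.b₂ ^ 2 + 2 * (4 * (-4 * τ * W.b₂ + 24 * τ ^ 2 + W.b₄)) := by
      simp only [shiftedB, hX']; ring
    rw [e]
    apply valuation_add_eq_one (by rw [map_pow, hb2, one_pow])
    refine valuation_mul_lt_one h2lt (?_ : _ ∈ (v.valuation K).integer)
    apply_rules [add_mem, mul_mem, pow_mem, neg_mem, ofNat_mem]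
  have hB0 : 16 * shiftedB W X ≠ 0 := ne_zero_of_valuation_eq_one h16B
  have hD : (shiftedA W X ^ 2 - 4 * shiftedB W X) = 16 * (W.Δ / (16 * shiftedB W X) ^ 2) := by
    rw [mul_div_assoc', eq_div_iff (pow_ne_zero _ hB0), h.Δ_eq]; ring
  have hΔm : W.Δ ∈ (v.valuation K).integer := by
    simp only [Δ, b₂, b₄, b₆, b₈]
    apply_rules [add_mem, sub_mem, mul_mem, pow_mem, neg_mem, ofNat_mem]
  refine ⟨2, W.a₁, W.a₂ - 3 * τ, W.Δ / (16 * shiftedB W X) ^ 2, two_ne_zero,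
    div_ne_zero hΔ0 (pow_ne_zero _ hB0), h1, ?_, ?_, ?_, ?_, ?_, ?_⟩
  · apply_rules [add_mem, sub_mem, mul_mem, ofNat_mem]
  · rw [Valuation.mem_integer_iff, map_div₀, map_pow, h16B, one_pow, div_one]; exact hΔm
  · simp only [shiftedA, hX', b₂]; ring
  · rw [hD]; ring
  · rw [ord_div hΔ0 (pow_ne_zero _ hB0), ord_pow, ord_of_valuation_eq_one h16B]; simp
  · have : (W.a₁ ^ 2 + 4 * (W.a₂ - 3 * τ)) ^ 2 - 64 * (W.Δ / (16 * shiftedB W X) ^ 2) =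
        16 * shiftedB W X := by
      have e : 64 * (W.Δ / (16 * shiftedB W X) ^ 2) =
        4 * (shiftedA W X ^ 2 - 4 * shiftedB W X) := by rw [hD]; ring
      rw [e]
      simp only [shiftedA, hX', b₂]; ring
    rw [this, h16B]

end TwoTorsionReduction

/-! ### Congruences modulo 4 in the supersingular case -/

namespace TwoTorsionReduction

open AdditiveValuation WithZero HeightOneSpectrum EllipticIsogeny ImaginaryQuadratic
  WeierstrassCurve

variable {K : Type*} [Field K] [NumberField K] {v : HeightOneSpectrum (𝓞 K)}
  {W : WeierstrassCurve K} {X Y : K}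

lemma valuation_four_mul_le {x y : K} (h : x = 4 * y) (hy : y ∈ (v.valuation K).integer) :
    v.valuation K x ≤ v.valuation K 4 := by
  rw [h, map_mul]
  exact mul_le_of_le_one_right' hy

/-- The congruences modulo `4` for a point of order two with a pole of order two in the
supersingular case. -/
lemma IsTwoTorsion.supersingular_of_pole {l : K} {t : ℤ} (hl : IsRamifiedTwo v l t)
    (hW : IsIntegralAt v W) (h : IsTwoTorsion W X Y) (ha : v.valuation K W.a₁ < 1)
    (ha₃ : v.valuation K W.a₃ = 1) (hX : v.valuation K (X * l ^ 2) = 1) :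
    SupersingularPair v (shiftedA W X) (shiftedB W X) := by
  have hl0 := hl.ne_zero
  have hlm : l ∈ (v.valuation K).integer := hl.lt_one.le
  have htm : (t : K) ∈ (v.valuation K).integer := intCast_mem _ t
  have h2 := hW.a₂
  have h3 := hW.a₃
  have h4 := hW.a₄
  have h6 := hW.a₆
  obtain ⟨α, hα, ha₁⟩ := hl.exists_mul ha
  replace hα : α ∈ (v.valuation K).integer := hα
  obtain ⟨κ, hκ⟩ : ∃ κ : K, κ = t * l - 1 := ⟨_, rfl⟩
  have hlsq : l ^ 2 = 2 * κ := by rw [hκ, hl.sq_eq]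
  have hκ1 : v.valuation K κ = 1 := by rw [hκ]; exact hl.valuation_kappa
  have hκm : κ ∈ (v.valuation K).integer := hκ1.le
  have hκ0 : κ ≠ 0 := ne_zero_of_valuation_eq_one hκ1
  -- Clearing the pole: X = z/(2κ) with z a unit, and the 2-division cubic becomes z + κ²α² + 2κa₂ =
  -- 2q with q integral.
  obtain ⟨z, hz⟩ : ∃ z : K, z = X * l ^ 2 := ⟨_, rfl⟩
  rw [← hz] at hX
  have hzm : z ∈ (v.valuation K).integer := hX.le
  have hz0 : z ≠ 0 := ne_zero_of_valuation_eq_one hX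
  have hzi : z⁻¹ ∈ (v.valuation K).integer := by
    rw [Valuation.mem_integer_iff, map_inv₀, hX, inv_one]
  have hXz : X = z / (2 * κ) := by rw [hz, hlsq]; field_simp
  obtain ⟨b4, hb4⟩ : ∃ x : K, x = 2 * W.a₄ + l * α * W.a₃ := ⟨_, rfl⟩
  obtain ⟨b6, hb6⟩ : ∃ x : K, x = W.a₃ ^ 2 + 4 * W.a₆ := ⟨_, rfl⟩
  obtain ⟨q, hq⟩ : ∃ x : K, x = -(κ ^ 2 * (b4 * z + κ * b6) * z⁻¹ ^ 2) := ⟨_, rfl⟩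
  have hqm : q ∈ (v.valuation K).integer := by
    rw [hq, hb4, hb6]
    apply_rules [add_mem, mul_mem, pow_mem, neg_mem, ofNat_mem]
  have hqz : q * z ^ 2 = -(κ ^ 2 * (b4 * z + κ * b6)) := by
    rw [hq]; field_simp
  have hcub : z + κ ^ 2 * α ^ 2 + 2 * κ * W.a₂ = 2 * q := by
    have hc := h.cubic
    simp only [b₂, b₄, b₆, ha₁, hXz] at hc
    have hb2 : (l * α) ^ 2 + 4 * W.a₂ = 2 * κ * α ^ 2 + 4 * W.a₂ := by
      rw [mul_pow, hlsq]
    rw [hb2] at hc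
    field_simp at hc
    apply mul_right_cancel₀ (pow_ne_zero 2 hz0)
    rw [mul_assoc 2 q, hqz, hb4, hb6]
    linear_combination hc / 4
  have hα1 : v.valuation K α = 1 := by
    have e : κ ^ 2 * α ^ 2 = -z + 2 * (q - κ * W.a₂) := by linear_combination hcub
    have h2lt : v.valuation K (2 : K) < 1 := by
      rw [hl.valuation_two, lt_one_iff_le_exp, exp_le_exp]; norm_num
    have h1 : v.valuation K (κ ^ 2 * α ^ 2) = 1 := by
      rw [e]
      apply valuation_add_eq_one (by rw [Valuation.map_neg, hX])
      refine valuation_mul_lt_one h2lt (?_ : _ ∈ (v.valuation K).integer)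
      apply_rules [sub_mem, mul_mem]
    rw [map_mul, map_pow, hκ1, one_pow, one_mul, map_pow] at h1
    exact (pow_eq_one_iff_of_nonneg zero_le two_ne_zero).mp h1
  obtain ⟨g, hg, hαg⟩ := hl.exists_eq_one_add hα1
  obtain ⟨m, hm, hκαa⟩ := hl.exists_eq_one_add (x := κ ^ 2 * α * W.a₃)
    (by simp only [map_mul, map_pow, hκ1, hα1, ha₃, one_pow, mul_one])
  obtain ⟨n, hn, hκa⟩ := hl.exists_eq_one_add (x := κ * W.a₃)
    (by simp only [map_mul, hκ1, ha₃, mul_one])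
  replace hg : g ∈ (v.valuation K).integer := hg
  replace hm : m ∈ (v.valuation K).integer := hm
  replace hn : n ∈ (v.valuation K).integer := hn
  -- κ² and α² are both 1 modulo 2, hence so is z; w is the explicit quotient.
  obtain ⟨w, hw⟩ : ∃ x : K, x = q - κ * W.a₂ - κ ^ 2 * (l * g + κ * g ^ 2) - 1 + t * l - t ^ 2 * κ := ⟨_, rfl⟩
  have hwm : w ∈ (v.valuation K).integer := by
    rw [hw]
    apply_rules [add_mem, sub_mem, mul_mem, pow_mem, neg_mem, ofNat_mem, one_mem]
  have hzw : z = 1 + 2 * w := by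
    have e1 : κ ^ 2 = 1 - 2 * t * l + t ^ 2 * (2 * κ) := by
      rw [← hlsq, hκ]; ring
    have e2 : α ^ 2 = 1 + 2 * (l * g + κ * g ^ 2) := by
      rw [hαg]; linear_combination g ^ 2 * hlsq
    rw [e2] at hcub
    rw [hw]
    linear_combination hcub - e1
  have hκb4 : κ ^ 2 * b4 = l + 2 * (κ ^ 2 * W.a₄ + κ * m) := by
    rw [hb4]
    linear_combination l * hκαa + m * hlsq
  -- Modulo 4 the three terms of η are 1, 0 and 2l, by z ≡ 1 and κ²b₄ ≡ l modulo 2.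
  obtain ⟨η, hη⟩ : ∃ η : K, η = z ^ 2 + 4 * z * q + 2 * κ ^ 2 * b4 := ⟨_, rfl⟩
  obtain ⟨E, hE⟩ : ∃ x : K, x = w + w ^ 2 + z * q + κ ^ 2 * W.a₄ + κ * m := ⟨_, rfl⟩
  have hEm : E ∈ (v.valuation K).integer := by
    rw [hE]
    apply_rules [add_mem, mul_mem, pow_mem]
  have hηE : η = 1 + 2 * l + 4 * E := by
    rw [hη, hE]
    linear_combination 2 * hκb4 + (z + 1 + 2 * w) * hzw
  have hB : shiftedB W X * l ^ 4 = η := by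
    have : l ^ 4 = 4 * κ ^ 2 := by rw [show l ^ 4 = (l ^ 2) ^ 2 by ring, hlsq]; ring
    have hb2 : W.b₂ = 2 * κ * α ^ 2 + 4 * W.a₂ := by
      simp only [b₂, ha₁]; rw [mul_pow, hlsq]
    have hbb : W.b₄ = b4 := by simp only [b₄, ha₁, hb4]
    simp only [shiftedB]
    rw [this, hη, hXz, hb2, hbb]
    field_simp
    linear_combination 8 * z * hcub
  obtain ⟨G, hG⟩ : ∃ x : K, x = w * l + (κ ^ 2 * W.a₄ + κ * m) * (1 + 2 * w) + κ * (l * n + κ * n ^ 2) +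
    2 * κ ^ 3 * W.a₆ + 2 * q * (w + w ^ 2) := ⟨_, rfl⟩
  have hqG : q = -l - κ - 2 * G := by
    have e3 : κ ^ 2 * W.a₃ ^ 2 = 1 + 2 * (l * n + κ * n ^ 2) := by
      rw [← mul_pow, hκa]; linear_combination n ^ 2 * hlsq
    rw [hzw] at hqz
    rw [hb6] at hqz
    rw [hG]
    linear_combination hqz - κ * e3 - (1 + 2 * w) * hκb4
  obtain ⟨w2, hw2⟩ : ∃ x : K, x = w - l - κ - G := ⟨_, rfl⟩
  have hGm : G ∈ (v.valuation K).integer := by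
    rw [hG]
    apply_rules [add_mem, mul_mem, pow_mem, ofNat_mem, one_mem]
  have hw2m : w2 ∈ (v.valuation K).integer := by
    rw [hw2]
    apply_rules [sub_mem]
  obtain ⟨a0, ha0⟩ : ∃ a0 : K, a0 = z + q := ⟨_, rfl⟩
  have ha0' : a0 = (1 + κ + l) + 2 * w2 := by
    rw [ha0, hw2, hzw]; linear_combination hqG
  have hA : shiftedA W X * κ = a0 := by
    have hb2 : W.b₂ = 2 * κ * α ^ 2 + 4 * W.a₂ := by
      simp only [b₂, ha₁]; rw [mul_pow, hlsq]
    simp only [shiftedA]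
    rw [ha0, hXz, hb2]
    field_simp
    linear_combination 4 * hcub
  obtain ⟨F, hF⟩ : ∃ x : K, x = κ + κ * t + (1 + κ + l) * w2 + w2 ^ 2 - E := ⟨_, rfl⟩
  have hFm : F ∈ (v.valuation K).integer := by
    rw [hF]
    apply_rules [add_mem, sub_mem, mul_mem, pow_mem, one_mem]
  have hD : κ ^ 2 * (shiftedA W X ^ 2 - 4 * shiftedB W X) = κ ^ 2 - 2 * l + 4 * F := by
    have e1 : κ ^ 2 * (shiftedA W X ^ 2 - 4 * shiftedB W X) = a0 ^ 2 - η := by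
      rw [← hB, ← hA, show l ^ 4 = (l ^ 2) ^ 2 by ring, hlsq]; ring
    rw [e1, ha0', hηE, hF]
    linear_combination (1 + 2 * t) * hlsq + (2 * l) * hκ
  refine ⟨l, t, l, 1, hl, hl0, one_ne_zero, ?_, ?_⟩
  · rw [hB]
    exact valuation_four_mul_le (y := E) (by rw [hηE]; ring) hEm
  -- Since κ² ≡ 1 modulo 2, 2lκ² ≡ -2l modulo 4, so `hD` is the desired congruence times the unit
  -- κ².
  · have e : κ ^ 2 * ((shiftedA W X ^ 2 - 4 * shiftedB W X) * 1 ^ 4 - (1 + 2 * l)) =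
        4 * (-(l * (1 - t * l + κ * t ^ 2)) + F) := by
      linear_combination hD + (-2 * l) * (κ + t * l - 1) * hκ + (-2 * l * t ^ 2) * hlsq
    have hm : -(l * (1 - t * l + κ * t ^ 2)) + F ∈ (v.valuation K).integer :=
      add_mem (neg_mem (mul_mem hlm (add_mem (sub_mem (one_mem _) (mul_mem htm hlm))
        (mul_mem hκm (pow_mem htm 2))))) hFm
    have := valuation_four_mul_le e hm
    rwa [map_mul, map_pow, hκ1, one_pow, one_mul] at this

end TwoTorsionReduction

/-! ### Local classification at primes of good and of multiplicative reduction -/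

namespace TwoTorsionReduction

open AdditiveValuation WithZero HeightOneSpectrum EllipticIsogeny ImaginaryQuadratic
  WeierstrassCurve

variable {K : Type*} [Field K] [NumberField K] {v : HeightOneSpectrum (𝓞 K)}
  {W : WeierstrassCurve K} {X Y : K}

lemma valuation_b₂_lt (hW : IsIntegralAt v W) (h2 : v.valuation K 2 < 1)
    (ha : v.valuation K W.a₁ < 1) : v.valuation K W.b₂ < 1 := by
  have h1 := hW.a₁
  have ha₂ := hW.a₂
  have e : W.b₂ = W.a₁ * W.a₁ + 2 * (2 * W.a₂) := by simp only [b₂]; ring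
  rw [e]
  exact Valuation.map_add_lt _ (valuation_mul_lt_one ha h1)
    (valuation_mul_lt_one h2 (mul_mem (ofNat_mem (v.valuation K).integer 2) ha₂))

/-- In residue characteristic 2, c₄ reduces to a₁⁴. -/
lemma IsTwoTorsion.valuation_a₁_of_mult (hW : IsIntegralAt v W) (h : IsTwoTorsion W X Y)
    (hX : 1 < v.valuation K X) (hc : v.valuation K W.c₄ = 1) : v.valuation K W.a₁ = 1 := by
  have h2 := h.valuation_two_lt hW hX
  refine le_antisymm hW.a₁ (not_lt.mp fun ha => ?_)
  have hb := valuation_b₂_lt hW h2 ha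
  have h1 := hW.a₁
  have h3 := hW.a₃
  have h4 := hW.a₄
  have e : W.c₄ = W.b₂ * W.b₂ + 2 * (-12 * (2 * W.a₄ + W.a₁ * W.a₃)) := by
    simp only [c₄, b₄]; ring
  have hlt : v.valuation K W.c₄ < 1 := by
    rw [e]
    refine Valuation.map_add_lt _ (valuation_mul_lt_one hb hb.le)
      (valuation_mul_lt_one h2 (?_ : _ ∈ (v.valuation K).integer))
    apply_rules [add_mem, mul_mem, neg_mem, ofNat_mem]
  exact hlt.ne hc

/-- In residue characteristic 2 with a₁ reducing to zero, the discriminant reduces to a₃⁴. -/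
lemma valuation_a₃_of_good (hW : IsIntegralAt v W) (h2 : v.valuation K 2 < 1)
    (ha : v.valuation K W.a₁ < 1) (hΔ : v.valuation K W.Δ = 1) : v.valuation K W.a₃ = 1 := by
  refine le_antisymm hW.a₃ (not_lt.mp fun h3 => ?_)
  have hb := valuation_b₂_lt hW h2 ha
  have h1m := hW.a₁
  have h2m := hW.a₂
  have h3m := hW.a₃
  have h4m := hW.a₄
  have h6m := hW.a₆
  have hb6 : v.valuation K W.b₆ < 1 := by
    have e : W.b₆ = W.a₃ * W.a₃ + 2 * (2 * W.a₆) := by simp only [b₆]; ring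
    rw [e]
    exact Valuation.map_add_lt _ (valuation_mul_lt_one h3 h3.le)
      (valuation_mul_lt_one h2 (mul_mem (ofNat_mem (v.valuation K).integer 2) h6m))
  have hb2m : W.b₂ ∈ (v.valuation K).integer := hb.le
  have hb6m : W.b₆ ∈ (v.valuation K).integer := hb6.le
  have hb4m : W.b₄ ∈ (v.valuation K).integer := by
    simp only [b₄]; apply_rules [add_mem, mul_mem, ofNat_mem]
  have hb8m : W.b₈ ∈ (v.valuation K).integer := by
    simp only [b₈]; apply_rules [add_mem, sub_mem, mul_mem, pow_mem, ofNat_mem]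
  have e : W.Δ = W.b₂ * (-W.b₂ * W.b₈ + 9 * W.b₄ * W.b₆) + 2 * (-4 * W.b₄ ^ 3) +
      W.b₆ * (-27 * W.b₆) := by
    simp only [Δ]; ring
  have hlt : v.valuation K W.Δ < 1 := by
    rw [e]
    refine Valuation.map_add_lt _ (Valuation.map_add_lt _
      (valuation_mul_lt_one hb (?_ : _ ∈ (v.valuation K).integer))
      (valuation_mul_lt_one h2 (?_ : _ ∈ (v.valuation K).integer)))
      (valuation_mul_lt_one hb6 (?_ : _ ∈ (v.valuation K).integer)) <;>
    apply_rules [add_mem, mul_mem, pow_mem, neg_mem, ofNat_mem]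
  exact hlt.ne hΔ

lemma exists_mul_of_valuation_le {x y : K} (hy : y ≠ 0)
    (h : v.valuation K x ≤ v.valuation K y) : ∃ g ∈ (v.valuation K).integer, x = y * g := by
  refine ⟨x / y, ?_, by rw [mul_div_cancel₀ _ hy]⟩
  rw [Valuation.mem_integer_iff, map_div₀]
  exact div_le_one_of_le₀ h zero_le

/-- A point of order two with nonintegral coordinates, for supersingular reduction. -/
lemma IsTwoTorsion.supersingularPair (hK : IsImaginaryQuadratic K)
    [IsPrincipalIdealRing (𝓞 K)] (hW : IsIntegralAt v W) (h : IsTwoTorsion W X Y)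
    (hX : 1 < v.valuation K X) (ha : v.valuation K W.a₁ < 1) (hΔ : v.valuation K W.Δ = 1) :
    SupersingularPair v (shiftedA W X) (shiftedB W X) := by
  have h2 := h.valuation_two_lt hW hX
  have ha₃ := valuation_a₃_of_good hW h2 ha hΔ
  have h2m := hW.a₂
  have h3m := hW.a₃
  have h4m := hW.a₄
  have h6m := hW.a₆
  have hX0 : X ≠ 0 := by rintro rfl; simp at hX
  have hXi : v.valuation K X⁻¹ < 1 := by
    rw [map_inv₀]; exact inv_lt_one_of_one_lt₀ hX
  have hcub : (4 : K) = -((W.a₁ ^ 2 + 4 * W.a₂) * X⁻¹ +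
      2 * (2 * W.a₄ + W.a₁ * W.a₃) * X⁻¹ ^ 2 + (W.a₃ ^ 2 + 4 * W.a₆) * X⁻¹ ^ 3) := by
    have := h.cubic
    simp only [b₂, b₄, b₆] at this
    field_simp
    linear_combination this
  have h20 : (2 : K) ≠ 0 := two_ne_zero
  rcases hK.ramified_or_unramified h2 with he | ⟨l, t, hl⟩
  -- In `hcub` the left side 4 has order 2, while every term on the right has order at least 3.
  · exfalso
    obtain ⟨y, hy, hXy⟩ := exists_mul_of_valuation_le h20
      ((lt_one_iff_le_exp.mp hXi).trans_eq he.symm)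
    obtain ⟨α, hα, ha₁⟩ := exists_mul_of_valuation_le h20
      ((lt_one_iff_le_exp.mp ha).trans_eq he.symm)
    rw [hXy, ha₁] at hcub
    have e : (1 : K) = 2 * -((α ^ 2 + W.a₂) * y + 2 * (W.a₄ + α * W.a₃) * y ^ 2 +
        (W.a₃ ^ 2 + 4 * W.a₆) * y ^ 3) := by
      have h4 : (4 : K) ≠ 0 := by norm_num
      apply mul_left_cancel₀ h4
      linear_combination hcub
    have hlt := valuation_mul_lt_one (V := v.valuation K) h2
      (y := -((α ^ 2 + W.a₂) * y + 2 * (W.a₄ + α * W.a₃) * y ^ 2 +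
        (W.a₃ ^ 2 + 4 * W.a₆) * y ^ 3)) (show _ ∈ (v.valuation K).integer by
          apply_rules [add_mem, mul_mem, pow_mem, neg_mem, ofNat_mem])
    rw [← e, map_one] at hlt
    exact lt_irrefl _ hlt
  · refine h.supersingular_of_pole hl hW ha ha₃ ?_
    have hXi0 : X⁻¹ ≠ 0 := inv_ne_zero hX0
    have hXim : X⁻¹ ∈ (v.valuation K).integer := hXi.le
    have hord := valuation_eq_exp (v := v) hXi0
    have hpos : 0 < ord v X⁻¹ := (valuation_lt_one_iff hXi0).mp hXi
    -- If it were 1, the square (Y/X²)² would have the valuation of X⁻¹, which is odd.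
    have h1 : ord v X⁻¹ ≠ 1 := by
      intro h1
      rw [h1] at hord
      have e : (Y * X⁻¹ ^ 2) ^ 2 = -(X⁻¹ + X⁻¹ * (X⁻¹ * (W.a₂ + W.a₄ * X⁻¹ +
          W.a₆ * X⁻¹ ^ 2))) := by
        field_simp
        linear_combination -h.eqn + Y * h.two_mul
      have hv : v.valuation K ((Y * X⁻¹ ^ 2) ^ 2) = exp (-1) := by
        rw [e, Valuation.map_neg, ← hord]
        apply Valuation.map_add_eq_of_lt_left
        rw [map_mul]
        refine mul_lt_of_lt_one_right (by rw [hord]; exact exp_pos) ?_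
        refine valuation_mul_lt_one hXi (?_ : _ ∈ (v.valuation K).integer)
        apply_rules [add_mem, mul_mem, pow_mem]
      rw [map_pow] at hv
      have hne : v.valuation K (Y * X⁻¹ ^ 2) ≠ 0 := by
        intro h0
        rw [h0, zero_pow two_ne_zero] at hv
        exact exp_ne_zero hv.symm
      rw [← exp_log hne, ← exp_nsmul, exp_inj] at hv
      simp only [nsmul_eq_mul, Nat.cast_ofNat] at hv
      omega
    -- A pole this deep would give every term on the right of `hcub` order at least 5, against order
    -- 4 for 4.
    have h3 : ¬ 3 ≤ ord v X⁻¹ := by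
      intro h3
      have hX3 : v.valuation K X⁻¹ ≤ v.valuation K (l ^ 3) := by
        rw [hord, map_pow, hl.valuation_eq, ← exp_nsmul, exp_le_exp]
        simp only [nsmul_eq_mul, Nat.cast_ofNat]
        omega
      have hl0 := hl.ne_zero
      obtain ⟨y, hy, hXy⟩ := exists_mul_of_valuation_le (pow_ne_zero 3 hl0) hX3
      obtain ⟨α, hα, ha₁⟩ := hl.exists_mul ha
      replace hα : α ∈ (v.valuation K).integer := hα
      obtain ⟨κ, hκ⟩ : ∃ κ : K, κ = t * l - 1 := ⟨_, rfl⟩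
      have hlsq : l ^ 2 = 2 * κ := by rw [hκ, hl.sq_eq]
      have hκm : κ ∈ (v.valuation K).integer := by rw [hκ]; exact hl.valuation_kappa.le
      have hlm : l ∈ (v.valuation K).integer := hl.lt_one.le
      rw [hXy, ha₁] at hcub
      have e4 : l ^ 4 = 4 * κ ^ 2 := by rw [show l ^ 4 = (l ^ 2) ^ 2 by ring, hlsq]; ring
      obtain ⟨G, hG⟩ : ∃ G : K, G = -(κ ^ 2 * α ^ 2 * y + l ^ 2 * W.a₂ * y +
        2 * κ ^ 2 * l * (2 * W.a₄ + l * α * W.a₃) * y ^ 2 +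
        κ ^ 2 * (W.a₃ ^ 2 + 4 * W.a₆) * l ^ 4 * y ^ 3) := ⟨_, rfl⟩
      have e : (1 : K) = l * G := by
        apply mul_left_cancel₀ (pow_ne_zero 4 hl0)
        rw [hG]
        linear_combination e4 + κ ^ 2 * hcub + W.a₂ * l ^ 3 * y * e4
      have hlt := valuation_mul_lt_one (V := v.valuation K) hl.lt_one (y := G)
        (show _ ∈ (v.valuation K).integer by
          rw [hG]
          refine neg_mem (add_mem ?_ ?_) <;> apply_rules [add_mem, mul_mem, pow_mem, ofNat_mem])
      rw [← e, map_one] at hlt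
      exact lt_irrefl _ hlt
    have h2' : ord v X⁻¹ = 2 := by omega
    rw [h2'] at hord
    rw [map_mul, map_pow, hl.valuation_eq, ← exp_nsmul, ← inv_inv (v.valuation K X), ← map_inv₀,
      hord, ← exp_neg, ← exp_add]
    norm_num

omit [NumberField K] in
lemma isTwoTorsion_smul (C : VariableChange K) (a b : K) :
    IsTwoTorsion (C • twoTorsionCurve a b) (-C.r * ((C.u⁻¹ : Kˣ) : K) ^ 2)
      ((C.s * C.r - C.t) * ((C.u⁻¹ : Kˣ) : K) ^ 3) := by
  constructor <;> simp only [variableChange_def, twoTorsionCurve] <;> ring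

lemma shiftedA_smul (C : VariableChange K) (a b : K) :
    shiftedA (C • twoTorsionCurve a b) (-C.r * ((C.u⁻¹ : Kˣ) : K) ^ 2) =
      ((C.u⁻¹ : Kˣ) : K) ^ 2 * a := by
  simp only [shiftedA, b₂, variableChange_def, twoTorsionCurve]; ring

lemma shiftedB_smul (C : VariableChange K) (a b : K) :
    shiftedB (C • twoTorsionCurve a b) (-C.r * ((C.u⁻¹ : Kˣ) : K) ^ 2) =
      ((C.u⁻¹ : Kˣ) : K) ^ 4 * b := by
  simp only [shiftedB, b₂, b₄, variableChange_def, twoTorsionCurve]; ring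

variable {a b : K}

lemma IntPair.of_smul {c : K} {k : ℤ} (hc : c ≠ 0) (h : IntPair v (c ^ 2 * a) (c ^ 4 * b) k) :
    IntPair v a b k := by
  have := h.smul (inv_ne_zero hc)
  rwa [show c⁻¹ ^ 2 * (c ^ 2 * a) = a by field_simp,
    show c⁻¹ ^ 4 * (c ^ 4 * b) = b by field_simp] at this

lemma IntPair.of_smul_dual {c : K} {k : ℤ} (hc : c ≠ 0)
    (h : IntPair v (-2 * (c ^ 2 * a)) ((c ^ 2 * a) ^ 2 - 4 * (c ^ 4 * b)) k) :
    IntPair v (-2 * a) (a ^ 2 - 4 * b) k := by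
  apply IntPair.of_smul hc
  convert h using 1 <;> ring

lemma SupersingularPair.of_smul {c : K} (hc : c ≠ 0)
    (h : SupersingularPair v (c ^ 2 * a) (c ^ 4 * b)) : SupersingularPair v a b := by
  have := h.smul (inv_ne_zero hc)
  rwa [show c⁻¹ ^ 2 * (c ^ 2 * a) = a by field_simp,
    show c⁻¹ ^ 4 * (c ^ 4 * b) = b by field_simp] at this

/-- Local types of a curve with good reduction and a point of order two. -/
lemma GoodAt.classify (hK : IsImaginaryQuadratic K) [IsPrincipalIdealRing (𝓞 K)]
    (h : GoodAt v (twoTorsionCurve a b)) :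
    IntPair v a b 0 ∨ IntPair v (-2 * a) (a ^ 2 - 4 * b) 0 ∨ SupersingularPair v a b := by
  obtain ⟨C, hW, hΔ⟩ := h
  have ht := isTwoTorsion_smul C a b
  have hA := shiftedA_smul C a b
  have hB := shiftedB_smul C a b
  have hu : ((C.u⁻¹ : Kˣ) : K) ≠ 0 := Units.ne_zero _
  -- A nonintegral abscissa means that the 2-torsion point reduces to zero and the residue
  -- characteristic is 2; then a₁ separates ordinary from supersingular reduction.
  rcases le_or_gt (v.valuation K (-C.r * ((C.u⁻¹ : Kˣ) : K) ^ 2)) 1 with hX | hX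
  · left
    have := ht.intPair_of_good hW hX hΔ
    rw [hA, hB] at this
    exact this.of_smul hu
  · right
    rcases (show v.valuation K _ ≤ 1 from hW.a₁).lt_or_eq with ha | ha
    · right
      have := ht.supersingularPair hK hW hX ha hΔ
      rw [hA, hB] at this
      exact this.of_smul hu
    · left
      have := ht.intPair_dual hW hX ha (ne_zero_of_valuation_eq_one hΔ)
      rw [hA, hB, ord_of_valuation_eq_one hΔ] at this
      exact this.of_smul_dual hu

/-- Local types of a curve with multiplicative reduction and a point of order two. -/
lemma MultAt.classify {n : ℤ} (h : MultAt v (twoTorsionCurve a b) n) :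
    (∃ k, IntPair v a b k ∧ n = 2 * k) ∨ IntPair v (-2 * a) (a ^ 2 - 4 * b) n := by
  obtain ⟨hn, C, hW, hc, hΔ, hord⟩ := h
  have ht := isTwoTorsion_smul C a b
  have hA := shiftedA_smul C a b
  have hB := shiftedB_smul C a b
  have hu : ((C.u⁻¹ : Kˣ) : K) ≠ 0 := Units.ne_zero _
  rcases le_or_gt (v.valuation K (-C.r * ((C.u⁻¹ : Kˣ) : K) ^ 2)) 1 with hX | hX
  · have := ht.intPair_of_mult hW hX hΔ hc
    rw [hA, hB, hord] at this
    rcases this with ⟨k, hk, hnk⟩ | h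
    · exact .inl ⟨k, hk.of_smul hu, hnk⟩
    · exact .inr (h.of_smul_dual hu)
  · right
    have := ht.intPair_dual hW hX (ht.valuation_a₁_of_mult hW hX hc) hΔ
    rw [hA, hB, hord] at this
    exact this.of_smul_dual hu

end TwoTorsionReduction

/-! ### From local types to the global square classes of b and a² - 4b -/

namespace TwoTorsionReduction

open AdditiveValuation WithZero HeightOneSpectrum EllipticIsogeny ImaginaryQuadratic
  WeierstrassCurve

variable {K : Type*} [Field K] [NumberField K] {v p : HeightOneSpectrum (𝓞 K)} {a b : K}
  {n k : ℤ}

/-- The curve `y² = x³ + a x² + b x` has good reduction outside `p` and multiplicative reduction at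
`p`, where `n` is the valuation of its minimal discriminant. -/
structure PrimeReduction (p : HeightOneSpectrum (𝓞 K)) (a b : K) (n : ℤ) : Prop where
  good : ∀ v ≠ p, GoodAt v (twoTorsionCurve a b)
  mult : MultAt p (twoTorsionCurve a b) n

/-- The local types of the pairs `(a, b)` and `(-2 a, a² - 4 b)`. -/
structure LocalTypes (p : HeightOneSpectrum (𝓞 K)) (a b : K) (n : ℤ) : Prop where
  pos : 0 < n
  away : ∀ v ≠ p, IntPair v a b 0 ∨ IntPair v (-2 * a) (a ^ 2 - 4 * b) 0
  at_prime : (∃ k, IntPair p a b k ∧ n = 2 * k) ∨ IntPair p (-2 * a) (a ^ 2 - 4 * b) n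

lemma ord_two_pow (v : HeightOneSpectrum (𝓞 K)) (m : ℕ) :
    ord v ((2 : K) ^ m) = m * ord v (2 : K) := ord_pow _ _

lemma ord_sixteen (v : HeightOneSpectrum (𝓞 K)) : ord v (16 : K) = 4 * ord v (2 : K) := by
  have := ord_two_pow (K := K) v 4
  norm_num at this
  exact this

lemma ord_two_nonneg (v : HeightOneSpectrum (𝓞 K)) : 0 ≤ ord v (2 : K) :=
  (valuation_le_one_iff two_ne_zero).mp (ofNat_mem (v.valuation K).integer 2)

lemma IntPair.exists_ord (h : IntPair v a b k) :
    ∃ m, ord v b = 4 * m + k ∧ ord v (a ^ 2 - 4 * b) = 4 * m - 4 * ord v (2 : K) := by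
  obtain ⟨hb, hD, m, h1, h2⟩ := h.ord_eq
  rw [ord_mul (by norm_num) hD, ord_sixteen] at h2
  exact ⟨m, h1, by omega⟩

lemma IntPair.exists_ord_dual (h : IntPair v (-2 * a) (a ^ 2 - 4 * b) k) :
    b ≠ 0 ∧ a ^ 2 - 4 * b ≠ 0 ∧
    ∃ m, ord v (a ^ 2 - 4 * b) = 4 * m + k ∧ ord v b = 4 * m - 8 * ord v (2 : K) := by
  obtain ⟨hD, hb, -⟩ := h.ord_eq
  obtain ⟨m, h1, h2⟩ := h.exists_ord
  have e : (-2 * a) ^ 2 - 4 * (a ^ 2 - 4 * b) = 16 * b := by ring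
  rw [e] at hb h2
  have hb0 : b ≠ 0 := right_ne_zero_of_mul hb
  rw [ord_mul (by norm_num) hb0, ord_sixteen] at h2
  exact ⟨hb0, hD, m, h1, by omega⟩

lemma _root_.ImaginaryQuadratic.IsRamifiedTwo.dvd_ord_of_congr {l : K} {t : ℤ} (hl : IsRamifiedTwo v l t) {x s : K}
    (hs : s ≠ 0) (h : v.valuation K (x * s ^ 4 - (1 + 2 * l)) ≤ v.valuation K 4) :
    v.valuation K (x * s ^ 4) = 1 ∧ 4 ∣ ord v x := by
  have h4 : v.valuation K 4 < 1 := by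
    rw [hl.valuation_four, lt_one_iff_le_exp, exp_le_exp]; norm_num
  have h2l : v.valuation K (2 * l) < 1 := by
    rw [mul_comm]; exact valuation_mul_lt_one hl.lt_one (ofNat_mem (v.valuation K).integer 2)
  have h1 : v.valuation K (x * s ^ 4) = 1 := by
    have := valuation_add_eq_one (valuation_add_eq_one (map_one (v.valuation K)) h2l)
      (h.trans_lt h4)
    rwa [add_sub_cancel] at this
  refine ⟨h1, -ord v s, ?_⟩
  have h0 := ord_of_valuation_eq_one h1
  have hx : x ≠ 0 := left_ne_zero_of_mul (ne_zero_of_valuation_eq_one h1)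
  rw [ord_mul hx (pow_ne_zero _ hs), ord_pow] at h0
  push_cast at h0
  omega

/-- Such an x is a unit times a fourth power. Fourth powers of local units are 1 modulo 4 here, so
the unit itself would satisfy the congruence excluded by `unit_not_congr`. -/
lemma not_congr_of_dvd_ord (hK : IsImaginaryQuadratic K) [IsPrincipalIdealRing (𝓞 K)]
    {l : K} {t : ℤ} (hl : IsRamifiedTwo v l t) {x s : K} (hx : ∀ w : HeightOneSpectrum (𝓞 K), 4 ∣ ord w x) (hs : s ≠ 0)
    (h : v.valuation K (x * s ^ 4 - (1 + 2 * l)) ≤ v.valuation K 4) : False := by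
  obtain ⟨h1, -⟩ := hl.dvd_ord_of_congr hs h
  have hx0 : x ≠ 0 := left_ne_zero_of_mul (ne_zero_of_valuation_eq_one h1)
  obtain ⟨ε, r, hr, rfl⟩ := exists_unit_mul_pow (m := 4) (by norm_num) hx0 hx
  have hε : v.valuation K (algebraMap (𝓞 K) K ε) = 1 :=
    (valuation_eq_one_iff (left_ne_zero_of_mul hx0)).mpr (ord_unit ε)
  have hεm : algebraMap (𝓞 K) K ε ∈ (v.valuation K).integer := hε.le
  rw [mul_assoc, ← mul_pow] at h1 h
  rw [map_mul, hε, one_mul, map_pow] at h1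
  obtain ⟨g, hg, hrs⟩ := hl.exists_eq_one_add
    ((pow_eq_one_iff_of_nonneg zero_le (by norm_num)).mp h1)
  replace hg : g ∈ (v.valuation K).integer := hg
  have hlm : l ∈ (v.valuation K).integer := hl.lt_one.le
  have hκm : t * l - 1 ∈ (v.valuation K).integer := hl.valuation_kappa.le
  obtain ⟨c, hc⟩ : ∃ c, c = l * g + (t * l - 1) * g ^ 2 := ⟨_, rfl⟩
  have hcm : c ∈ (v.valuation K).integer := by
    rw [hc]; exact add_mem (mul_mem hlm hg) (mul_mem hκm (pow_mem hg 2))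
  have e2 : (r * s) ^ 2 = 1 + 2 * c := by
    rw [hrs, hc]; linear_combination g ^ 2 * hl.sq_eq
  refine hK.unit_not_congr hl ε ?_
  have e : algebraMap (𝓞 K) K ε - (1 + 2 * l) =
      (algebraMap (𝓞 K) K ε * (r * s) ^ 4 - (1 + 2 * l)) +
        4 * (-(algebraMap (𝓞 K) K ε * (c + c ^ 2))) := by
    rw [show (r * s) ^ 4 = ((r * s) ^ 2) ^ 2 by ring, e2]; ring
  rw [e]
  refine Valuation.map_add_le _ h (valuation_four_mul_le rfl ?_)
  exact neg_mem (mul_mem hεm (add_mem hcm (pow_mem hcm 2)))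

lemma PrimeReduction.localTypes (hK : IsImaginaryQuadratic K) [IsPrincipalIdealRing (𝓞 K)]
    (h : PrimeReduction p a b n) : LocalTypes p a b n := by
  have hp := h.mult.classify
  refine ⟨h.mult.1, fun v hv => ?_, hp⟩
  rcases (h.good v hv).classify hK with h1 | h1 | ⟨l, t, r, s, hl, hr, hs, hb, hD⟩
  · exact .inl h1
  · exact .inr h1
  · exfalso
    have hdvd : ∀ w ≠ p, 4 ∣ ord w b ∧ 4 ∣ ord w (a ^ 2 - 4 * b) := by
      intro w hw
      by_cases hwv : w = v
      · subst hwv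
        exact ⟨(hl.dvd_ord_of_congr hr hb).2, (hl.dvd_ord_of_congr hs hD).2⟩
      · rcases (h.good w hw).classify hK with h1 | h1 | ⟨l', t', -, -, hl', -⟩
        · obtain ⟨m, h2, h3⟩ := h1.exists_ord
          omega
        · obtain ⟨-, -, m, h2, h3⟩ := h1.exists_ord_dual
          omega
        · have := hl.unique w hwv
          rw [ord_eq_iff two_ne_zero, hl'.valuation_two, exp_inj] at this
          norm_num at this
    -- At p either type leaves one of a² - 4b and b with valuation divisible by 4, and the
    -- supersingular congruence for that one is contradictory.
    rcases hp with ⟨k, hk, -⟩ | hk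
    · refine not_congr_of_dvd_ord hK hl (fun w => ?_) hs hD
      by_cases hw : w = p
      · subst hw
        obtain ⟨m, h2, h3⟩ := hk.exists_ord
        omega
      · exact (hdvd w hw).2
    · refine not_congr_of_dvd_ord hK hl (fun w => ?_) hr hb
      by_cases hw : w = p
      · subst hw
        obtain ⟨-, -, m, h2, h3⟩ := hk.exists_ord_dual
        omega
      · exact (hdvd w hw).1

/-- The isogenous curve has good reduction outside `p`. -/
lemma LocalTypes.goodAt_dual (h : LocalTypes p a b n) (hv : v ≠ p) :
    GoodAt v (twoTorsionCurve (-2 * a) (a ^ 2 - 4 * b)) :=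
  (h.away v hv).elim IntPair.goodAt_dual IntPair.goodAt

lemma LocalTypes.primeReduction_dual (h : LocalTypes p a b n) (hk : IntPair p a b k)
    (hk0 : 0 < k) : PrimeReduction p (-2 * a) (a ^ 2 - 4 * b) k :=
  ⟨fun _ hv => h.goodAt_dual hv, hk.multAt_dual hk0⟩

lemma LocalTypes.exists_primeReduction_dual (h : LocalTypes p a b n) :
    ∃ n', PrimeReduction p (-2 * a) (a ^ 2 - 4 * b) n' := by
  rcases h.at_prime with ⟨k, hk, hnk⟩ | hk
  · exact ⟨k, h.primeReduction_dual hk (by have := h.pos; omega)⟩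
  · exact ⟨2 * n, fun _ hv => h.goodAt_dual hv, hk.multAt h.pos⟩

lemma PrimeReduction.ne_zero (h : PrimeReduction p a b n) : b ≠ 0 ∧ a ^ 2 - 4 * b ≠ 0 := by
  rcases h.mult.classify with ⟨k, hk, -⟩ | hk
  · exact ⟨hk.ord_eq.1, hk.ord_eq.2.1⟩
  · exact ⟨hk.exists_ord_dual.1, hk.exists_ord_dual.2.1⟩

lemma exists_valuation_two_lt (hK : IsImaginaryQuadratic K) [IsPrincipalIdealRing (𝓞 K)] :
    ∃ v : HeightOneSpectrum (𝓞 K), v.valuation K 2 < 1 := by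
  obtain ⟨l, hl, h2⟩ := hK.exists_prime_dvd_two
  refine ⟨⟨Ideal.span {l}, (Ideal.span_singleton_prime hl.ne_zero).mpr hl, by
    simpa using hl.ne_zero⟩, ?_⟩
  have hmap : algebraMap (𝓞 K) K 2 = 2 := map_ofNat _ 2
  rw [← hmap]
  exact (HeightOneSpectrum.valuation_lt_one_iff_mem _ _).mpr (Ideal.mem_span_singleton.mpr h2)

/-- Even valuations make a² - 4b a unit times a square, and the integral model makes that unit a
square modulo 4 at v. -/
lemma IntPair.isSquare (hK : IsImaginaryQuadratic K) [IsPrincipalIdealRing (𝓞 K)]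
    (hv : v.valuation K 2 < 1) (h : IntPair v a b k) (hD0 : a ^ 2 - 4 * b ≠ 0)
    (hD : ∀ w : HeightOneSpectrum (𝓞 K), 2 ∣ ord w (a ^ 2 - 4 * b)) :
    ∃ d, a ^ 2 - 4 * b = d ^ 2 := by
  obtain ⟨ε, r, hr, hεr⟩ := exists_unit_mul_pow (m := 2) (by norm_num) hD0 hD
  obtain ⟨u, ρ, h1, h2⟩ := h.exists_sq
  have hε0 : algebraMap (𝓞 K) K ε ≠ 0 := by
    rintro h0
    rw [hεr, h0, zero_mul] at hD0
    exact hD0 rfl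
  have hε : v.valuation K (algebraMap (𝓞 K) K ε) = 1 :=
    (valuation_eq_one_iff hε0).mpr (ord_unit ε)
  have e : (a ^ 2 - 4 * b) * u ^ 4 = algebraMap (𝓞 K) K ε * (r * u ^ 2) ^ 2 := by
    rw [hεr]; ring
  rw [e] at h1 h2
  rw [map_mul, hε, one_mul] at h1
  have hy0 : (r * u ^ 2) ^ 2 ≠ 0 := ne_zero_of_valuation_eq_one h1
  have hu0 : u ≠ 0 := by rintro rfl; simp at hy0
  obtain ⟨w, hw⟩ := hK.unit_eq_sq hv ε (y := ρ / (r * u ^ 2)) (by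
    have e2 : algebraMap (𝓞 K) K ε * (r * u ^ 2) ^ 2 - ρ ^ 2 =
        (algebraMap (𝓞 K) K ε - (ρ / (r * u ^ 2)) ^ 2) * (r * u ^ 2) ^ 2 := by
      field_simp
    rwa [e2, map_mul, h1, mul_one] at h2)
  exact ⟨w * r, by rw [hεr, hw]; ring⟩

lemma LocalTypes.isSquare (hK : IsImaginaryQuadratic K) [IsPrincipalIdealRing (𝓞 K)]
    (h : LocalTypes p a b n) (hb0 : b ≠ 0) (hD0 : a ^ 2 - 4 * b ≠ 0)
    (hb : ∀ w : HeightOneSpectrum (𝓞 K), 2 ∣ ord w b)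
    (hD : ∀ w : HeightOneSpectrum (𝓞 K), 2 ∣ ord w (a ^ 2 - 4 * b)) :
    (∃ d, a ^ 2 - 4 * b = d ^ 2) ∨ ∃ d, (-2 * a) ^ 2 - 4 * (a ^ 2 - 4 * b) = d ^ 2 := by
  obtain ⟨v, hv⟩ := exists_valuation_two_lt hK
  have htype : (∃ k, IntPair v a b k) ∨ ∃ k, IntPair v (-2 * a) (a ^ 2 - 4 * b) k := by
    by_cases hvp : v = p
    · subst hvp
      exact h.at_prime.imp (fun ⟨k, hk, _⟩ => ⟨k, hk⟩) fun hk => ⟨_, hk⟩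
    · exact (h.away v hvp).imp (fun hk => ⟨_, hk⟩) fun hk => ⟨_, hk⟩
  have e : (-2 * a) ^ 2 - 4 * (a ^ 2 - 4 * b) = 16 * b := by ring
  refine htype.imp (fun ⟨k, hk⟩ => hk.isSquare hK hv hD0 hD) fun ⟨k, hk⟩ =>
    hk.isSquare hK hv (by rw [e]; exact mul_ne_zero (by norm_num) hb0) fun w => ?_
  rw [e, ord_mul (by norm_num) hb0, ord_sixteen]
  have := hb w
  omega

end TwoTorsionReduction

/-! ### Curves with full rational 2-torsion -/

namespace TwoTorsionReduction

open AdditiveValuation WithZero HeightOneSpectrum EllipticIsogeny ImaginaryQuadratic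
  WeierstrassCurve

variable {K : Type*} [Field K] [NumberField K] {v p : HeightOneSpectrum (𝓞 K)} {a b : K}
  {n k : ℤ} {x₀ x₁ x₂ : K}

/-- The elliptic curve `y² = x (x + x₂) (x - x₁)` with the differences `x₀`, `x₁`, `x₂` of the
abscissas of its points of order two, of prime conductor. -/
structure FullTwoTorsion (p : HeightOneSpectrum (𝓞 K)) (n : ℤ) (x₀ x₁ x₂ : K) : Prop where
  sum_eq : x₀ + x₁ + x₂ = 0
  reduction : PrimeReduction p (x₂ - x₁) (-(x₁ * x₂)) n

omit [NumberField K] in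
lemma smul_fullTwoTorsion (h : x₀ + x₁ + x₂ = 0) :
    (⟨1, x₁, 0, 0⟩ : VariableChange K) • twoTorsionCurve (x₂ - x₁) (-(x₁ * x₂)) =
      twoTorsionCurve (x₁ - x₀) (-(x₀ * x₁)) := by
  obtain rfl : x₂ = -x₀ - x₁ := by linear_combination h
  ext <;> simp [variableChange_def, twoTorsionCurve] <;> ring

namespace FullTwoTorsion

/-- Translating x by x₁ moves another point of order two to the origin, so any of the three
differences can play the part of x₀. -/
lemma rotate (h : FullTwoTorsion p n x₀ x₁ x₂) : FullTwoTorsion p n x₂ x₀ x₁ := by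
  refine ⟨by linear_combination h.sum_eq, fun v hv => ?_, ?_⟩ <;>
    rw [← smul_fullTwoTorsion h.sum_eq]
  · exact (h.reduction.good v hv).of_smul _
  · exact h.reduction.mult.of_smul _

lemma disc_eq (h : FullTwoTorsion p n x₀ x₁ x₂) :
    (x₂ - x₁) ^ 2 - 4 * -(x₁ * x₂) = x₀ ^ 2 := by
  obtain rfl : x₂ = -x₀ - x₁ := by linear_combination h.sum_eq
  ring

lemma ne_zero (h : FullTwoTorsion p n x₀ x₁ x₂) : x₀ ≠ 0 ∧ x₁ ≠ 0 ∧ x₂ ≠ 0 := by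
  obtain ⟨h1, h2⟩ := h.reduction.ne_zero
  rw [h.disc_eq] at h2
  rw [neg_ne_zero] at h1
  exact ⟨fun h0 => h2 (by rw [h0]; ring), left_ne_zero_of_mul h1, right_ne_zero_of_mul h1⟩

/-- Valuations for an integral pair. -/
lemma ord_add_of_intPair (h : FullTwoTorsion p n x₀ x₁ x₂)
    (hk : IntPair v (x₂ - x₁) (-(x₁ * x₂)) k) :
    ord v x₁ + ord v x₂ = 2 * ord v x₀ + 4 * ord v (2 : K) + k := by
  obtain ⟨h0, h1, h2⟩ := h.ne_zero
  obtain ⟨m, e1, e2⟩ := hk.exists_ord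
  rw [h.disc_eq, ord_pow] at e2
  rw [ord_neg, ord_mul h1 h2] at e1
  push_cast at e2
  omega

/-- Valuations for a dual integral pair. -/
lemma ord_add_of_dual (h : FullTwoTorsion p n x₀ x₁ x₂)
    (hk : IntPair v (-2 * (x₂ - x₁)) ((x₂ - x₁) ^ 2 - 4 * -(x₁ * x₂)) k) :
    ord v x₁ + ord v x₂ = 2 * ord v x₀ - 8 * ord v (2 : K) - k := by
  obtain ⟨h0, h1, h2⟩ := h.ne_zero
  obtain ⟨-, -, m, e1, e2⟩ := hk.exists_ord_dual
  rw [h.disc_eq, ord_pow] at e1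
  rw [ord_neg, ord_mul h1 h2] at e2
  push_cast at e1
  omega

variable (hK : IsImaginaryQuadratic K) [IsPrincipalIdealRing (𝓞 K)]
include hK

/-- For the dual type the sum would be 2 ord x₀ - 8 ord 2, which minimality of x₀ allows only where
2 is a unit; there the two formulas agree. -/
lemma ord_add_of_le (h : FullTwoTorsion p n x₀ x₁ x₂) (hv : v ≠ p)
    (h1 : ord v x₀ ≤ ord v x₁) (h2 : ord v x₀ ≤ ord v x₂) :
    ord v x₁ + ord v x₂ = 2 * ord v x₀ + 4 * ord v (2 : K) := by
  have h2n := ord_two_nonneg (K := K) v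
  rcases (h.reduction.localTypes hK).away v hv with hk | hk
  · have := h.ord_add_of_intPair hk
    omega
  · have := h.ord_add_of_dual hk
    omega

/-- Minimality of x₀ excludes the dual type at p, so the quotient by the origin has discriminant
valuation k, the exponent appearing in the product of the differences. -/
lemma ord_add_at_prime_of_le (h : FullTwoTorsion p n x₀ x₁ x₂)
    (h1 : ord p x₀ ≤ ord p x₁) (h2 : ord p x₀ ≤ ord p x₂) :
    ∃ k, 0 < k ∧ ord p x₁ + ord p x₂ = 2 * ord p x₀ + 4 * ord p (2 : K) + k ∧
      ∃ a' b', IsIsogenous (twoTorsionCurve (x₂ - x₁) (-(x₁ * x₂))) (twoTorsionCurve a' b') ∧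
        PrimeReduction p a' b' k := by
  have h2n := ord_two_nonneg (K := K) p
  have ht := h.reduction.localTypes hK
  have hn := ht.pos
  rcases ht.at_prime with ⟨k, hk, hnk⟩ | hk
  · exact ⟨k, by omega, h.ord_add_of_intPair hk, _, _, isIsogenous_twoTorsionCurve _ _,
      ht.primeReduction_dual hk (by omega)⟩
  · have := h.ord_add_of_dual hk
    omega

omit hK [IsPrincipalIdealRing (𝓞 K)] in
lemma isIsogenous_rotate (h : FullTwoTorsion p n x₀ x₁ x₂) :
    IsIsogenous (twoTorsionCurve (x₂ - x₁) (-(x₁ * x₂)))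
      (twoTorsionCurve (x₁ - x₀) (-(x₀ * x₁))) := by
  rw [← smul_fullTwoTorsion h.sum_eq]
  exact isIsogenous_variableChange _ _

lemma sum_ord (h : FullTwoTorsion p n x₀ x₁ x₂) (hv : v ≠ p) {m : ℤ} (h0 : m ≤ ord v x₀)
    (h1 : m ≤ ord v x₁) (h2 : m ≤ ord v x₂)
    (hm : m = ord v x₀ ∨ m = ord v x₁ ∨ m = ord v x₂) :
    ord v x₀ + ord v x₁ + ord v x₂ = 3 * m + 4 * ord v (2 : K) := by
  rcases hm with rfl | rfl | rfl
  · have := h.ord_add_of_le hK hv h1 h2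
    omega
  · have := h.rotate.rotate.ord_add_of_le hK hv h2 h0
    omega
  · have := h.rotate.ord_add_of_le hK hv h0 h1
    omega

lemma sum_ord_at_prime (h : FullTwoTorsion p n x₀ x₁ x₂) {m : ℤ} (h0 : m ≤ ord p x₀)
    (h1 : m ≤ ord p x₁) (h2 : m ≤ ord p x₂)
    (hm : m = ord p x₀ ∨ m = ord p x₁ ∨ m = ord p x₂) :
    ∃ k, 0 < k ∧ ord p x₀ + ord p x₁ + ord p x₂ = 3 * m + 4 * ord p (2 : K) + k ∧
      ∃ a' b', IsIsogenous (twoTorsionCurve (x₂ - x₁) (-(x₁ * x₂))) (twoTorsionCurve a' b') ∧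
        PrimeReduction p a' b' k := by
  have i1 := h.isIsogenous_rotate
  have i2 := i1.trans h.rotate.isIsogenous_rotate
  rcases hm with rfl | rfl | rfl
  · obtain ⟨k, hk, hs, a', b', hi, hr⟩ := h.ord_add_at_prime_of_le hK h1 h2
    exact ⟨k, hk, by omega, a', b', hi, hr⟩
  · obtain ⟨k, hk, hs, a', b', hi, hr⟩ := h.rotate.rotate.ord_add_at_prime_of_le hK h2 h0
    exact ⟨k, hk, by omega, a', b', i2.trans hi, hr⟩
  · obtain ⟨k, hk, hs, a', b', hi, hr⟩ := h.rotate.ord_add_at_prime_of_le hK h0 h1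
    exact ⟨k, hk, by omega, a', b', i1.trans hi, hr⟩

omit hK in
lemma exists_coprime (hx : x₀ + x₁ + x₂ = 0) (h0 : x₀ ≠ 0) :
    ∃ (c : K) (y₀ y₁ y₂ : 𝓞 K), c ≠ 0 ∧ IsCoprime y₀ y₁ ∧ y₀ + y₁ + y₂ = 0 ∧
      x₀ = c * algebraMap (𝓞 K) K y₀ ∧ x₁ = c * algebraMap (𝓞 K) K y₁ ∧
      x₂ = c * algebraMap (𝓞 K) K y₂ := by
  have hinj : Function.Injective (algebraMap (𝓞 K) K) := NumberField.RingOfIntegers.coe_injective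
  obtain ⟨r₀, s₀, hs₀, rfl⟩ := IsFractionRing.div_surjective (A := 𝓞 K) x₀
  obtain ⟨r₁, s₁, hs₁, rfl⟩ := IsFractionRing.div_surjective (A := 𝓞 K) x₁
  have hs₀' : algebraMap (𝓞 K) K s₀ ≠ 0 :=
    (map_ne_zero_iff _ hinj).mpr (nonZeroDivisors.ne_zero hs₀)
  have hs₁' : algebraMap (𝓞 K) K s₁ ≠ 0 :=
    (map_ne_zero_iff _ hinj).mpr (nonZeroDivisors.ne_zero hs₁)
  have hr₀ : r₀ ≠ 0 := by rintro rfl; simp at h0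
  have hrs : r₀ * s₁ ≠ 0 := mul_ne_zero hr₀ (nonZeroDivisors.ne_zero hs₁)
  obtain ⟨y₀, y₁, hco, g, h1, h2⟩ : ∃ y₀ y₁ : 𝓞 K, IsCoprime y₀ y₁ ∧ ∃ g,
      r₀ * s₁ = g * y₀ ∧ r₁ * s₀ = g * y₁ := by
    obtain ⟨g, hg⟩ := IsPrincipalIdealRing.principal (Ideal.span {r₀ * s₁, r₁ * s₀})
    rw [Ideal.submodule_span_eq] at hg
    have m0 : r₀ * s₁ ∈ Ideal.span {g} := by rw [← hg]; exact Ideal.subset_span (by simp)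
    have m1 : r₁ * s₀ ∈ Ideal.span {g} := by rw [← hg]; exact Ideal.subset_span (by simp)
    obtain ⟨y₀, e0⟩ := Ideal.mem_span_singleton.mp m0
    obtain ⟨y₁, e1⟩ := Ideal.mem_span_singleton.mp m1
    have hg0 : g ≠ 0 := by rintro rfl; rw [zero_mul] at e0; exact hrs e0
    have hgm : g ∈ Ideal.span {r₀ * s₁, r₁ * s₀} := by rw [hg]; exact Ideal.mem_span_singleton_self g
    obtain ⟨u, w, e⟩ := Ideal.mem_span_pair.mp hgm
    refine ⟨y₀, y₁, ⟨u, w, ?_⟩, g, e0, e1⟩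
    apply mul_left_cancel₀ hg0
    rw [e0, e1] at e
    linear_combination e
  have hg0 : g ≠ 0 := by rintro rfl; rw [zero_mul] at h1; exact hrs h1
  have e1 := congrArg (algebraMap (𝓞 K) K) h1
  have e2 := congrArg (algebraMap (𝓞 K) K) h2
  simp only [map_mul] at e1 e2
  have f0 : algebraMap (𝓞 K) K r₀ / algebraMap (𝓞 K) K s₀ =
      algebraMap (𝓞 K) K g / (algebraMap (𝓞 K) K s₀ * algebraMap (𝓞 K) K s₁) *
        algebraMap (𝓞 K) K y₀ := by
    field_simp
    linear_combination e1
  have f1 : algebraMap (𝓞 K) K r₁ / algebraMap (𝓞 K) K s₁ =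
      algebraMap (𝓞 K) K g / (algebraMap (𝓞 K) K s₀ * algebraMap (𝓞 K) K s₁) *
        algebraMap (𝓞 K) K y₁ := by
    field_simp
    linear_combination e2
  refine ⟨_, y₀, y₁, -y₀ - y₁, div_ne_zero ((map_ne_zero_iff _ hinj).mpr hg0)
    (mul_ne_zero hs₀' hs₁'), hco, by ring, f0, f1, ?_⟩
  rw [map_sub, map_neg]
  linear_combination hx - f0 - f1

/-- A curve of prime conductor with full rational two-torsion is isogenous to a curve whose minimal
discriminant has odd valuation. -/
lemma exists_odd (h : FullTwoTorsion p n x₀ x₁ x₂) :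
    ∃ a' b' k, Odd k ∧
      IsIsogenous (twoTorsionCurve (x₂ - x₁) (-(x₁ * x₂))) (twoTorsionCurve a' b') ∧
        PrimeReduction p a' b' k := by
  obtain ⟨h0, h1, h2⟩ := h.ne_zero
  have hinj : Function.Injective (algebraMap (𝓞 K) K) := NumberField.RingOfIntegers.coe_injective
  obtain ⟨c, y₀, y₁, y₂, hc, hco, hsum, e0, e1, e2⟩ := exists_coprime h.sum_eq h0
  have hy0 : algebraMap (𝓞 K) K y₀ ≠ 0 := by intro h'; rw [e0, h', mul_zero] at h0; exact h0 rfl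
  have hy1 : algebraMap (𝓞 K) K y₁ ≠ 0 := by intro h'; rw [e1, h', mul_zero] at h1; exact h1 rfl
  have hy2 : algebraMap (𝓞 K) K y₂ ≠ 0 := by intro h'; rw [e2, h', mul_zero] at h2; exact h2 rfl
  have o0 : ∀ v : HeightOneSpectrum (𝓞 K), ord v x₀ = ord v c + ord v (algebraMap (𝓞 K) K y₀) :=
    fun v => by rw [e0, ord_mul hc hy0]
  have o1 : ∀ v : HeightOneSpectrum (𝓞 K), ord v x₁ = ord v c + ord v (algebraMap (𝓞 K) K y₁) :=
    fun v => by rw [e1, ord_mul hc hy1]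
  have o2 : ∀ v : HeightOneSpectrum (𝓞 K), ord v x₂ = ord v c + ord v (algebraMap (𝓞 K) K y₂) :=
    fun v => by rw [e2, ord_mul hc hy2]
  have nn : ∀ (v : HeightOneSpectrum (𝓞 K)) {y : 𝓞 K}, algebraMap (𝓞 K) K y ≠ 0 →
      0 ≤ ord v (algebraMap (𝓞 K) K y) := fun v y hy =>
    (valuation_le_one_iff hy).mp (v.valuation_le_one y)
  -- Coprimality of y₀ and y₁ makes the valuation of c the minimum everywhere.
  have hmin : ∀ v : HeightOneSpectrum (𝓞 K), ord v c = ord v x₀ ∨ ord v c = ord v x₁ := by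
    intro v
    by_contra hne
    rw [not_or, o0, o1] at hne
    have m0 : y₀ ∈ v.asIdeal := by
      rw [← v.valuation_lt_one_iff_mem (K := K)]
      exact (valuation_lt_one_iff hy0).mpr (by have := nn v hy0; omega)
    have m1 : y₁ ∈ v.asIdeal := by
      rw [← v.valuation_lt_one_iff_mem (K := K)]
      exact (valuation_lt_one_iff hy1).mpr (by have := nn v hy1; omega)
    obtain ⟨u, w, huw⟩ := hco
    apply v.isPrime.one_notMem
    rw [← huw]
    exact v.asIdeal.add_mem (v.asIdeal.mul_mem_left _ m0) (v.asIdeal.mul_mem_left _ m1)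
  have hmin' : ∀ v : HeightOneSpectrum (𝓞 K),
      ord v c = ord v x₀ ∨ ord v c = ord v x₁ ∨ ord v c = ord v x₂ := fun v =>
    (hmin v).imp_right .inl
  have l0 : ∀ v : HeightOneSpectrum (𝓞 K), ord v c ≤ ord v x₀ := fun v => by
    have := nn v hy0; rw [o0]; omega
  have l1 : ∀ v : HeightOneSpectrum (𝓞 K), ord v c ≤ ord v x₁ := fun v => by
    have := nn v hy1; rw [o1]; omega
  have l2 : ∀ v : HeightOneSpectrum (𝓞 K), ord v c ≤ ord v x₂ := fun v => by
    have := nn v hy2; rw [o2]; omega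
  obtain ⟨k, hk, hs, a', b', hi, hr⟩ := h.sum_ord_at_prime hK (l0 p) (l1 p) (l2 p) (hmin' p)
  refine ⟨a', b', k, ?_, hi, hr⟩
  by_contra hodd
  rw [Int.not_odd_iff_even] at hodd
  obtain ⟨j, hj⟩ := hodd
  obtain ⟨π, hπ, -, hπ1, hπ0⟩ := exists_generator p K
  obtain ⟨j, rfl⟩ := Int.eq_ofNat_of_zero_le (a := j) (by omega)
  have hπne : algebraMap (𝓞 K) K π ≠ 0 := (map_ne_zero_iff _ hinj).mpr hπ.ne_zero
  -- The product y₀y₁y₂ has valuation 4 ord 2 at every prime, with an extra k = 2j at p, exactly as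
  -- 16 π^(2j).
  obtain ⟨u, hu⟩ := exists_unit_mul_of_ord_eq (R := 𝓞 K)
    (x := algebraMap (𝓞 K) K y₀ * algebraMap (𝓞 K) K y₁ * algebraMap (𝓞 K) K y₂)
    (y := 16 * algebraMap (𝓞 K) K π ^ (2 * j)) (mul_ne_zero (mul_ne_zero hy0 hy1) hy2)
    (mul_ne_zero (by norm_num) (pow_ne_zero _ hπne)) fun v => by
      rw [ord_mul (mul_ne_zero hy0 hy1) hy2, ord_mul hy0 hy1,
        ord_mul (by norm_num) (pow_ne_zero _ hπne), ord_pow, ord_sixteen]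
      by_cases hv : v = p
      · subst hv
        rw [o0, o1, o2] at hs
        rw [hπ1]
        push_cast
        omega
      · have := h.sum_ord hK hv (l0 v) (l1 v) (l2 v) (hmin' v)
        rw [o0, o1, o2] at this
        rw [hπ0 v hv]
        push_cast
        omega
  have hprod : y₀ * y₁ * y₂ = 16 * π ^ (2 * j) * u := by
    apply hinj
    simp only [map_mul, map_pow, map_ofNat]
    rw [hu]; ring
  have h02 : IsCoprime y₀ y₂ := by
    obtain rfl : y₂ = -y₁ + y₀ * (-1) := by linear_combination hsum
    exact IsCoprime.add_mul_left_right hco.neg_right _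
  have h12 : IsCoprime y₁ y₂ := by
    obtain rfl : y₂ = -y₀ + y₁ * (-1) := by linear_combination hsum
    exact IsCoprime.add_mul_left_right hco.symm.neg_right _
  exact hK.unitEquation u.isUnit hπ (j := j) (by omega) hco h02 h12 hprod hsum

end FullTwoTorsion

/-! ### Reduction to full 2-torsion when all exponents are even -/

section

variable (hK : IsImaginaryQuadratic K) [IsPrincipalIdealRing (𝓞 K)]
include hK

lemma PrimeReduction.exists_odd_of_sq (h : PrimeReduction p a b n) {d : K}
    (hd : a ^ 2 - 4 * b = d ^ 2) :
    ∃ a' b' k, Odd k ∧ IsIsogenous (twoTorsionCurve a b) (twoTorsionCurve a' b') ∧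
      PrimeReduction p a' b' k := by
  have ha : (a - d) / 2 - (-a - d) / 2 = a := by ring
  have hb : -((-a - d) / 2 * ((a - d) / 2)) = b := by linear_combination hd / 4
  have hf : FullTwoTorsion p n d ((-a - d) / 2) ((a - d) / 2) :=
    ⟨by ring, by rwa [ha, hb]⟩
  have := hf.exists_odd hK
  rwa [ha, hb] at this

/-- A curve of prime conductor with a rational point of order two is isogenous to a curve whose
minimal discriminant has odd valuation. -/
theorem PrimeReduction.exists_odd (h : PrimeReduction p a b n) :
    ∃ a' b' k, Odd k ∧ IsIsogenous (twoTorsionCurve a b) (twoTorsionCurve a' b') ∧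
      PrimeReduction p a' b' k := by
  have ht := h.localTypes hK
  obtain ⟨hb0, hD0⟩ := h.ne_zero
  have hdual := isIsogenous_twoTorsionCurve a b
  rcases Int.even_or_odd n with hn | hn
  swap
  · refine ⟨a, b, n, hn, ?_, h⟩
    have := isIsogenous_variableChange (twoTorsionCurve a b) 1
    rwa [one_smul] at this
  by_cases hodd : ∃ k, Odd k ∧ n = 2 * k ∧ IntPair p a b k
  · obtain ⟨k, hk, hnk, hi⟩ := hodd
    exact ⟨_, _, k, hk, hdual, ht.primeReduction_dual hi (by have := ht.pos; omega)⟩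
  have heven : ∀ w : HeightOneSpectrum (𝓞 K), 2 ∣ ord w b ∧ 2 ∣ ord w (a ^ 2 - 4 * b) := by
    have hint : ∀ (w : HeightOneSpectrum (𝓞 K)) (k : ℤ), Even k → IntPair w a b k →
        2 ∣ ord w b ∧ 2 ∣ ord w (a ^ 2 - 4 * b) := by
      rintro w k ⟨i, hi⟩ hk
      obtain ⟨m, h1, h2⟩ := hk.exists_ord
      omega
    have hint' : ∀ (w : HeightOneSpectrum (𝓞 K)) (k : ℤ), Even k →
        IntPair w (-2 * a) (a ^ 2 - 4 * b) k →
        2 ∣ ord w b ∧ 2 ∣ ord w (a ^ 2 - 4 * b) := by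
      rintro w k ⟨i, hi⟩ hk
      obtain ⟨-, -, m, h1, h2⟩ := hk.exists_ord_dual
      omega
    intro w
    by_cases hw : w = p
    · subst hw
      rcases ht.at_prime with ⟨k, hk, hnk⟩ | hk
      · refine hint _ k ?_ hk
        by_contra hk'
        exact hodd ⟨k, Int.not_even_iff_odd.mp hk', hnk, hk⟩
      · exact hint' _ n hn hk
    · rcases ht.away w hw with hk | hk
      · exact hint _ 0 Even.zero hk
      · exact hint' _ 0 Even.zero hk
  rcases ht.isSquare hK hb0 hD0 (fun w => (heven w).1) (fun w => (heven w).2) with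
    ⟨d, hd⟩ | ⟨d, hd⟩
  · exact h.exists_odd_of_sq hK hd
  -- Here the dual curve has full 2-torsion, and the result is composed with the 2-isogeny onto it.
  · obtain ⟨n', h'⟩ := ht.exists_primeReduction_dual
    obtain ⟨a', b', k, hk, hi, hr⟩ := h'.exists_odd_of_sq hK hd
    exact ⟨a', b', k, hk, hdual.trans hi, hr⟩

end

end TwoTorsionReduction

/-! ### Conductor and minimal discriminant in terms of the local conditions -/

namespace EllipticConductor

open AdditiveValuation WithZero HeightOneSpectrum EllipticIsogeny ImaginaryQuadratic
  WeierstrassCurve TwoTorsionReduction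

variable {K : Type*} [Field K] [NumberField K] {E : WeierstrassCurve K}
  {v p : HeightOneSpectrum (𝓞 K)}

/-- The prime of the valuation ring of `v`. -/
abbrev localPrime (v : HeightOneSpectrum (𝓞 K)) :
    HeightOneSpectrum (v.valuation K).integer :=
  IsDiscreteValuationRing.maximalIdeal (v.valuation K).integer

lemma localPrime_valuation_le_one_iff (x : K) :
    (localPrime v).valuation K x ≤ 1 ↔ v.valuation K x ≤ 1 := by
  constructor
  · intro h
    obtain ⟨r, hr⟩ := IsDiscreteValuationRing.exists_lift_of_le_one h
    rw [← hr]
    exact r.2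
  · intro h
    exact (localPrime v).valuation_le_one (K := K) ⟨x, h⟩

/-- The two valuations have the same valuation ring, and for nonzero x value one means that x and
x⁻¹ both lie in it. -/
lemma localPrime_valuation_eq_one_iff {x : K} :
    (localPrime v).valuation K x = 1 ↔ v.valuation K x = 1 := by
  by_cases hx : x = 0
  · simp [hx]
  have h1 : ∀ {Γ : Type} [LinearOrderedCommGroupWithZero Γ] (V : Valuation K Γ),
      V x = 1 ↔ V x ≤ 1 ∧ V x⁻¹ ≤ 1 := by
    intro Γ _ V
    rw [map_inv₀, inv_le_one₀ (zero_lt_iff.mpr ((V.ne_zero_iff).mpr hx))]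
    exact le_antisymm_iff
  rw [h1, h1, localPrime_valuation_le_one_iff, localPrime_valuation_le_one_iff]

lemma isIntegralAt_of_isIntegral {W : WeierstrassCurve K}
    (h : WeierstrassCurve.IsIntegral (v.valuation K).integer W) : IsIntegralAt v W := by
  obtain ⟨W', rfl⟩ := h.integral
  exact ⟨W'.a₁.2, W'.a₂.2, W'.a₃.2, W'.a₄.2, W'.a₆.2⟩

lemma goodAt_of_conductorExponent (h : conductorExponent E v = 0) : GoodAt v E := by
  unfold conductorExponent at h
  split_ifs at h with h1 h2
  · refine ⟨_, isIntegralAt_of_isIntegral (v := v) (W := minimalAt E v) inferInstance, ?_⟩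
    exact localPrime_valuation_eq_one_iff.mp h1.goodReduction
  · omega

lemma multAt_of_conductorExponent [E.IsElliptic] (h : conductorExponent E v = 1) :
    MultAt v E (minimalDiscriminantValuation E v) := by
  unfold conductorExponent at h
  split_ifs at h with h1 h2
  · have hΔ : (minimalAt E v).Δ ≠ 0 := by
      change ((E.exists_isMinimal (v.valuation K).integer).choose • E).Δ ≠ 0
      rw [variableChange_Δ]
      exact mul_ne_zero (pow_ne_zero _ (Units.ne_zero _)) E.isUnit_Δ.ne_zero
    have hint := isIntegralAt_of_isIntegral (v := v) (W := minimalAt E v) inferInstance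
    have hlt : v.valuation K (minimalAt E v).Δ < 1 := by
      have h3 := h2.badReduction
      refine lt_of_le_of_ne ((localPrime_valuation_le_one_iff _).mp h3.le) fun h4 => ?_
      exact h3.ne (localPrime_valuation_eq_one_iff.mpr h4)
    exact ⟨(valuation_lt_one_iff hΔ).mp hlt, _, hint,
      localPrime_valuation_eq_one_iff.mp h2.multiplicativeReduction, hΔ, rfl⟩
  · omega

lemma conductorExponent_of_conductor_eq (h : conductor E = p.asIdeal) :
    (∀ v ≠ p, conductorExponent E v = 0) ∧ conductorExponent E p = 1 := by
  have hfin : (Function.mulSupport fun v : HeightOneSpectrum (𝓞 K) =>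
      v.asIdeal ^ conductorExponent E v).Finite := by
    -- With infinite support `finprod` takes the default value 1, the unit ideal, which is not
    -- prime.
    by_contra hinf
    rw [conductor, finprod_of_infinite_mulSupport hinf] at h
    exact p.isPrime.ne_top (by rw [← h, Ideal.one_eq_top])
  have haway : ∀ v ≠ p, conductorExponent E v = 0 := by
    intro v hv
    by_contra hne
    apply hv
    have hmem : v ∈ hfin.toFinset := by
      rw [Set.Finite.mem_toFinset, Function.mem_mulSupport, Ideal.one_eq_top]
      exact fun htop => v.isPrime.ne_top (top_le_iff.mp (htop ▸ Ideal.pow_le_self hne))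
    have hdvd := Finset.dvd_prod_of_mem (fun v : HeightOneSpectrum (𝓞 K) =>
      v.asIdeal ^ conductorExponent E v) hmem
    rw [← finprod_eq_prod _ hfin] at hdvd
    change _ ∣ conductor E at hdvd
    rw [h] at hdvd
    have hle : p.asIdeal ≤ v.asIdeal := Ideal.le_of_dvd ((dvd_pow_self _ hne).trans hdvd)
    exact HeightOneSpectrum.ext (p.isMaximal.eq_of_le v.isPrime.ne_top hle).symm
  refine ⟨haway, ?_⟩
  rw [conductor, finprod_eq_single _ p fun v hv => by rw [haway v hv, pow_zero]] at h
  exact (Ideal.pow_right_strictAnti p.asIdeal p.ne_bot p.isPrime.ne_top).injective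
    (by simpa using h)

/-- Discriminants of two models differ by a twelfth power, so the parity can be read off any model.
-/
lemma odd_minimalDiscriminantValuation {n : ℤ} (h : MultAt v E n) (hn : Odd n) :
    Odd (minimalDiscriminantValuation E v) := by
  obtain ⟨-, C, -, -, hΔ, rfl⟩ := h
  set C' := (E.exists_isMinimal (v.valuation K).integer).choose
  have e : minimalDiscriminantValuation E v = ord v (C' • E).Δ := rfl
  rw [variableChange_Δ] at hΔ hn
  have hΔ0 := right_ne_zero_of_mul hΔ
  have hC := left_ne_zero_of_mul hΔ
  rw [ord_mul hC hΔ0, ord_pow] at hn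
  rw [e, variableChange_Δ, ord_mul (pow_ne_zero _ (Units.ne_zero _)) hΔ0, ord_pow]
  push_cast at hn ⊢
  rw [Int.odd_iff] at hn ⊢
  omega

lemma exists_smul_eq_twoTorsionCurve (h : ∃ P : E.toAffine.Point, addOrderOf P = 2) :
    ∃ (C : VariableChange K) (a b : K), C • E = twoTorsionCurve a b := by
  obtain ⟨P, hP⟩ := h
  have h2 : P + P = 0 := by
    rw [← two_nsmul, ← hP, addOrderOf_nsmul_eq_zero]
  have h0 : P ≠ 0 := by
    rintro rfl
    simp at hP
  rcases P with _ | ⟨x, y, hxy⟩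
  · exact absurd rfl h0
  rw [add_eq_zero_iff_eq_neg, Affine.Point.neg_some, Affine.Point.some.injEq] at h2
  have hy := h2.2
  have heq := (Affine.equation_iff _ _).mp hxy.1
  rw [Affine.negY] at hy
  -- The shear -a₁/2 removes the xy term; the y term then vanishes because the point equals its
  -- negative.
  refine ⟨⟨1, x, -E.a₁ / 2, y⟩, E.a₂ + E.a₁ ^ 2 / 4 + 3 * x,
    E.a₄ + E.a₁ * E.a₃ / 2 + 2 * x * E.a₂ + x * E.a₁ ^ 2 / 2 + 3 * x ^ 2, ?_⟩
  ext <;> simp only [variableChange_def, twoTorsionCurve, inv_one, Units.val_one]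
  · ring
  · ring
  · linear_combination hy
  · ring
  · linear_combination -heq

/-- An elliptic curve of prime conductor with a rational point of order two is isogenous to a curve
whose minimal discriminant has odd valuation. -/
theorem exists_isIsogenous_odd (hquad : Module.finrank ℚ K = 2)
    (himag : NumberField.IsTotallyComplex K) (hclass : NumberField.classNumber K = 1)
    [E.IsElliptic] (hcond : conductor E = p.asIdeal)
    (htors : ∃ P : E.toAffine.Point, addOrderOf P = 2) :
    ∃ E' : WeierstrassCurve K, E'.IsElliptic ∧ IsIsogenous E E' ∧
      Odd (minimalDiscriminantValuation E' p) := by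
  have hK : ImaginaryQuadratic.IsImaginaryQuadratic K := ⟨hquad, himag⟩
  have : IsPrincipalIdealRing (𝓞 K) := NumberField.classNumber_eq_one_iff.mp hclass
  obtain ⟨haway, hp⟩ := conductorExponent_of_conductor_eq hcond
  obtain ⟨C, a, b, hC⟩ := exists_smul_eq_twoTorsionCurve htors
  have hred : PrimeReduction p a b (minimalDiscriminantValuation E p) := by
    refine ⟨fun v hv => ?_, ?_⟩ <;> rw [← hC]
    · exact (goodAt_of_conductorExponent (haway v hv)).of_smul C
    · exact (multAt_of_conductorExponent hp).of_smul C
  obtain ⟨a', b', k, hk, hiso, hred'⟩ := hred.exists_odd hK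
  refine ⟨twoTorsionCurve a' b', ?_, ?_, odd_minimalDiscriminantValuation hred'.mult hk⟩
  · obtain ⟨hb, hD⟩ := hred'.ne_zero
    rw [WeierstrassCurve.isElliptic_iff, isUnit_iff_ne_zero]
    have e : (twoTorsionCurve a' b').Δ = 16 * b' ^ 2 * (a' ^ 2 - 4 * b') := by
      simp only [WeierstrassCurve.Δ, WeierstrassCurve.b₂, WeierstrassCurve.b₄, WeierstrassCurve.b₆,
        WeierstrassCurve.b₈, twoTorsionCurve]
      ring
    rw [e]
    exact mul_ne_zero (mul_ne_zero (by norm_num) (pow_ne_zero _ hb)) hD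
  · have h1 := isIsogenous_variableChange E C
    rw [hC] at h1
    exact h1.trans hiso

end EllipticConductor

end

theorem mainTheorem11 (K : Type*) [Field K] [NumberField K]
    (hquad : Module.finrank ℚ K = 2) (himag : NumberField.IsTotallyComplex K)
    (hclass : NumberField.classNumber K = 1)
    (E : WeierstrassCurve K) [E.IsElliptic]
    (p : HeightOneSpectrum (𝓞 K))
    (hcond : EllipticConductor.conductor E = p.asIdeal)
    (htors : ∃ P : E.toAffine.Point, addOrderOf P = 2) :
    ∃ E' : WeierstrassCurve K, E'.IsElliptic ∧ EllipticIsogeny.IsIsogenous E E' ∧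
      Odd (EllipticConductor.minimalDiscriminantValuation E' p) :=
  EllipticConductor.exists_isIsogenous_odd hquad himag hclass hcond htors
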